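/- Let $n\ge 1$, $a\in(-1,1)$, $\lambda_+,\lambda_->0$. Write $x=(x',x_n)\in\mathbb{R}^{n-1}\times\mathbb{R}$, $B_r=\{|x|<r\}$, $B_r'=B_r\cap\{x_n=0\}$, $v^\pm=\max\{\pm v,0\}$. Let $W^{1,2}(B_1,|x_n|^a)$ be the space of functions in $L^2(B_1,|x_n|^a)$ whose distributional first derivatives in $B_1$ belong to $L^2(B_1,|x_n|^a)$; values of such functions on $B_1'$ and on spheres $\partial B_r$ are understood in the sense of traces. Let $g\in L^2(\partial B_1,|x_n|^a)$ be even in $x_n$, and let $u\in W^{1,2}(B_1,|x_n|^a)$ be a minimizer of $$J_a(v)=\frac12\int_{B_1}|\nabla v|^2|x_n|^a\,dx+2\int_{B_1'}(\lambda_+v^++\lambda_-v^-)\,dx'$$ among all $v\in W^{1,2}(B_1,|x_n|^a)$ with $v=g$ on $\partial B_1$. Then $u$ has a trace in $L^2(B_1')$ and, for each $0<r<1$, a trace in $L^2(\partial B_r,|x_n|^a)$, and the function $$W(r)=\frac1{r^{n-a}}\int_{B_r}|\nabla u|^2|x_n|^a\,dx+\frac4{r^{n-a}}\int_{B_r'}(\lambda_+u^++\lambda_-u^-)\,dx'-\frac{1-a}{r^{n+1-a}}\int_{\partial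 B_r}u^2|x_n|^a\,d\mathcal H^{n-1}$$ is nondecreasing for $0<r<1$. Moreover, for all $0\le r_1<r_2\le1$, $W$ is constant on $(r_1,r_2)$ if and only if $u$ is homogeneous of degree $1-a$ in the ring $r_1<|x|<r_2$, that is, for every $t>0$, $u(tx)=t^{1-a}u(x)$ for almost every $x$ such that $x$ and $tx$ lie in the ring. -/

import Mathlib

open MeasureTheory Set Metric
open scoped ContDiff

namespace TwoPhase

/-- The ambient space `ℝⁿ` with `n = d + 1`; the last coordinate is `xₙ`, the thin space is
`ℝᵈ × {0}`. -/
abbrev Space (d : ℕ) : Type := EuclideanSpace ℝ (Fin (d + 1))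

/-- The last coordinate `xₙ` of a point. -/
def lastCoord {d : ℕ} (x : Space d) : ℝ := x (Fin.last d)

/-- The embedding `x' ↦ (x', 0)` of `ℝᵈ` onto the thin space. -/
def thinEmbedding (d : ℕ) (y : EuclideanSpace ℝ (Fin d)) : Space d :=
  WithLp.toLp 2 (Fin.snoc (α := fun _ => ℝ) (fun i => y i) 0)

/-- The reflection `(x', xₙ) ↦ (x', -xₙ)`. -/
def reflection {d : ℕ} (x : Space d) : Space d :=
  WithLp.toLp 2 (Fin.snoc (α := fun _ => ℝ) (fun i => x (Fin.castSucc i)) (-lastCoord x))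

/-- The weight `|xₙ|ᵃ`. -/
noncomputable def weight {d : ℕ} (a : ℝ) (x : Space d) : ℝ := |lastCoord x| ^ a

/-- The measure `|xₙ|ᵃ dμ`. -/
noncomputable def weighted {d : ℕ} (a : ℝ) (μ : Measure (Space d)) : Measure (Space d) :=
  μ.withDensity (fun x => ENNReal.ofReal (weight a x))

/-- Lebesgue measure `dx'` of the thin space, as a measure on `ℝⁿ`. -/
noncomputable def thinMeasure (d : ℕ) : Measure (Space d) :=
  (volume : Measure (EuclideanSpace ℝ (Fin d))).map (thinEmbedding d)

/-- The surface measure of the sphere `∂B_r`, `r > 0`, as a measure on `ℝⁿ`: the image of the surface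
measure of the unit sphere under `p ↦ r p`, times `rⁿ⁻¹`. -/
noncomputable def sphereMeasure (d : ℕ) (r : ℝ) : Measure (Space d) :=
  ENNReal.ofReal (r ^ d) • Measure.map (fun p : sphere (0 : Space d) 1 => r • p.1)
    (volume : Measure (Space d)).toSphere

/-- The `i`-th partial derivative of a (smooth) function. -/
noncomputable def partialDeriv {d : ℕ} (i : Fin (d + 1)) (φ : Space d → ℝ) (x : Space d) : ℝ :=
  fderiv ℝ φ x (EuclideanSpace.single i 1)

/-- `G` is the distributional gradient of `u` in the unit ball. -/
structure IsWeakGradient {d : ℕ} (u : Space d → ℝ) (G : Space d → Space d) : Prop where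
  locallyIntegrable : LocallyIntegrableOn u (ball 0 1)
  locallyIntegrable_grad : LocallyIntegrableOn G (ball 0 1)
  integral_eq : ∀ (i : Fin (d + 1)) (φ : Space d → ℝ), ContDiff ℝ ∞ φ → HasCompactSupport φ →
    tsupport φ ⊆ ball 0 1 →
    ∫ x in ball 0 1, u x * partialDeriv i φ x = -∫ x in ball 0 1, G x i * φ x

open Classical in
/-- The distributional gradient of `u` in the unit ball (unique up to null sets; `0` if there is
none). -/
noncomputable def weakGradient {d : ℕ} (u : Space d → ℝ) : Space d → Space d :=
  if h : ∃ G, IsWeakGradient u G then h.choose else 0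

/-- The weighted Sobolev space `W^{1,2}(B₁, |xₙ|ᵃ)`. -/
structure MemSobolev {d : ℕ} (a : ℝ) (u : Space d → ℝ) : Prop where
  memLp : MemLp u 2 ((weighted a volume).restrict (ball 0 1))
  exists_grad : ∃ G, IsWeakGradient u G ∧ MemLp G 2 ((weighted a volume).restrict (ball 0 1))

/-- `T ∈ L²(B₁')` is the trace of `u` on the thin ball `B₁'`, in the sense of the Gauss-Green formula
in the upper half ball, whose outer normal on `B₁'` is `-eₙ`. It is unique almost everywhere. -/
structure IsThinTrace {d : ℕ} (u T : Space d → ℝ) : Prop where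
  memLp : MemLp T 2 ((thinMeasure d).restrict (ball 0 1))
  gauss_green : ∀ φ : Space d → ℝ, ContDiff ℝ ∞ φ → HasCompactSupport φ → tsupport φ ⊆ ball 0 1 →
    ∫ x in ball 0 1 ∩ {x : Space d | 0 < lastCoord x},
        (u x * partialDeriv (Fin.last d) φ x + lastCoord (weakGradient u x) * φ x) =
      -∫ x in ball 0 1, T x * φ x ∂(thinMeasure d)

/-- `T ∈ L²(∂B_r, |xₙ|ᵃ)` is the trace of `u` on `∂B_r`, `0 < r ≤ 1`, in the sense of the Gauss-Green
formula in `B_r`, whose outer normal is `x / r`. It is unique almost everywhere on `∂B_r`. -/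
structure IsSphereTrace {d : ℕ} (a : ℝ) (u : Space d → ℝ) (r : ℝ) (T : Space d → ℝ) : Prop where
  memLp : MemLp T 2 (weighted a (sphereMeasure d r))
  gauss_green : ∀ (i : Fin (d + 1)) (φ : Space d → ℝ), ContDiff ℝ ∞ φ → HasCompactSupport φ →
    ∫ x in ball 0 r, (u x * partialDeriv i φ x + weakGradient u x i * φ x) =
      ∫ x, T x * φ x * (x i / r) ∂(sphereMeasure d r)

open Classical in
/-- The trace of `u` on the thin ball `B₁'`. -/
noncomputable def thinTrace {d : ℕ} (u : Space d → ℝ) : Space d → ℝ :=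
  if h : ∃ T, IsThinTrace u T then h.choose else 0

open Classical in
/-- The trace of `u` on the sphere `∂B_r`. -/
noncomputable def sphereTrace {d : ℕ} (a : ℝ) (u : Space d → ℝ) (r : ℝ) : Space d → ℝ :=
  if h : ∃ T, IsSphereTrace a u r T then h.choose else 0

/-- The weighted Dirichlet energy `∫_{B_r} |∇u|² |xₙ|ᵃ`. -/
noncomputable def dirichletEnergy {d : ℕ} (a : ℝ) (u : Space d → ℝ) (r : ℝ) : ℝ :=
  ∫ x in ball 0 r, ‖weakGradient u x‖ ^ 2 * weight a x

/-- The thin energy `∫_{B_r'} (λ₊ u⁺ + λ₋ u⁻)`. -/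
noncomputable def thinEnergy {d : ℕ} (lamP lamM : ℝ) (u : Space d → ℝ) (r : ℝ) : ℝ :=
  ∫ x in ball 0 r, (lamP * max (thinTrace u x) 0 + lamM * max (-thinTrace u x) 0) ∂(thinMeasure d)

/-- The functional `J_a(u) = ½ ∫_{B₁} |∇u|² |xₙ|ᵃ + 2 ∫_{B₁'} (λ₊ u⁺ + λ₋ u⁻)`. -/
noncomputable def energy {d : ℕ} (a lamP lamM : ℝ) (u : Space d → ℝ) : ℝ :=
  1 / 2 * dirichletEnergy a u 1 + 2 * thinEnergy lamP lamM u 1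

/-- `u` minimizes `J_a` among all functions of `W^{1,2}(B₁, |xₙ|ᵃ)` whose trace on `∂B₁` is `g`. -/
structure IsMinimizer {d : ℕ} (a lamP lamM : ℝ) (g u : Space d → ℝ) : Prop where
  memSobolev : MemSobolev a u
  trace_eq : IsSphereTrace a u 1 g
  energy_le : ∀ v : Space d → ℝ, MemSobolev a v → IsSphereTrace a v 1 g →
    energy a lamP lamM u ≤ energy a lamP lamM v

/-- The Weiss energy `W(r, u)`, where `n = d + 1`. -/
noncomputable def weiss {d : ℕ} (a lamP lamM : ℝ) (u : Space d → ℝ) (r : ℝ) : ℝ :=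
  1 / r ^ ((d : ℝ) + 1 - a) * dirichletEnergy a u r
    + 4 / r ^ ((d : ℝ) + 1 - a) * thinEnergy lamP lamM u r
    - (1 - a) / r ^ ((d : ℝ) + 1 + 1 - a) *
      ∫ x, sphereTrace a u r x ^ 2 * weight a x ∂(sphereMeasure d r)

/-- The function `u`, defined up to null sets, is homogeneous of degree `k` in the ring
`r₁ < |x| < r₂`. -/
def IsHomogeneousInRing {d : ℕ} (k : ℝ) (u : Space d → ℝ) (r₁ r₂ : ℝ) : Prop :=
  ∀ t : ℝ, 0 < t → ∀ᵐ x : Space d, ‖x‖ ∈ Ioo r₁ r₂ → ‖t • x‖ ∈ Ioo r₁ r₂ → u (t • x) = t ^ k * u x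

end TwoPhase

/-! Put `κ = 1 - a` and `N = d + 1 - a`, let `w = |xₙ|ᵃ`, and let `E(r)` be the energy `½ ∫ |∇u|² w
+ 2 ∫' (λ₊ u⁺ + λ₋ u⁻)` of the ball of radius `r`. The Weiss energy is `W(r) = 2 r^(-N) E(r) - κ
S(r)`, where `S(r)` is the integral of `(r^(-κ) u(rθ))² w(θ)` over the unit sphere. Everything
follows from the exact identity, for `0 < p < q < 1`, `W(q) - W(p) = 2 ∫_{p<|y|<q} |y|^(-N-2) (⟨y,
∇u⟩ - κ u)² w`, which is `IsMinimizer.weiss_sub`. Its right-hand side is nonnegative, and it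
vanishes exactly when Euler's relation `⟨y, ∇u⟩ = κ u` holds almost everywhere in the ring.

The energy part comes from inner variations, so that no regularity of the minimizer is needed. With
`q(y) = 1 + ε F(|y|²)` and `Ψ(y) = q(y) y`, the competitor is `(q^κ u) ∘ Ψ⁻¹`, which equals `u` near
the unit sphere when `F` vanishes there. Radial maps preserve the thin space, the thin density is
positively homogeneous of degree one, and `κ = 1 - a` is the amplitude for which the Dirichlet and
the thin energy both scale with the power `q^N` (`IsSmallProfile.energyDensity_transport`,
`IsSmallProfile.thinDensity_transport`). The derivative at `ε = 0` gives `IsMinimizer.stationary`.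
The profile with `F'(t) = t^(-N/2-1)` on the ring makes `N F + 2 t F'` a combination of the
indicator functions of two balls, and stationarity becomes `q^(-N) E(q) - p^(-N) E(p) = ∫ |y|^(-N-2)
(⟨y, ∇u⟩² - κ u ⟨y, ∇u⟩) w`, which is `IsMinimizer.localEnergy_sub`.

The sphere part holds for every Sobolev function. On almost every ray `u` is absolutely continuous,
and integrating the derivative of `(r^(-κ) u(rθ))²` gives `S(q) - S(p) = 2 ∫ |y|^(-N-2) (u ⟨y, ∇u⟩ -
κ u²) w`, which is `IsSobolevPair.sphereEnergy_sub`. Twice the first identity minus `κ` times the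
second completes the square.

In the case of equality, Euler's relation says that `r^(-κ) u(rθ)` is constant in `r` on almost
every ray, which is homogeneity (`IsSobolevPair.isHomogeneousInRing_iff`).

Traces are handled by explicit formulas, `thinFormula` and `rayValue`. They recover the values of
`C¹` functions from integrals of the function and its gradient along curves, and they are continuous
in `L¹`. Approximation by mollified functions therefore identifies them with the traces and shows
how they change under `Ψ`. Weighted `L²` embeds into `L¹` because `a < 1` makes `1 / w` locally
integrable. -/

open Filter Topology

open scoped Convolution Gradient

set_option linter.unusedSectionVars false

namespace TwoPhase

variable {d : ℕ}

/-! ### Mollification and convergence in `L¹` -/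

section Mollification

variable {E : Type*} [NormedAddCommGroup E] [InnerProductSpace ℝ E] [FiniteDimensional ℝ E]

/-- A sequence of bump functions centred at the origin whose supports shrink to the origin. -/
noncomputable def shrinkingBump (E : Type*) [NormedAddCommGroup E] [InnerProductSpace ℝ E]
    [FiniteDimensional ℝ E] (k : ℕ) : ContDiffBump (0 : E) where
  rIn := 1 / (2 * ((k : ℝ) + 1))
  rOut := 1 / ((k : ℝ) + 1)
  rIn_pos := by positivity
  rIn_lt_rOut := by
    apply one_div_lt_one_div_of_lt <;> linarith [(Nat.cast_nonneg k : (0 : ℝ) ≤ k)]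

theorem tendsto_rOut_shrinkingBump :
    Tendsto (fun k => (shrinkingBump E k).rOut) atTop (𝓝 0) := by
  simpa [shrinkingBump] using tendsto_one_div_add_atTop_nhds_zero_nat (𝕜 := ℝ)

variable [MeasurableSpace E] [BorelSpace E]

/-- The mollifications of a function. -/
noncomputable def mollify (k : ℕ) (f : E → ℝ) : E → ℝ :=
  (shrinkingBump E k).normed volume ⋆[ContinuousLinearMap.lsmul ℝ ℝ, volume] f

theorem integrable_normed_shrinkingBump (k : ℕ) :
    Integrable ((shrinkingBump E k).normed volume) (volume : Measure E) :=
  (shrinkingBump E k).continuous_normed.integrable_of_hasCompactSupport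
    (shrinkingBump E k).hasCompactSupport_normed

theorem integrable_mollify (k : ℕ) {f : E → ℝ} (hf : Integrable f) : Integrable (mollify k f) :=
  (integrable_normed_shrinkingBump k).integrable_convolution _ hf

theorem integral_mollify (k : ℕ) {f : E → ℝ} (hf : Integrable f) :
    ∫ x, mollify k f x = ∫ x, f x := by
  unfold mollify
  rw [integral_convolution _ (integrable_normed_shrinkingBump k) hf]
  simp [ContDiffBump.integral_normed]

theorem ae_tendsto_mollify {f : E → ℝ} (hf : Integrable f) :
    ∀ᵐ x, Tendsto (fun k => mollify k f x) atTop (𝓝 (f x)) := by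
  -- `K` bounds the ratio `rOut / rIn`, which is exactly 2 for every bump of the sequence.
  refine ContDiffBump.ae_convolution_tendsto_right_of_locallyIntegrable (K := 2)
    tendsto_rOut_shrinkingBump (Eventually.of_forall fun k => ?_) hf.locallyIntegrable
  simp only [shrinkingBump]
  apply le_of_eq
  field_simp

/-- Scheffé's argument. Mollification preserves the integral, so the positive and negative parts of
the difference have equal mass and the `L¹` distance is twice the integral of `(f - mollify k f)⁺`.
For `f ≥ 0` this positive part is at most `f`, and dominated convergence applies. -/
theorem tendsto_integral_norm_mollify_sub_of_nonneg {f : E → ℝ} (hf : Integrable f)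
    (h0 : ∀ x, 0 ≤ f x) :
    Tendsto (fun k => ∫ x, ‖mollify k f x - f x‖) atTop (𝓝 0) := by
  have hg0 : ∀ k x, 0 ≤ mollify k f x := fun k x => by
    unfold mollify convolution
    exact integral_nonneg fun t => by
      simpa using mul_nonneg ((shrinkingBump E k).nonneg_normed t) (h0 _)
  have hpos : ∀ k, Integrable (fun x => max (f x - mollify k f x) 0) := fun k =>
    (hf.sub (integrable_mollify k hf)).pos_part
  have key : ∀ k, ∫ x, ‖mollify k f x - f x‖ = 2 * ∫ x, max (f x - mollify k f x) 0 := by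
    intro k
    have h1 : ∀ x, ‖mollify k f x - f x‖
        = (mollify k f x - f x) + 2 * max (f x - mollify k f x) 0 := by
      intro x
      rw [Real.norm_eq_abs]
      rcases le_total (f x) (mollify k f x) with h | h
      · rw [abs_of_nonneg (by linarith), max_eq_right (by linarith)]; ring
      · rw [abs_of_nonpos (by linarith), max_eq_left (by linarith)]; ring
    simp_rw [h1]
    rw [integral_add (f := fun x => mollify k f x - f x)
      ((integrable_mollify k hf).sub hf) ((hpos k).const_mul 2),
      integral_sub (integrable_mollify k hf) hf, integral_mollify k hf, integral_const_mul]
    ring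
  simp_rw [key]
  suffices h : Tendsto (fun k => ∫ x, max (f x - mollify k f x) 0) atTop (𝓝 (∫ _ : E, (0 : ℝ))) by
    simpa using h.const_mul 2
  refine tendsto_integral_of_dominated_convergence f
    (fun k => (hpos k).1) hf (fun k => Eventually.of_forall fun x => ?_) ?_
  · rw [Real.norm_eq_abs, abs_of_nonneg (le_max_right _ _)]
    exact max_le (by linarith [hg0 k x]) (h0 x)
  · filter_upwards [ae_tendsto_mollify hf] with x hx
    have : Tendsto (fun k => max (f x - mollify k f x) 0) atTop (𝓝 (max (f x - f x) 0)) :=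
      (tendsto_const_nhds.sub hx).max tendsto_const_nhds
    simpa using this

theorem mollify_sub (k : ℕ) {f g : E → ℝ} (hf : Integrable f) (hg : Integrable g) :
    mollify k (fun x => f x - g x) = fun x => mollify k f x - mollify k g x := by
  have hex : ∀ {h : E → ℝ}, Integrable h →
      ConvolutionExists ((shrinkingBump E k).normed volume) h (ContinuousLinearMap.lsmul ℝ ℝ)
        volume := fun hh =>
    (shrinkingBump E k).hasCompactSupport_normed.convolutionExists_left _
      (shrinkingBump E k).continuous_normed hh.locallyIntegrable
  funext x
  unfold mollify convolution
  rw [← integral_sub (hex hf x) (hex hg x)]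
  congr 1
  funext t
  simp [mul_sub]

/-- Mollifications of an integrable function converge in `L¹`. -/
theorem tendsto_lintegral_enorm_mollify_sub {f : E → ℝ} (hf : Integrable f) :
    Tendsto (fun k => ∫⁻ x, ‖mollify k f x - f x‖ₑ) atTop (𝓝 0) := by
  have hp := hf.pos_part
  have hn := hf.neg_part
  have h1 := tendsto_integral_norm_mollify_sub_of_nonneg hp fun x => le_max_right _ _
  have h2 := tendsto_integral_norm_mollify_sub_of_nonneg hn fun x => le_max_right _ _
  have h3 : Tendsto (fun k => ENNReal.ofReal
      ((∫ x, ‖mollify k (fun x => max (f x) 0) x - max (f x) 0‖) +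
        ∫ x, ‖mollify k (fun x => max (-f x) 0) x - max (-f x) 0‖)) atTop (𝓝 0) := by
    simpa using ENNReal.tendsto_ofReal (h1.add h2)
  refine tendsto_of_tendsto_of_tendsto_of_le_of_le tendsto_const_nhds h3 (fun _ => zero_le)
    fun k => ?_
  have hfe : f = fun x => max (f x) 0 - max (-f x) 0 := by
    funext x
    rcases le_total 0 (f x) with h | h
    · rw [max_eq_left h, max_eq_right (by linarith)]; ring
    · rw [max_eq_right h, max_eq_left (by linarith)]; ring
  have hi1 := ((integrable_mollify k hp).sub hp).norm
  have hi2 := ((integrable_mollify k hn).sub hn).norm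
  have hmeq := mollify_sub k hp hn
  rw [← hfe] at hmeq
  simp only [Pi.sub_apply] at hi1 hi2
  rw [← integral_add hi1 hi2, ofReal_integral_eq_lintegral_ofReal
    (f := fun x => ‖mollify k (fun a => max (f a) 0) x - max (f x) 0‖ +
      ‖mollify k (fun a => max (-f a) 0) x - max (-f x) 0‖) (hi1.add hi2)
    (Eventually.of_forall fun x => by positivity)]
  refine lintegral_mono fun x => ?_
  rw [← ofReal_norm]
  refine ENNReal.ofReal_le_ofReal ?_
  have he : mollify k f x - f x = (mollify k (fun x => max (f x) 0) x - max (f x) 0) -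
      (mollify k (fun x => max (-f x) 0) x - max (-f x) 0) := by
    have := congrFun hfe x
    rw [hmeq]
    linarith
  rw [he]
  exact norm_sub_le _ _

theorem contDiff_mollify (k : ℕ) {f : E → ℝ} (hf : Integrable f) : ContDiff ℝ 1 (mollify k f) :=
  (shrinkingBump E k).hasCompactSupport_normed.contDiff_convolution_left
    (n := 1) (μ := (volume : Measure E)) _
    ((shrinkingBump E k).contDiff_normed (n := 1) (μ := (volume : Measure E)))
    hf.locallyIntegrable

theorem fderiv_mollify (k : ℕ) {f : E → ℝ} (hf : Integrable f) (x v : E) :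
    fderiv ℝ (mollify k f) x v =
      ∫ y, fderiv ℝ ((shrinkingBump E k).normed volume) (x - y) v * f y := by
  have h := ((shrinkingBump E k).hasCompactSupport_normed
    (μ := (volume : Measure E))).hasFDerivAt_convolution_left
    (ContinuousLinearMap.lsmul ℝ ℝ) ((shrinkingBump E k).contDiff_normed (n := 1))
    hf.locallyIntegrable x
  have h' : HasFDerivAt (mollify k f) _ x := h
  rw [h'.fderiv]
  have hint : Integrable (fun t => (ContinuousLinearMap.precompL E (ContinuousLinearMap.lsmul ℝ ℝ)
      (fderiv ℝ ((shrinkingBump E k).normed volume) t)) (f (x - t))) :=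
    (((shrinkingBump E k).hasCompactSupport_normed
      (μ := (volume : Measure E))).fderiv ℝ).convolutionExists_left _
      (((shrinkingBump E k).contDiff_normed (n := 1)).continuous_fderiv (by norm_num))
      hf.locallyIntegrable x
  unfold convolution
  rw [ContinuousLinearMap.integral_apply hint]
  rw [← integral_sub_left_eq_self (fun y => fderiv ℝ ((shrinkingBump E k).normed volume) (x - y) v
    * f y) volume x]
  congr 1
  funext t
  simp [ContinuousLinearMap.precompL_apply]

theorem mollify_apply (k : ℕ) (f : E → ℝ) (x : E) :
    mollify k f x = ∫ y, (shrinkingBump E k).normed volume (x - y) * f y := by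
  unfold mollify convolution
  rw [← integral_sub_left_eq_self (fun y => (shrinkingBump E k).normed volume (x - y)
    * f y) volume x]
  congr 1
  funext t
  simp

end Mollification

/-! ### Distributional gradients as limits of classical ones -/

theorem gradient_apply (f : Space d → ℝ) (x : Space d) (i : Fin (d + 1)) :
    ∇ f x i = partialDeriv i f x := by
  rw [partialDeriv, ← inner_gradient_left, EuclideanSpace.inner_single_right]
  simp

theorem continuous_gradient {E : Type*} [NormedAddCommGroup E] [InnerProductSpace ℝ E]
    [CompleteSpace E] {f : E → ℝ} (hf : ContDiff ℝ 1 f) : Continuous (∇ f) :=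
  (InnerProductSpace.toDual ℝ E).symm.continuous.comp (hf.continuous_fderiv (by norm_num))

/-- `u` and `G` are, in `L¹` of every smaller ball, limits of `C¹` functions and of their
gradients. -/
def IsSmoothlyApproximable (u : Space d → ℝ) (G : Space d → Space d) : Prop :=
  ∀ R < (1 : ℝ), ∃ f : ℕ → Space d → ℝ, (∀ k, ContDiff ℝ 1 (f k)) ∧
    Tendsto (fun k => ∫⁻ x in ball 0 R, ‖f k x - u x‖ₑ) atTop (𝓝 0) ∧
    Tendsto (fun k => ∫⁻ x in ball 0 R, ‖∇ (f k) x - G x‖ₑ) atTop (𝓝 0)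

theorem enorm_le_sum_enorm_apply (v : Space d) : ‖v‖ₑ ≤ ∑ i, ‖v i‖ₑ := by
  conv_lhs => rw [← (EuclideanSpace.basisFun (Fin (d + 1)) ℝ).sum_repr v]
  refine (enorm_sum_le _ _).trans (Finset.sum_le_sum fun i _ => ?_)
  rw [enorm_smul]
  simp [← ofReal_norm]

theorem integrableOn_ball_of_locallyIntegrableOn {E F : Type*} [NormedAddCommGroup E]
    [MeasurableSpace E] [OpensMeasurableSpace E] [ProperSpace E] {μ : Measure E}
    [NormedAddCommGroup F] {u : E → F} {R : ℝ}
    (hu : LocallyIntegrableOn u (ball 0 1) μ) (hR : R < 1) : IntegrableOn u (ball 0 R) μ :=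
  (hu.integrableOn_compact_subset (closedBall_subset_ball hR)
    (isCompact_closedBall 0 R)).mono_set ball_subset_closedBall

theorem integrableOn_apply {S : Set (Space d)} {μ : Measure (Space d)} {G : Space d → Space d}
    (hG : IntegrableOn G S μ) (i : Fin (d + 1)) : IntegrableOn (fun x => G x i) S μ :=
  (EuclideanSpace.proj (𝕜 := ℝ) i).integrable_comp hG

/-- The kernel `y ↦ ρ(x - y)` is itself an admissible test function. The condition `R + rOut < R'`
keeps its support inside the ball of radius `R'`, so that cutting off at `R'` is not seen from `x`.
-/
theorem IsWeakGradient.fderiv_mollify_eq {u : Space d → ℝ} {G : Space d → Space d}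
    (h : IsWeakGradient u G) {R R' : ℝ} (hR' : R' < 1) {k : ℕ}
    (hk : R + (shrinkingBump (Space d) k).rOut < R') {x : Space d} (hx : x ∈ ball 0 R)
    (i : Fin (d + 1)) :
    partialDeriv i (mollify k ((ball 0 R').indicator u)) x =
      mollify k ((ball 0 R').indicator fun x => G x i) x := by
  have hui : Integrable ((ball 0 R').indicator u) :=
    (integrableOn_ball_of_locallyIntegrableOn h.locallyIntegrable hR').integrable_indicator
      measurableSet_ball
  rw [partialDeriv, fderiv_mollify k hui, mollify_apply]
  set ρ := (shrinkingBump (Space d) k).normed volume with hρ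
  have hρs : ContDiff ℝ ∞ ρ := (shrinkingBump (Space d) k).contDiff_normed
  set φ : Space d → ℝ := fun y => ρ (x - y) with hφ
  have hzero : ∀ y ∉ ball (0 : Space d) R', x - y ∉ closedBall 0 (shrinkingBump (Space d) k).rOut := by
    intro y hy hxy
    apply hy
    simp only [mem_ball_zero_iff, mem_closedBall_zero_iff] at *
    have : ‖y‖ ≤ ‖x‖ + ‖x - y‖ := by
      calc ‖y‖ = ‖x - (x - y)‖ := by congr 1; abel
        _ ≤ _ := norm_sub_le _ _
    linarith
  have htsρ : tsupport ρ = closedBall 0 (shrinkingBump (Space d) k).rOut :=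
    (shrinkingBump (Space d) k).tsupport_normed_eq
  have hφs : ContDiff ℝ ∞ φ := hρs.comp (contDiff_const.sub contDiff_id)
  have hsub : Function.support φ ⊆ closedBall x (shrinkingBump (Space d) k).rOut := by
    intro y hy
    have : x - y ∈ tsupport ρ := subset_tsupport _ hy
    rw [htsρ] at this
    rw [mem_closedBall, dist_comm, dist_eq_norm]
    simpa using this
  have hts : tsupport φ ⊆ closedBall x (shrinkingBump (Space d) k).rOut :=
    closure_minimal hsub isClosed_closedBall
  have hcs : HasCompactSupport φ :=
    HasCompactSupport.of_support_subset_isCompact (isCompact_closedBall _ _) hsub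
  have hts' : tsupport φ ⊆ ball 0 R' := by
    intro y hy
    by_contra hy'
    refine hzero y hy' ?_
    have := hts hy
    rw [mem_closedBall, dist_comm, dist_eq_norm] at this
    simpa using this
  have hib := h.integral_eq i φ hφs hcs (hts'.trans (ball_subset_ball hR'.le))
  have hd : ∀ y, partialDeriv i φ y = -fderiv ℝ ρ (x - y) (EuclideanSpace.single i 1) := by
    intro y
    have h1 : HasFDerivAt φ ((fderiv ℝ ρ (x - y)).comp (-ContinuousLinearMap.id ℝ (Space d))) y := by
      exact ((hρs.differentiable (by simp)).differentiableAt (x := x - y)).hasFDerivAt.comp y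
        ((hasFDerivAt_id y).const_sub x)
    rw [partialDeriv, h1.fderiv]
    simp
  have e1 : ∫ y, fderiv ℝ ρ (x - y) (EuclideanSpace.single i 1) * (ball 0 R').indicator u y
      = -∫ y in ball 0 1, u y * partialDeriv i φ y := by
    rw [← integral_neg, ← integral_indicator measurableSet_ball]
    congr 1
    funext y
    by_cases hy : y ∈ ball (0 : Space d) R'
    · rw [indicator_of_mem hy, indicator_of_mem (ball_subset_ball hR'.le hy), hd]
      ring
    · rw [indicator_of_notMem hy]
      have : fderiv ℝ ρ (x - y) = 0 := by
        by_contra hne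
        have : x - y ∈ tsupport ρ := support_fderiv_subset ℝ (f := ρ) hne
        rw [htsρ] at this
        exact hzero y hy this
      by_cases hy1 : y ∈ ball (0 : Space d) 1
      · rw [indicator_of_mem hy1, hd, this]; simp
      · rw [indicator_of_notMem hy1, mul_zero]
  have e2 : ∫ y, ρ (x - y) * (ball 0 R').indicator (fun x => G x i) y
      = ∫ y in ball 0 1, G y i * φ y := by
    rw [← integral_indicator measurableSet_ball]
    congr 1
    funext y
    by_cases hy : y ∈ ball (0 : Space d) R'
    · rw [indicator_of_mem hy, indicator_of_mem (ball_subset_ball hR'.le hy)]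
      exact mul_comm _ _
    · rw [indicator_of_notMem hy]
      have : φ y = 0 := by
        by_contra hne
        exact hy (hts' (subset_tsupport _ hne))
      by_cases hy1 : y ∈ ball (0 : Space d) 1
      · rw [indicator_of_mem hy1, this]; simp
      · rw [indicator_of_notMem hy1, mul_zero]
  rw [e1, e2, hib, neg_neg]

/-- Cutting off at an intermediate radius `R'` makes `u` and `G` globally integrable. On the smaller
ball the gradient of the mollified function is eventually the mollification of `G`, so both limits
are instances of convergence of mollifications in `L¹`. -/
theorem IsWeakGradient.isSmoothlyApproximable {u : Space d → ℝ} {G : Space d → Space d}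
    (h : IsWeakGradient u G) : IsSmoothlyApproximable u G := by
  intro R hR
  obtain ⟨R', hRR', hR'⟩ := exists_between hR
  have hu := (integrableOn_ball_of_locallyIntegrableOn h.locallyIntegrable hR').integrable_indicator
      measurableSet_ball
  have hG := fun i => (integrableOn_apply (integrableOn_ball_of_locallyIntegrableOn
    h.locallyIntegrable_grad hR') i).integrable_indicator measurableSet_ball
  have hsub : ball (0 : Space d) R ⊆ ball 0 R' := ball_subset_ball hRR'.le
  have hest : ∀ (g : Space d → ℝ) (k : ℕ), ∫⁻ x in ball 0 R, ‖mollify k ((ball 0 R').indicator g) x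
      - g x‖ₑ ≤ ∫⁻ x, ‖mollify k ((ball 0 R').indicator g) x - (ball 0 R').indicator g x‖ₑ := by
    intro g k
    refine le_trans (le_of_eq ?_) (setLIntegral_le_lintegral (ball 0 R) _)
    refine setLIntegral_congr_fun measurableSet_ball fun x hx => ?_
    simp only
    rw [indicator_of_mem (hsub hx)]
  refine ⟨fun k => mollify k ((ball 0 R').indicator u), fun k => contDiff_mollify k hu, ?_, ?_⟩
  · exact tendsto_of_tendsto_of_tendsto_of_le_of_le tendsto_const_nhds
      (tendsto_lintegral_enorm_mollify_sub hu) (fun _ => zero_le) (fun k => hest u k)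
  · have hsum : Tendsto (fun k => ∑ i, ∫⁻ x, ‖mollify k ((ball 0 R').indicator fun x => G x i) x
        - (ball 0 R').indicator (fun x => G x i) x‖ₑ) atTop (𝓝 0) := by
      have := tendsto_finsetSum Finset.univ fun i _ => tendsto_lintegral_enorm_mollify_sub (hG i)
      simpa using this
    refine tendsto_of_tendsto_of_tendsto_of_le_of_le' tendsto_const_nhds hsum
      (Eventually.of_forall fun _ => zero_le) ?_
    have hev : ∀ᶠ k in atTop, R + (shrinkingBump (Space d) k).rOut < R' := by
      have := (tendsto_rOut_shrinkingBump (E := Space d)).eventually_lt_const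
        (show (0 : ℝ) < R' - R by linarith)
      filter_upwards [this] with k hk
      linarith
    filter_upwards [hev] with k hk
    calc ∫⁻ x in ball 0 R, ‖∇ (mollify k ((ball 0 R').indicator u)) x - G x‖ₑ
        ≤ ∫⁻ x in ball 0 R, ∑ i, ‖mollify k ((ball 0 R').indicator fun x => G x i) x
          - G x i‖ₑ := by
          refine setLIntegral_mono_ae' measurableSet_ball (Eventually.of_forall fun x hx => ?_)
          refine (enorm_le_sum_enorm_apply _).trans (le_of_eq (Finset.sum_congr rfl fun i _ => ?_))
          rw [PiLp.sub_apply, gradient_apply, h.fderiv_mollify_eq hR' hk hx]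
      _ = ∑ i, ∫⁻ x in ball 0 R, ‖mollify k ((ball 0 R').indicator fun x => G x i) x
          - G x i‖ₑ := by
          refine lintegral_finsetSum' _ fun i _ => ?_
          refine AEStronglyMeasurable.enorm (AEStronglyMeasurable.sub
            (contDiff_mollify k (hG i)).continuous.aestronglyMeasurable ?_)
          exact (integrableOn_apply (integrableOn_ball_of_locallyIntegrableOn
            h.locallyIntegrable_grad hR) i).1
      _ ≤ _ := Finset.sum_le_sum fun i _ => hest (fun x => G x i) k

theorem tendsto_setIntegral_mul_of_L1 {E : Type*} [MeasurableSpace E] {μ : Measure E} {S : Set E}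
    {F : ℕ → E → ℝ} {f ψ : E → ℝ}
    (hF : ∀ k, IntegrableOn (F k) S μ) (hf : IntegrableOn f S μ)
    (hlim : Tendsto (fun k => ∫⁻ x in S, ‖F k x - f x‖ₑ ∂μ) atTop (𝓝 0))
    (hψ : AEStronglyMeasurable ψ (μ.restrict S)) {C : ℝ} (hC : ∀ x, ‖ψ x‖ ≤ C) :
    Tendsto (fun k => ∫ x in S, F k x * ψ x ∂μ) atTop (𝓝 (∫ x in S, f x * ψ x ∂μ)) := by
  refine tendsto_integral_of_L1 _ ?_ (Eventually.of_forall fun k => ?_) ?_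
  · exact hf.1.mul hψ
  · exact (hF k).mul_bdd (c := C) hψ (Eventually.of_forall hC)
  · have hlim' := ENNReal.Tendsto.mul_const (b := ENNReal.ofReal C) hlim
      (Or.inr ENNReal.ofReal_ne_top)
    rw [zero_mul] at hlim'
    refine tendsto_of_tendsto_of_tendsto_of_le_of_le tendsto_const_nhds hlim'
      (fun _ => zero_le) fun k => ?_
    rw [← lintegral_mul_const' _ _ ENNReal.ofReal_ne_top]
    refine lintegral_mono fun x => ?_
    rw [← sub_mul, enorm_mul]
    gcongr
    rw [← ofReal_norm]
    exact ENNReal.ofReal_le_ofReal (hC x)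

theorem partialDeriv_eq_zero_of_notMem_tsupport {φ : Space d → ℝ} {i : Fin (d + 1)} {x : Space d}
    (hx : x ∉ tsupport φ) : partialDeriv i φ x = 0 := by
  have : fderiv ℝ φ x = 0 := by
    by_contra h
    exact hx (support_fderiv_subset ℝ (f := φ) h)
  simp [partialDeriv, this]

theorem continuous_partialDeriv {φ : Space d → ℝ} (hφ : ContDiff ℝ 1 φ) (i : Fin (d + 1)) :
    Continuous (partialDeriv i φ) :=
  (hφ.continuous_fderiv (by norm_num)).clm_apply continuous_const

theorem hasCompactSupport_partialDeriv {φ : Space d → ℝ} (hφ : HasCompactSupport φ)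
    (i : Fin (d + 1)) : HasCompactSupport (partialDeriv i φ) := by
  have := hφ.fderiv_apply (𝕜 := ℝ) (v := EuclideanSpace.single i (1 : ℝ))
  exact this

theorem setIntegral_ball_eq_of_support {E : Type*} [NormedAddCommGroup E] [MeasurableSpace E]
    [OpensMeasurableSpace E] {μ : Measure E} {f : E → ℝ} {R : ℝ} (hR : R ≤ 1)
    (hf : ∀ x, x ∉ ball (0 : E) R → f x = 0) :
    ∫ x in ball 0 1, f x ∂μ = ∫ x in ball 0 R, f x ∂μ := by
  exact setIntegral_eq_of_subset_of_forall_sdiff_eq_zero measurableSet_ball (ball_subset_ball hR)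
    fun x hx => hf x hx.2

theorem continuousOn_integrableOn_ball {E F : Type*} [NormedAddCommGroup E] [MeasurableSpace E]
    [BorelSpace E] [ProperSpace E] {μ : Measure E} [IsFiniteMeasureOnCompacts μ]
    [NormedAddCommGroup F] [SecondCountableTopologyEither E F]
    {f : E → F} (hf : Continuous f) (R : ℝ) : IntegrableOn f (ball 0 R) μ :=
  (hf.continuousOn.integrableOn_compact (isCompact_closedBall 0 R)).mono_set ball_subset_closedBall

theorem exists_bound_of_hasCompactSupport {E : Type*} [TopologicalSpace E] {f : E → ℝ}
    (hf : Continuous f) (hc : HasCompactSupport f) : ∃ C, ∀ x, ‖f x‖ ≤ C :=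
  hc.exists_bound_of_continuous hf

/-- Integration by parts holds for `C¹` functions, and both sides pass to the limit in `L¹` of a
ball that contains the support of the test function. With this converse, the chain rule for deformed
Sobolev functions reduces to the one for `C¹` functions. -/
theorem IsSmoothlyApproximable.isWeakGradient {u : Space d → ℝ} {G : Space d → Space d}
    (h : IsSmoothlyApproximable u G) (hu : LocallyIntegrableOn u (ball 0 1))
    (hG : LocallyIntegrableOn G (ball 0 1)) : IsWeakGradient u G where
  locallyIntegrable := hu
  locallyIntegrable_grad := hG
  integral_eq := by
    intro i φ hφ hc hs
    obtain ⟨R, hR, hsR⟩ := exists_lt_subset_ball (isClosed_tsupport φ) hs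
    obtain ⟨f, hf, hfu, hfG⟩ := h R hR
    have hφ1 : ContDiff ℝ 1 φ := hφ.of_le (by exact_mod_cast le_top)
    obtain ⟨C₁, hC₁⟩ := exists_bound_of_hasCompactSupport hφ.continuous hc
    obtain ⟨C₂, hC₂⟩ := exists_bound_of_hasCompactSupport (continuous_partialDeriv hφ1 i)
      (hasCompactSupport_partialDeriv hc i)
    have l1 := tendsto_setIntegral_mul_of_L1
      (fun k => continuousOn_integrableOn_ball (hf k).continuous R)
      (integrableOn_ball_of_locallyIntegrableOn hu hR) hfu
      (continuous_partialDeriv hφ1 i).aestronglyMeasurable hC₂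
    have l2 := tendsto_setIntegral_mul_of_L1 (F := fun k x => ∇ (f k) x i) (f := fun x => G x i)
      (fun k => integrableOn_apply (continuousOn_integrableOn_ball (continuous_gradient (hf k)) R) i)
      (integrableOn_apply (integrableOn_ball_of_locallyIntegrableOn hG hR) i)
      (tendsto_of_tendsto_of_tendsto_of_le_of_le tendsto_const_nhds hfG (fun _ => zero_le)
        fun k => lintegral_mono fun x => by
          simp only [← ofReal_norm, ← PiLp.sub_apply]
          exact ENNReal.ofReal_le_ofReal (PiLp.norm_apply_le _ i))
      hφ.continuous.aestronglyMeasurable hC₁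
    have hz : ∀ x, x ∉ ball (0 : Space d) R → φ x = 0 := fun x hx =>
      image_eq_zero_of_notMem_tsupport fun hx' => hx (hsR hx')
    have hz' : ∀ x, x ∉ ball (0 : Space d) R → partialDeriv i φ x = 0 := fun x hx =>
      partialDeriv_eq_zero_of_notMem_tsupport fun hx' => hx (hsR hx')
    rw [setIntegral_ball_eq_of_support hR.le fun x hx => by rw [hz' x hx, mul_zero],
      setIntegral_ball_eq_of_support hR.le fun x hx => by rw [hz x hx, mul_zero]]
    refine tendsto_nhds_unique l1 ?_
    refine l2.neg.congr fun k => ?_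
    rw [setIntegral_eq_integral_of_forall_compl_eq_zero fun x hx => by rw [hz x hx, mul_zero],
      setIntegral_eq_integral_of_forall_compl_eq_zero fun x hx => by rw [hz' x hx, mul_zero]]
    simp only [gradient_apply]
    refine (integral_mul_fderiv_eq_neg_fderiv_mul_of_integrable ?_ ?_ ?_
      (fun x _ => (hf k).differentiable (by norm_num) x)
      (fun x _ => hφ.differentiable (by simp) x)).symm
    · exact ((continuous_partialDeriv (hf k) i).mul hφ.continuous).integrable_of_hasCompactSupport
        hc.mul_left
    · exact ((hf k).continuous.mul (continuous_partialDeriv hφ1 i)).integrable_of_hasCompactSupport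
        (hasCompactSupport_partialDeriv hc i).mul_left
    · exact ((hf k).continuous.mul hφ.continuous).integrable_of_hasCompactSupport hc.mul_left

/-- Distributional gradients are unique almost everywhere. -/
theorem IsWeakGradient.ae_eq {u v : Space d → ℝ} {G H : Space d → Space d}
    (hG : IsWeakGradient u G) (hH : IsWeakGradient v H) (huv : ∀ᵐ x, x ∈ ball (0 : Space d) 1 →
      u x = v x) : ∀ᵐ x, x ∈ ball (0 : Space d) 1 → G x = H x := by
  have hcoord : ∀ i, ∀ᵐ x, x ∈ ball (0 : Space d) 1 → G x i - H x i = 0 := by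
    intro i

    have l1 : LocallyIntegrableOn (fun x => G x i) (ball 0 1) := fun x hx =>
      (hG.locallyIntegrable_grad x hx).imp fun s hs => ⟨hs.1, integrableOn_apply hs.2 i⟩
    have l2 : LocallyIntegrableOn (fun x => H x i) (ball 0 1) := fun x hx =>
      (hH.locallyIntegrable_grad x hx).imp fun s hs => ⟨hs.1, integrableOn_apply hs.2 i⟩
    refine isOpen_ball.ae_eq_zero_of_integral_contDiff_smul_eq_zero (l1.sub l2)
      fun φ hφ hc hs => ?_
    have hφ' : ContDiff ℝ ∞ φ := hφ
    have e1 := hG.integral_eq i φ hφ' hc hs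
    have e2 := hH.integral_eq i φ hφ' hc hs
    have e3 : ∫ x in ball 0 1, u x * partialDeriv i φ x =
        ∫ x in ball 0 1, v x * partialDeriv i φ x := by
      refine setIntegral_congr_ae measurableSet_ball ?_
      filter_upwards [huv] with x hx hx1
      rw [hx hx1]
    have e4 : ∫ x in ball 0 1, G x i * φ x = ∫ x in ball 0 1, H x i * φ x := by linarith
    rw [← setIntegral_eq_integral_of_forall_compl_eq_zero (s := ball (0 : Space d) 1) fun x hx => by
      rw [image_eq_zero_of_notMem_tsupport fun hx' => hx (hs hx'), zero_smul]]
    obtain ⟨R, hR, hsR⟩ := exists_lt_subset_ball (isClosed_tsupport φ) hs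
    obtain ⟨C, hC⟩ := exists_bound_of_hasCompactSupport hφ.continuous hc
    have hz : ∀ x, x ∉ ball (0 : Space d) R → φ x = 0 := fun x hx =>
      image_eq_zero_of_notMem_tsupport fun hx' => hx (hsR hx')
    rw [setIntegral_ball_eq_of_support hR.le fun x hx => by rw [hz x hx, mul_zero],
      setIntegral_ball_eq_of_support (f := fun x => H x i * φ x) hR.le
        fun x hx => by rw [hz x hx, mul_zero]] at e4
    rw [setIntegral_ball_eq_of_support hR.le fun x hx => by rw [hz x hx, zero_smul]]
    have i1 : IntegrableOn (fun x => G x i * φ x) (ball 0 R) :=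
      (integrableOn_apply (integrableOn_ball_of_locallyIntegrableOn hG.locallyIntegrable_grad hR)
        i).mul_bdd (c := C) hφ.continuous.aestronglyMeasurable (Eventually.of_forall hC)
    have i2 : IntegrableOn (fun x => H x i * φ x) (ball 0 R) :=
      (integrableOn_apply (integrableOn_ball_of_locallyIntegrableOn hH.locallyIntegrable_grad hR)
        i).mul_bdd (c := C) hφ.continuous.aestronglyMeasurable (Eventually.of_forall hC)
    calc ∫ x in ball 0 R, φ x • (G x i - H x i)
        = ∫ x in ball 0 R, (G x i * φ x - H x i * φ x) := by
          congr 1; funext x; rw [smul_eq_mul]; ring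
      _ = 0 := by rw [integral_sub i1 i2, e4, sub_self]
  have hall := ae_all_iff.2 hcoord
  filter_upwards [hall] with x hx hx1
  ext i
  linarith [hx i hx1]

theorem IsWeakGradient.weakGradient {u : Space d → ℝ} {G : Space d → Space d}
    (h : IsWeakGradient u G) : IsWeakGradient u (TwoPhase.weakGradient u) := by
  have hex : ∃ G, IsWeakGradient u G := ⟨G, h⟩
  rw [TwoPhase.weakGradient, dif_pos hex]
  exact hex.choose_spec

theorem IsWeakGradient.weakGradient_ae_eq {u : Space d → ℝ} {G : Space d → Space d}
    (h : IsWeakGradient u G) :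
    ∀ᵐ x, x ∈ ball (0 : Space d) 1 → TwoPhase.weakGradient u x = G x :=
  h.weakGradient.ae_eq h (Eventually.of_forall fun _ _ => rfl)

/-! ### The splitting `x = (x', xₙ)` -/

section Slicing

/-- The point `(x', xₙ)` of `ℝⁿ`. -/
noncomputable def slice (p : EuclideanSpace ℝ (Fin d) × ℝ) : Space d :=
  WithLp.toLp 2 (Fin.snoc (α := fun _ => ℝ) (fun i => p.1 i) p.2)

@[simp]
theorem slice_castSucc (p : EuclideanSpace ℝ (Fin d) × ℝ) (i : Fin d) :
    slice p (Fin.castSucc i) = p.1 i := by simp [slice]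

@[simp]
theorem slice_last (p : EuclideanSpace ℝ (Fin d) × ℝ) : slice p (Fin.last d) = p.2 := by
  simp [slice]

@[simp]
theorem lastCoord_slice (p : EuclideanSpace ℝ (Fin d) × ℝ) : lastCoord (slice p) = p.2 :=
  slice_last p

theorem thinEmbedding_eq_slice (y : EuclideanSpace ℝ (Fin d)) :
    thinEmbedding d y = slice (y, 0) := rfl

theorem slice_ext {x : Space d} {p : EuclideanSpace ℝ (Fin d) × ℝ}
    (h : ∀ i, x (Fin.castSucc i) = p.1 i) (h' : lastCoord x = p.2) : x = slice p := by
  ext j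
  refine Fin.lastCases ?_ (fun i => ?_) j
  · rw [slice_last]
    exact h'
  · simpa using h i

theorem slice_add (p q : EuclideanSpace ℝ (Fin d) × ℝ) : slice (p + q) = slice p + slice q :=
  (slice_ext (by simp) (by simp [lastCoord])).symm

theorem slice_smul (c : ℝ) (p : EuclideanSpace ℝ (Fin d) × ℝ) : slice (c • p) = c • slice p :=
  (slice_ext (by simp) (by simp [lastCoord])).symm

/-- `slice` as a linear map. -/
noncomputable def sliceL : EuclideanSpace ℝ (Fin d) × ℝ →L[ℝ] Space d :=
  LinearMap.toContinuousLinearMap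
    { toFun := slice, map_add' := slice_add, map_smul' := slice_smul }

theorem contDiff_slice : ContDiff ℝ ∞ (slice (d := d)) := (sliceL (d := d)).contDiff

theorem continuous_slice : Continuous (slice (d := d)) := (sliceL (d := d)).continuous

theorem norm_slice_sq (p : EuclideanSpace ℝ (Fin d) × ℝ) :
    ‖slice p‖ ^ 2 = ‖p.1‖ ^ 2 + p.2 ^ 2 := by
  rw [EuclideanSpace.real_norm_sq_eq, EuclideanSpace.real_norm_sq_eq, Fin.sum_univ_castSucc]
  simp

theorem norm_slice_zero (y : EuclideanSpace ℝ (Fin d)) : ‖slice (y, 0)‖ = ‖y‖ := by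
  have := norm_slice_sq (y, (0 : ℝ))
  simp only [ne_eq, OfNat.ofNat_ne_zero, not_false_eq_true, zero_pow, add_zero] at this
  exact (sq_eq_sq₀ (norm_nonneg _) (norm_nonneg _)).1 this

theorem norm_fst_le_norm_slice (p : EuclideanSpace ℝ (Fin d) × ℝ) : ‖p.1‖ ≤ ‖slice p‖ := by
  have := norm_slice_sq p
  exact abs_le_of_sq_le_sq' (by nlinarith [sq_nonneg p.2]) (norm_nonneg _) |>.2

theorem abs_snd_le_norm_slice (p : EuclideanSpace ℝ (Fin d) × ℝ) : |p.2| ≤ ‖slice p‖ := by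
  have := norm_slice_sq p
  exact abs_le_of_sq_le_sq (by nlinarith [sq_nonneg ‖p.1‖]) (norm_nonneg _)

theorem measurePreserving_slice : MeasurePreserving (slice (d := d)) volume volume := by
  have h1 := (volume_preserving_piFinSuccAbove (fun _ : Fin (d + 1) => ℝ) (Fin.last d)).symm
  have h2 := (EuclideanSpace.volume_preserving_symm_measurableEquiv_toLp (Fin (d + 1))).symm
  have h3 := EuclideanSpace.volume_preserving_symm_measurableEquiv_toLp (Fin d)
  have h4 : MeasurePreserving
      (fun p : EuclideanSpace ℝ (Fin d) × ℝ => (p.2, (MeasurableEquiv.toLp 2 (Fin d → ℝ)).symm p.1))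
      volume volume :=
    ((MeasurePreserving.id (volume : Measure ℝ)).prod h3).comp Measure.measurePreserving_swap
  have h5 := h2.comp (h1.comp h4)
  have : slice (d := d) = ((MeasurableEquiv.toLp 2 (Fin (d + 1) → ℝ)).symm).symm ∘
      ((MeasurableEquiv.piFinSuccAbove (fun _ => ℝ) (Fin.last d)).symm ∘
      fun p : EuclideanSpace ℝ (Fin d) × ℝ => (p.2, (MeasurableEquiv.toLp 2 (Fin d → ℝ)).symm p.1)) := by
    funext p
    change slice p = WithLp.toLp 2 (Fin.insertNth (α := fun _ => ℝ) (Fin.last d) p.2 fun i => p.1 i)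
    rw [Fin.insertNth_last]
    rfl
  rw [this]
  exact h5

theorem measurableEmbedding_slice : MeasurableEmbedding (slice (d := d)) := by
  have hinj : Function.Injective (slice (d := d)) := by
    intro p q h
    refine Prod.ext ?_ ?_
    · ext i
      rw [← slice_castSucc p i, h, slice_castSucc]
    · rw [← lastCoord_slice p, h, lastCoord_slice]
  exact (LinearMap.isClosedEmbedding_of_injective (f := (sliceL (d := d)).toLinearMap)
    (LinearMap.ker_eq_bot.2 hinj)).measurableEmbedding

theorem continuous_lastCoord : Continuous (lastCoord (d := d)) :=
  (EuclideanSpace.proj (𝕜 := ℝ) (Fin.last d)).continuous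

theorem lintegral_eq_lintegral_slice {g : Space d → ENNReal} (hg : Measurable g) :
    ∫⁻ x, g x = ∫⁻ t : ℝ, ∫⁻ y : EuclideanSpace ℝ (Fin d), g (slice (y, t)) := by
  rw [← measurePreserving_slice.lintegral_comp hg]
  exact lintegral_prod_symm' _ (hg.comp measurePreserving_slice.measurable)

/-- Off the thin space the weight is positive, so weighted and unweighted null sets coincide. -/
theorem ae_lastCoord_ne_zero : ∀ᵐ x : Space d, lastCoord x ≠ 0 := by
  have hm : MeasurableSet {x : Space d | lastCoord x ≠ 0}ᶜ :=
    (continuous_lastCoord.measurable (measurableSet_singleton (0 : ℝ)).compl).compl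
  rw [ae_iff]
  change volume {x : Space d | lastCoord x ≠ 0}ᶜ = 0
  rw [← measurePreserving_slice.measure_preimage hm.nullMeasurableSet]
  have : slice (d := d) ⁻¹' {x : Space d | lastCoord x ≠ 0}ᶜ = univ ×ˢ {(0 : ℝ)} := by
    ext p; simp
  rw [this, Measure.volume_eq_prod, Measure.prod_prod]
  simp

end Slicing

/-! ### The weight `|xₙ|ᵃ` and weighted `L²` -/

section Weight

variable {a : ℝ}

theorem measurable_weight (a : ℝ) : Measurable (weight (d := d) a) :=
  (continuous_lastCoord.measurable.abs).pow_const a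

theorem weight_nonneg (a : ℝ) (x : Space d) : 0 ≤ weight a x := Real.rpow_nonneg (abs_nonneg _) _

theorem weight_pos (a : ℝ) {x : Space d} (hx : lastCoord x ≠ 0) : 0 < weight a x :=
  Real.rpow_pos_of_pos (abs_pos.2 hx) _

theorem weight_neg (a : ℝ) (x : Space d) : weight (-a) x = (weight a x)⁻¹ :=
  Real.rpow_neg (abs_nonneg _) _

theorem weight_smul (a : ℝ) {c : ℝ} (hc : 0 ≤ c) (x : Space d) :
    weight a (c • x) = c ^ a * weight a x := by
  have : lastCoord (c • x) = c * lastCoord x := by simp [lastCoord]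
  rw [weight, weight, this, abs_mul, abs_of_nonneg hc, Real.mul_rpow hc (abs_nonneg _)]

theorem integrableOn_abs_rpow {b : ℝ} (hb : -1 < b) (R : ℝ) :
    IntegrableOn (fun t : ℝ => |t| ^ b) (Ioo (-R) R) := by
  have h1 : IntervalIntegrable (fun t : ℝ => |t| ^ b) volume (-R) 0 := by
    have : IntervalIntegrable (fun t : ℝ => |t| ^ b) volume 0 R := by
      rcases le_total 0 R with hR | hR
      · refine (intervalIntegral.intervalIntegrable_rpow' (a := 0) (b := R) hb).congr ?_
        intro t ht
        rw [uIoc_of_le hR] at ht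
        simp only
        rw [abs_of_pos ht.1]
      · have := (intervalIntegral.intervalIntegrable_rpow' (a := 0) (b := -R) hb).comp_sub_left 0
        simp only [zero_sub, neg_neg, sub_zero] at this
        refine this.congr ?_
        intro t ht
        rw [uIoc_of_ge hR] at ht
        simp only
        rw [abs_of_nonpos ht.2]
    have := this.comp_sub_left 0
    simp only [zero_sub, abs_neg, neg_zero] at this
    exact this.symm
  have h2 : IntervalIntegrable (fun t : ℝ => |t| ^ b) volume 0 R := by
    have := h1.comp_sub_left 0
    simp only [zero_sub, abs_neg, neg_zero, neg_neg] at this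
    exact this.symm
  rcases le_total (-R) R with hR | hR
  · exact ((intervalIntegrable_iff_integrableOn_Ioc_of_le hR).1 (h1.trans h2)).mono_set
      Ioo_subset_Ioc_self
  · rw [Ioo_eq_empty (not_lt.2 hR)]
    exact integrableOn_empty

/-- The singularity is one-dimensional: the ball lies in the product of a ball of `ℝᵈ` and an
interval, where the weight is `|t|^b`. The exponent that matters is `b = -a`, for which the
condition reads `a < 1`. -/
theorem integrableOn_weight {b : ℝ} (hb : -1 < b) (R : ℝ) :
    IntegrableOn (weight (d := d) b) (ball 0 R) := by
  have h1 : IntegrableOn (fun p : EuclideanSpace ℝ (Fin d) × ℝ => |p.2| ^ b)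
      (ball 0 R ×ˢ Ioo (-R) R) := by
    rw [IntegrableOn, Measure.volume_eq_prod, ← Measure.prod_restrict]
    have hc : IntegrableOn (fun _ : EuclideanSpace ℝ (Fin d) => (1 : ℝ)) (ball 0 R) :=
      continuousOn_integrableOn_ball continuous_const R
    have := Integrable.mul_prod hc (integrableOn_abs_rpow hb R)
    simpa using this
  have h2 : IntegrableOn (weight (d := d) b ∘ slice) (slice ⁻¹' ball 0 R) := by
    have : (weight (d := d) b ∘ slice) = fun p => |p.2| ^ b := by
      funext p; simp [weight]
    rw [this]
    refine h1.mono_set fun p hp => ?_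
    have hp' : ‖slice p‖ < R := by simpa using hp
    refine ⟨?_, ?_⟩
    · simpa using (norm_fst_le_norm_slice p).trans_lt hp'
    · exact abs_lt.1 ((abs_snd_le_norm_slice p).trans_lt hp')
  exact (measurePreserving_slice.integrableOn_comp_preimage measurableEmbedding_slice).1 h2

theorem restrict_weighted (μ : Measure (Space d)) {S : Set (Space d)} (hS : MeasurableSet S) :
    (weighted a μ).restrict S = weighted a (μ.restrict S) :=
  restrict_withDensity hS _

theorem absolutelyContinuous_weighted {μ : Measure (Space d)} (h0 : ∀ᵐ x ∂μ, lastCoord x ≠ 0) :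
    μ ≪ weighted a μ := by
  refine withDensity_absolutelyContinuous' (measurable_weight a).ennreal_ofReal.aemeasurable ?_
  filter_upwards [h0] with x hx
  simpa using weight_pos a hx

theorem weighted_absolutelyContinuous {μ : Measure (Space d)} : weighted a μ ≪ μ :=
  withDensity_absolutelyContinuous _ _

theorem integrable_weighted_iff {F : Type*} [NormedAddCommGroup F] [NormedSpace ℝ F]
    {μ : Measure (Space d)} {f : Space d → F} :
    Integrable f (weighted a μ) ↔ Integrable (fun x => weight a x • f x) μ := by
  rw [weighted, integrable_withDensity_iff_integrable_smul'
    (measurable_weight a).ennreal_ofReal (by simp)]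
  simp only [ENNReal.toReal_ofReal (weight_nonneg a _)]

theorem memLp_weighted_iff {F : Type*} [NormedAddCommGroup F] {μ : Measure (Space d)}
    (h0 : ∀ᵐ x ∂μ, lastCoord x ≠ 0) {f : Space d → F} :
    MemLp f 2 (weighted a μ) ↔
      AEStronglyMeasurable f μ ∧ Integrable (fun x => ‖f x‖ ^ 2 * weight a x) μ := by
  constructor
  · intro h
    refine ⟨h.1.mono_ac (absolutelyContinuous_weighted h0), ?_⟩
    have := (memLp_two_iff_integrable_sq_norm h.1).1 h
    rw [integrable_weighted_iff] at this
    simpa [mul_comm] using this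
  · rintro ⟨h1, h2⟩
    have h1' := h1.mono_ac (weighted_absolutelyContinuous (a := a))
    rw [memLp_two_iff_integrable_sq_norm h1', integrable_weighted_iff]
    simpa [mul_comm] using h2

/-- A form of Young's inequality without the sharp constant, proved by completing the square. It
bounds a function by its weighted square plus the inverse weight. -/
theorem norm_le_half_sq_mul_add_inv {w t : ℝ} (hw : 0 < w) : t ≤ t ^ 2 * w + w⁻¹ := by
  have h1 : w * w⁻¹ = 1 := mul_inv_cancel₀ hw.ne'
  have h2 : 0 < w⁻¹ := inv_pos.2 hw
  have e : t ^ 2 * w + w⁻¹ - t = w⁻¹ * ((t * w - 1 / 2) ^ 2 + 3 / 4) := by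
    field_simp
    ring
  nlinarith [sq_nonneg (t * w - 1 / 2), mul_nonneg h2.le (add_nonneg (sq_nonneg (t * w - 1 / 2))
    (by norm_num : (0 : ℝ) ≤ 3 / 4))]

/-- Weighted `L²` functions are integrable when the inverse weight is. -/
theorem integrable_of_integrable_sq_weight {F : Type*} [NormedAddCommGroup F]
    {μ : Measure (Space d)} (h0 : ∀ᵐ x ∂μ, lastCoord x ≠ 0) (hw : Integrable (weight (-a)) μ)
    {f : Space d → F} (hf : AEStronglyMeasurable f μ)
    (h : Integrable (fun x => ‖f x‖ ^ 2 * weight a x) μ) : Integrable f μ := by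
  refine (h.add hw).mono' hf ?_
  filter_upwards [h0] with x hx
  simp only [Pi.add_apply]
  rw [weight_neg]
  exact norm_le_half_sq_mul_add_inv (weight_pos a hx)

end Weight

/-! ### Borel representatives of Sobolev functions -/

/-- `u` belongs to `W^{1,2}(B₁, |xₙ|ᵃ)`, is Borel measurable, and `G` is a Borel measurable
distributional gradient of `u`. -/
structure IsSobolevPair (a : ℝ) (u : Space d → ℝ) (G : Space d → Space d) : Prop where
  measurable : Measurable u
  measurable_grad : Measurable G
  isWeakGradient : IsWeakGradient u G
  integrable_sq : IntegrableOn (fun x => ‖u x‖ ^ 2 * weight a x) (ball 0 1)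
  integrable_grad_sq : IntegrableOn (fun x => ‖G x‖ ^ 2 * weight a x) (ball 0 1)

theorem ae_restrict_lastCoord_ne_zero {S : Set (Space d)} :
    ∀ᵐ x ∂(volume.restrict S), lastCoord x ≠ 0 := ae_restrict_of_ae ae_lastCoord_ne_zero

namespace IsSobolevPair

variable {a : ℝ} {u : Space d → ℝ} {G : Space d → Space d}

theorem integrableOn (h : IsSobolevPair a u G) (ha : a < 1) : IntegrableOn u (ball 0 1) :=
  integrable_of_integrable_sq_weight ae_restrict_lastCoord_ne_zero
    (integrableOn_weight (by linarith) 1) h.measurable.aestronglyMeasurable h.integrable_sq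

theorem integrableOn_grad (h : IsSobolevPair a u G) (ha : a < 1) : IntegrableOn G (ball 0 1) :=
  integrable_of_integrable_sq_weight ae_restrict_lastCoord_ne_zero
    (integrableOn_weight (by linarith) 1) h.measurable_grad.aestronglyMeasurable
    h.integrable_grad_sq

theorem memSobolev (h : IsSobolevPair a u G) : MemSobolev a u where
  memLp := by
    rw [restrict_weighted _ measurableSet_ball, memLp_weighted_iff ae_restrict_lastCoord_ne_zero]
    exact ⟨h.measurable.aestronglyMeasurable, h.integrable_sq⟩
  exists_grad := by
    refine ⟨G, h.isWeakGradient, ?_⟩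
    rw [restrict_weighted _ measurableSet_ball, memLp_weighted_iff ae_restrict_lastCoord_ne_zero]
    exact ⟨h.measurable_grad.aestronglyMeasurable, h.integrable_grad_sq⟩

end IsSobolevPair

theorem locallyIntegrableOn_congr_ae {E F : Type*} [NormedAddCommGroup F] [TopologicalSpace E]
    [MeasurableSpace E] {μ : Measure E} {S : Set E} {f g : E → F} (hS : MeasurableSet S)
    (hf : LocallyIntegrableOn f S μ) (h : ∀ᵐ x ∂μ, x ∈ S → f x = g x) :
    LocallyIntegrableOn g S μ := by
  intro x hx
  obtain ⟨s, hs, hfs⟩ := hf x hx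
  refine ⟨s ∩ S, inter_mem hs self_mem_nhdsWithin, ?_⟩
  refine (hfs.mono_set inter_subset_left).congr ?_
  have h1 := (ae_restrict_iff' hS).2 h
  exact ae_mono (Measure.restrict_mono inter_subset_right le_rfl) h1

theorem IsWeakGradient.congr_ae {u v : Space d → ℝ} {G H : Space d → Space d}
    (h : IsWeakGradient u G) (huv : ∀ᵐ x, x ∈ ball (0 : Space d) 1 → u x = v x)
    (hGH : ∀ᵐ x, x ∈ ball (0 : Space d) 1 → G x = H x) : IsWeakGradient v H where
  locallyIntegrable := locallyIntegrableOn_congr_ae measurableSet_ball h.locallyIntegrable huv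
  locallyIntegrable_grad :=
    locallyIntegrableOn_congr_ae measurableSet_ball h.locallyIntegrable_grad hGH
  integral_eq := by
    intro i φ hφ hc hs
    have e1 : ∫ x in ball 0 1, u x * partialDeriv i φ x =
        ∫ x in ball 0 1, v x * partialDeriv i φ x := by
      refine setIntegral_congr_ae measurableSet_ball ?_
      filter_upwards [huv] with x hx hx1
      rw [hx hx1]
    have e2 : ∫ x in ball 0 1, G x i * φ x = ∫ x in ball 0 1, H x i * φ x := by
      refine setIntegral_congr_ae measurableSet_ball ?_
      filter_upwards [hGH] with x hx hx1
      rw [hx hx1]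
    rw [← e1, ← e2]
    exact h.integral_eq i φ hφ hc hs

/-- Every Sobolev function has a Borel representative. -/
theorem MemSobolev.exists_isSobolevPair {a : ℝ} {u : Space d → ℝ} (h : MemSobolev a u) :
    ∃ (v : Space d → ℝ) (G : Space d → Space d), IsSobolevPair a v G ∧
      (∀ᵐ x, x ∈ ball (0 : Space d) 1 → u x = v x) ∧
      (∀ᵐ x, x ∈ ball (0 : Space d) 1 → weakGradient u x = G x) := by
  obtain ⟨hu, G, hG, hG2⟩ := h
  rw [restrict_weighted _ measurableSet_ball, memLp_weighted_iff ae_restrict_lastCoord_ne_zero]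
    at hu hG2
  have e1 := (ae_restrict_iff' measurableSet_ball).1 hu.1.ae_eq_mk
  have e2 := (ae_restrict_iff' measurableSet_ball).1 hG2.1.ae_eq_mk
  refine ⟨hu.1.mk u, hG2.1.mk G, ⟨hu.1.measurable_mk, hG2.1.measurable_mk,
    hG.congr_ae e1 e2, ?_, ?_⟩, e1, ?_⟩
  · refine hu.2.congr ?_
    filter_upwards [hu.1.ae_eq_mk] with x hx
    rw [← hx]
  · refine hG2.2.congr ?_
    filter_upwards [hG2.1.ae_eq_mk] with x hx
    rw [← hx]
  · filter_upwards [hG.weakGradient_ae_eq, e2] with x h1 h2 hx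
    rw [h1 hx, h2 hx]

/-- A `C¹` profile `F` for which the radial map `y ↦ (1 + F(|y|²)) y` is a small perturbation of the
identity that is trivial outside the ball of radius `R < 1`. -/
structure IsSmallProfile (F : ℝ → ℝ) (R : ℝ) : Prop where
  contDiff : ContDiff ℝ 1 F
  pos : 0 < R
  lt_one : R < 1
  eq_zero : ∀ t, R ^ 2 ≤ t → F t = 0
  abs_apply_le : ∀ t, 0 ≤ t → |F t| ≤ 1 / 4
  abs_deriv_le : ∀ t, 0 ≤ t → |t * (2 * deriv F t)| ≤ 1 / 4

/-! ### Radial deformations -/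

section RadialMap

variable {E : Type*} [NormedAddCommGroup E] [InnerProductSpace ℝ E]

/-- The dilation factor `1 + F(|y|²)` of a radial map. -/
noncomputable def dilation (F : ℝ → ℝ) (y : E) : ℝ := 1 + F (‖y‖ ^ 2)

/-- The slope `2 F'(|y|²)`, so that the gradient of the dilation factor is `2 F'(|y|²) y`. -/
noncomputable def slope (F : ℝ → ℝ) (y : E) : ℝ := 2 * deriv F (‖y‖ ^ 2)

/-- The radial derivative factor `1 + F(|y|²) + 2 |y|² F'(|y|²)` of a radial map. -/
noncomputable def stretch (F : ℝ → ℝ) (y : E) : ℝ := dilation F y + ‖y‖ ^ 2 * slope F y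

/-- The radial map `y ↦ (1 + F(|y|²)) y`. -/
noncomputable def radialMap (F : ℝ → ℝ) (y : E) : E := dilation F y • y

/-- The derivative of the radial map. -/
noncomputable def radialDeriv (F : ℝ → ℝ) (y : E) : E →L[ℝ] E :=
  dilation F y • ContinuousLinearMap.id ℝ E + slope F y • (innerSL ℝ y).smulRight y

/-- The inverse of the derivative of the radial map. -/
noncomputable def radialDerivInv (F : ℝ → ℝ) (y : E) : E →L[ℝ] E :=
  (dilation F y)⁻¹ • (ContinuousLinearMap.id ℝ E -
    (slope F y / stretch F y) • (innerSL ℝ y).smulRight y)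

theorem radialDeriv_apply (F : ℝ → ℝ) (y w : E) :
    radialDeriv F y w = dilation F y • w + (slope F y * inner ℝ y w) • y := by
  simp [radialDeriv, smul_smul]

theorem radialDerivInv_apply (F : ℝ → ℝ) (y w : E) :
    radialDerivInv F y w =
      (dilation F y)⁻¹ • (w - (slope F y / stretch F y * inner ℝ y w) • y) := by
  simp [radialDerivInv, smul_smul]

theorem inner_radialDeriv (F : ℝ → ℝ) (y v w : E) :
    inner ℝ v (radialDeriv F y w) = inner ℝ (radialDeriv F y v) w := by
  simp only [radialDeriv_apply, inner_add_left, inner_add_right, inner_smul_left, inner_smul_right,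
    real_inner_comm y v]
  simp only [conj_trivial]
  ring

/-- The transformation rule for gradients involves the transpose of the inverse derivative; by
symmetry this is `radialDerivInv` itself. -/
theorem inner_radialDerivInv (F : ℝ → ℝ) (y v w : E) :
    inner ℝ v (radialDerivInv F y w) = inner ℝ (radialDerivInv F y v) w := by
  simp only [radialDerivInv_apply, inner_sub_left, inner_sub_right, inner_smul_left,
    inner_smul_right, real_inner_comm y v]
  simp only [conj_trivial]
  ring

/-- The Jacobian determinant of the radial map. -/
noncomputable def jacobian (F : ℝ → ℝ) (y : E) : ℝ :=
  dilation F y ^ (Module.finrank ℝ E) * (1 + ‖y‖ ^ 2 * slope F y / dilation F y)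

theorem continuous_dilation {F : ℝ → ℝ} (hF : Continuous F) : Continuous (dilation (E := E) F) :=
  continuous_const.add (hF.comp (continuous_norm.pow 2))

theorem continuous_slope {F : ℝ → ℝ} (hF : ContDiff ℝ 1 F) : Continuous (slope (E := E) F) :=
  continuous_const.mul ((hF.continuous_deriv (by norm_num)).comp (continuous_norm.pow 2))

theorem contDiff_dilation {F : ℝ → ℝ} (hF : ContDiff ℝ 1 F) : ContDiff ℝ 1 (dilation (E := E) F) :=
  contDiff_const.add (hF.comp (contDiff_norm_sq ℝ))

theorem contDiff_radialMap {F : ℝ → ℝ} (hF : ContDiff ℝ 1 F) :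
    ContDiff ℝ 1 (radialMap (E := E) F) := (contDiff_dilation hF).smul contDiff_id

theorem hasFDerivAt_dilation {F : ℝ → ℝ} (hF : ContDiff ℝ 1 F) (y : E) :
    HasFDerivAt (dilation F) (slope F y • innerSL ℝ y) y := by
  have h1 : HasFDerivAt (fun y : E => ‖y‖ ^ 2) (2 • innerSL ℝ y) y :=
    (hasStrictFDerivAt_norm_sq y).hasFDerivAt
  have h2 : HasDerivAt F (deriv F (‖y‖ ^ 2)) (‖y‖ ^ 2) :=
    (hF.differentiable (by norm_num)).differentiableAt.hasDerivAt
  refine ((h2.comp_hasFDerivAt y h1).const_add 1).congr_fderiv ?_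
  ext w
  simp [slope]
  ring

theorem hasFDerivAt_radialMap {F : ℝ → ℝ} (hF : ContDiff ℝ 1 F) (y : E) :
    HasFDerivAt (radialMap F) (radialDeriv F y) y := by
  refine ((hasFDerivAt_dilation hF y).smul (hasFDerivAt_id y)).congr_fderiv ?_
  ext w
  simp [radialDeriv_apply]

/-- After the dilation factor is taken out, the derivative is the identity plus a rank-one map in
the direction `y`, whose determinant is one plus its trace. -/
theorem det_radialDeriv [FiniteDimensional ℝ E] {F : ℝ → ℝ} {y : E} (h : dilation F y ≠ 0) :
    (radialDeriv F y).det = jacobian F y := by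
  have : ((radialDeriv F y : E →L[ℝ] E) : E →ₗ[ℝ] E) = dilation F y •
      LinearMap.transvection (((slope F y / dilation F y) • innerSL ℝ y : E →L[ℝ] ℝ) : E →ₗ[ℝ] ℝ)
        y := by
    ext w
    simp only [LinearMap.smul_apply, LinearMap.transvection.apply, ContinuousLinearMap.coe_coe,
      radialDeriv_apply, smul_add, smul_smul, _root_.smul_apply, innerSL_apply_apply,
      smul_eq_mul]
    congr 2
    field_simp
  rw [ContinuousLinearMap.det, this, LinearMap.det_smul, LinearMap.transvection.det, jacobian]
  congr 2
  simp
  ring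

namespace IsSmallProfile

variable {F : ℝ → ℝ} {R : ℝ}

theorem dilation_mem (h : IsSmallProfile F R) (y : E) : dilation F y ∈ Icc (3 / 4 : ℝ) (5 / 4) := by
  have := abs_le.1 (h.abs_apply_le (‖y‖ ^ 2) (by positivity))
  constructor <;> unfold dilation <;> linarith

theorem dilation_pos (h : IsSmallProfile F R) (y : E) : 0 < dilation F y := by
  linarith [(h.dilation_mem y).1]

theorem stretch_pos (h : IsSmallProfile F R) (y : E) : 0 < stretch F y := by
  have := abs_le.1 (h.abs_deriv_le (‖y‖ ^ 2) (by positivity))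
  have := (h.dilation_mem y).1
  unfold stretch slope
  linarith

theorem jacobian_pos (h : IsSmallProfile F R) (y : E) : 0 < jacobian F y := by
  have h1 := h.dilation_pos y
  have h2 := h.stretch_pos y
  have : 1 + ‖y‖ ^ 2 * slope F y / dilation F y = stretch F y / dilation F y := by
    unfold stretch
    field_simp
  unfold jacobian
  rw [this]
  positivity

theorem radialDeriv_radialDerivInv (h : IsSmallProfile F R) (y w : E) :
    radialDeriv F y (radialDerivInv F y w) = w := by
  have h1 := (h.dilation_pos y).ne'
  have h2 := (h.stretch_pos y).ne'
  rw [radialDeriv_apply, radialDerivInv_apply]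
  simp only [smul_sub, smul_smul, inner_sub_right, inner_smul_right, real_inner_self_eq_norm_sq]
  rw [mul_inv_cancel₀ h1, one_smul, sub_add, ← sub_smul]
  rw [show dilation F y * ((dilation F y)⁻¹ * (slope F y / stretch F y * inner ℝ y w)) -
    slope F y * ((dilation F y)⁻¹ * inner ℝ y w -
      (dilation F y)⁻¹ * (slope F y / stretch F y * inner ℝ y w) * ‖y‖ ^ 2) = 0 by
    field_simp
    rw [stretch]
    ring]
  simp

theorem radialDerivInv_radialDeriv (h : IsSmallProfile F R) (y w : E) :
    radialDerivInv F y (radialDeriv F y w) = w := by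
  refine ext_inner_left ℝ fun v => ?_
  rw [inner_radialDerivInv, inner_radialDeriv, h.radialDeriv_radialDerivInv]

/-- The derivative of the radial map as a continuous linear equivalence. -/
noncomputable def derivEquiv (h : IsSmallProfile F R) (y : E) : E ≃L[ℝ] E :=
  ContinuousLinearEquiv.equivOfInverse (radialDeriv F y) (radialDerivInv F y)
    (h.radialDerivInv_radialDeriv y) (h.radialDeriv_radialDerivInv y)

variable [CompleteSpace E]

/-- The derivative of the radial map minus the identity is `F • id + slope • y ⊗ y`. The two bounds
of `IsSmallProfile` give it norm at most `1/4 + 1/4`, and the mean value inequality applies. A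
Lipschitz constant below 1 makes the map a global homeomorphism. -/
theorem approximatesLinearOn (h : IsSmallProfile F R) :
    ApproximatesLinearOn (radialMap (E := E) F)
      ((ContinuousLinearEquiv.refl ℝ E : E ≃L[ℝ] E) : E →L[ℝ] E) univ (1 / 2) := by
  intro x _ y _
  have hd : ∀ z ∈ (univ : Set E), HasFDerivWithinAt (fun z => radialMap F z - z)
      (radialDeriv F z - ContinuousLinearMap.id ℝ E) univ z := fun z _ =>
    ((hasFDerivAt_radialMap h.contDiff z).sub (hasFDerivAt_id z)).hasFDerivWithinAt
  have hb : ∀ z ∈ (univ : Set E), ‖radialDeriv F z - ContinuousLinearMap.id ℝ E‖ ≤ 1 / 2 := by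
    intro z _
    refine ContinuousLinearMap.opNorm_le_bound _ (by norm_num) fun w => ?_
    have e : (radialDeriv F z - ContinuousLinearMap.id ℝ E) w =
        F (‖z‖ ^ 2) • w + (slope F z * inner ℝ z w) • z := by
      simp [radialDeriv_apply, dilation, add_smul]
      abel
    rw [e]
    have e1 := h.abs_apply_le (‖z‖ ^ 2) (by positivity)
    have e2 := h.abs_deriv_le (‖z‖ ^ 2) (by positivity)
    have e3 := abs_real_inner_le_norm z w
    calc _ ≤ ‖F (‖z‖ ^ 2) • w‖ + ‖(slope F z * inner ℝ z w) • z‖ := norm_add_le _ _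
      _ = |F (‖z‖ ^ 2)| * ‖w‖ + |slope F z| * |inner ℝ z w| * ‖z‖ := by
        rw [norm_smul, norm_smul, Real.norm_eq_abs, Real.norm_eq_abs, abs_mul]
      _ ≤ 1 / 4 * ‖w‖ + |slope F z| * (‖z‖ * ‖w‖) * ‖z‖ := by gcongr
      _ = 1 / 4 * ‖w‖ + |‖z‖ ^ 2 * (2 * deriv F (‖z‖ ^ 2))| * ‖w‖ := by
        rw [abs_mul (‖z‖ ^ 2), abs_of_nonneg (sq_nonneg ‖z‖), slope]
        ring
      _ ≤ 1 / 4 * ‖w‖ + 1 / 4 * ‖w‖ := by gcongr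
      _ = 1 / 2 * ‖w‖ := by ring
  have := convex_univ.norm_image_sub_le_of_norm_hasFDerivWithin_le hd hb (mem_univ y) (mem_univ x)
  simp only [ContinuousLinearEquiv.coe_refl, ContinuousLinearMap.coe_id', id_eq]
  calc _ = ‖radialMap F x - x - (radialMap F y - y)‖ := by congr 1; abel
    _ ≤ 1 / 2 * ‖x - y‖ := this
    _ = _ := by simp

/-- The radial map as a homeomorphism. -/
noncomputable def homeo (h : IsSmallProfile F R) : E ≃ₜ E :=
  h.approximatesLinearOn.toHomeomorph (radialMap F) (by
    rcases subsingleton_or_nontrivial E with hE | hE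
    · exact Or.inl hE
    · refine Or.inr ?_
      have : ‖((ContinuousLinearEquiv.refl ℝ E).symm : E →L[ℝ] E)‖₊ = 1 := by
        simp
      rw [this]
      norm_num)

@[simp]
theorem homeo_apply (h : IsSmallProfile F R) (y : E) : h.homeo y = radialMap F y := rfl

theorem contDiff_homeo_symm (h : IsSmallProfile F R) : ContDiff ℝ 1 (h.homeo (E := E)).symm :=
  (h.homeo (E := E)).contDiff_symm (f₀' := h.derivEquiv)
    (fun y => hasFDerivAt_radialMap h.contDiff y) (contDiff_radialMap h.contDiff)

theorem dilation_eq_one (h : IsSmallProfile F R) {y : E} (hy : R ≤ ‖y‖) : dilation F y = 1 := by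
  rw [dilation, h.eq_zero _ (by gcongr; exact h.pos.le), add_zero]

theorem slope_eq_zero (h : IsSmallProfile F R) {y : E} (hy : R ≤ ‖y‖) : slope F y = 0 := by
  have hRt : R ^ 2 ≤ ‖y‖ ^ 2 := by
    gcongr
    exact h.pos.le
  have hcont : Continuous (deriv F) := h.contDiff.continuous_deriv (by norm_num)
  have hzero : ∀ t ∈ Ioi (R ^ 2), deriv F t = 0 := by
    intro t ht
    have : F =ᶠ[𝓝 t] fun _ => 0 := by
      filter_upwards [Ioi_mem_nhds ht] with s hs
      exact h.eq_zero s (le_of_lt hs)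
    rw [this.deriv_eq]
    simp
  -- The case `‖y‖ = R` is reached by continuity of `F'`, since `F` is locally constant only for `t
  -- > R ^ 2`.
  have hcl : ∀ t ∈ closure (Ioi (R ^ 2)), deriv F t = 0 := fun t ht =>
    closure_minimal (t := {t | deriv F t = 0}) hzero
      (isClosed_eq hcont continuous_const) ht
  rw [closure_Ioi] at hcl
  rw [slope, hcl _ hRt, mul_zero]

theorem radialMap_eq_self (h : IsSmallProfile F R) {y : E} (hy : R ≤ ‖y‖) : radialMap F y = y := by
  rw [radialMap, h.dilation_eq_one hy, one_smul]

theorem homeo_symm_eq_self (h : IsSmallProfile F R) {y : E} (hy : R ≤ ‖y‖) :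
    h.homeo.symm y = y := by
  rw [Homeomorph.symm_apply_eq, homeo_apply, h.radialMap_eq_self hy]

/-- The map is bijective and fixes every point with `‖y‖ ≥ R`, so no point can cross a sphere of
radius `r ≥ R`. -/
theorem norm_radialMap_lt_iff (h : IsSmallProfile F R) {r : ℝ} (hr : R ≤ r) (y : E) :
    ‖radialMap F y‖ < r ↔ ‖y‖ < r := by
  constructor
  · intro hlt
    by_contra hy
    push Not at hy
    rw [h.radialMap_eq_self (hr.trans hy)] at hlt
    linarith
  · intro hlt
    by_contra hy
    push Not at hy
    have h1 := h.homeo_symm_eq_self (hr.trans hy)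
    rw [← homeo_apply h, Homeomorph.symm_apply_apply] at h1
    rw [h.homeo_apply] at h1
    rw [← h1] at hy
    linarith

theorem image_ball (h : IsSmallProfile F R) {r : ℝ} (hr : R ≤ r) :
    radialMap F '' ball (0 : E) r = ball 0 r := by
  ext x
  constructor
  · rintro ⟨y, hy, rfl⟩
    simpa using (h.norm_radialMap_lt_iff hr y).2 (by simpa using hy)
  · intro hx
    refine ⟨h.homeo.symm x, ?_, ?_⟩
    · have := (h.norm_radialMap_lt_iff hr (h.homeo.symm x)).1
      rw [← h.homeo_apply, Homeomorph.apply_symm_apply] at this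
      simpa using this (by simpa using hx)
    · rw [← h.homeo_apply, Homeomorph.apply_symm_apply]

theorem injective_radialMap (h : IsSmallProfile F R) : Function.Injective (radialMap (E := E) F) :=
  h.homeo.injective

theorem symm_radialMap (h : IsSmallProfile F R) (y : E) : h.homeo.symm (radialMap F y) = y := by
  rw [← h.homeo_apply, Homeomorph.symm_apply_apply]

end IsSmallProfile

end RadialMap

/-! ### Change of variables under a radial map -/

section ChangeOfVariables

variable {E : Type*} [NormedAddCommGroup E] [InnerProductSpace ℝ E] [FiniteDimensional ℝ E]
  [MeasurableSpace E] [BorelSpace E] {F : ℝ → ℝ} {R : ℝ}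

theorem continuous_jacobian (h : IsSmallProfile F R) : Continuous (jacobian (E := E) F) := by
  have h1 := continuous_dilation (E := E) h.contDiff.continuous
  exact (h1.pow _).mul (continuous_const.add
    (((continuous_norm.pow 2).mul (continuous_slope h.contDiff)).div h1
      fun y => (h.dilation_pos y).ne'))

theorem IsSmallProfile.lintegral_ball (h : IsSmallProfile F R) {r : ℝ} (hr : R ≤ r)
    (g : E → ENNReal) :
    ∫⁻ x in ball 0 r, g x = ∫⁻ y in ball 0 r, ENNReal.ofReal (jacobian F y) * g (radialMap F y) := by
  conv_lhs => rw [← h.image_ball hr]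
  rw [lintegral_image_eq_lintegral_abs_det_fderiv_mul volume measurableSet_ball
    (fun y _ => (hasFDerivAt_radialMap h.contDiff y).hasFDerivWithinAt)
    h.injective_radialMap.injOn]
  congr 1
  funext y
  rw [det_radialDeriv (h.dilation_pos y).ne', abs_of_pos (h.jacobian_pos y)]

theorem IsSmallProfile.integral_ball (h : IsSmallProfile F R) {r : ℝ} (hr : R ≤ r) (g : E → ℝ) :
    ∫ x in ball 0 r, g x = ∫ y in ball 0 r, jacobian F y * g (radialMap F y) := by
  conv_lhs => rw [← h.image_ball hr]
  rw [integral_image_eq_integral_abs_det_fderiv_smul volume measurableSet_ball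
    (fun y _ => (hasFDerivAt_radialMap h.contDiff y).hasFDerivWithinAt)
    h.injective_radialMap.injOn]
  congr 1
  funext y
  rw [det_radialDeriv (h.dilation_pos y).ne', abs_of_pos (h.jacobian_pos y), smul_eq_mul]

theorem IsSmallProfile.integrableOn_ball (h : IsSmallProfile F R) {r : ℝ} (hr : R ≤ r)
    (g : E → ℝ) :
    IntegrableOn g (ball 0 r) ↔
      IntegrableOn (fun y => jacobian F y * g (radialMap F y)) (ball 0 r) := by
  conv_lhs => rw [← h.image_ball hr]
  rw [integrableOn_image_iff_integrableOn_abs_det_fderiv_smul volume measurableSet_ball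
    (fun y _ => (hasFDerivAt_radialMap h.contDiff y).hasFDerivWithinAt)
    h.injective_radialMap.injOn]
  refine integrableOn_congr_fun (fun y _ => ?_) measurableSet_ball
  rw [det_radialDeriv (h.dilation_pos y).ne', abs_of_pos (h.jacobian_pos y), smul_eq_mul]

end ChangeOfVariables

/-! ### Transported functions and the chain rule -/

section Transport

variable {E : Type*} [NormedAddCommGroup E] [InnerProductSpace ℝ E] [CompleteSpace E]
  {F : ℝ → ℝ} {R : ℝ}

/-- The gradient at `radialMap F y` of the transported function, in terms of the value and the
gradient at `y` of the original one. -/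
noncomputable def transportVec (F : ℝ → ℝ) (κ : ℝ) (y : E) (s : ℝ) (g : E) : E :=
  radialDerivInv F y (dilation F y ^ κ • g + (κ * dilation F y ^ (κ - 1) * slope F y * s) • y)

/-- The function `(q^κ u) ∘ Ψ⁻¹`, where `Ψ y = q(y) y` is the radial map. -/
noncomputable def IsSmallProfile.transport (h : IsSmallProfile F R) (κ : ℝ) (u : E → ℝ) (x : E) : ℝ :=
  dilation F (h.homeo.symm x) ^ κ * u (h.homeo.symm x)

/-- The gradient of the transported function. -/
noncomputable def IsSmallProfile.transportGrad (h : IsSmallProfile F R) (κ : ℝ) (u : E → ℝ)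
    (G : E → E) (x : E) : E :=
  transportVec F κ (h.homeo.symm x) (u (h.homeo.symm x)) (G (h.homeo.symm x))

namespace IsSmallProfile

theorem transport_radialMap (h : IsSmallProfile F R) (κ : ℝ) (u : E → ℝ) (y : E) :
    h.transport κ u (radialMap F y) = dilation F y ^ κ * u y := by
  rw [transport, h.symm_radialMap]

theorem transportGrad_radialMap (h : IsSmallProfile F R) (κ : ℝ) (u : E → ℝ) (G : E → E) (y : E) :
    h.transportGrad κ u G (radialMap F y) = transportVec F κ y (u y) (G y) := by
  rw [transportGrad, h.symm_radialMap]

theorem contDiff_transport (h : IsSmallProfile F R) (κ : ℝ) {f : E → ℝ} (hf : ContDiff ℝ 1 f) :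
    ContDiff ℝ 1 (h.transport κ f) := by
  have : ContDiff ℝ 1 fun y : E => dilation F y ^ κ * f y :=
    ((contDiff_dilation h.contDiff).rpow_const_of_ne fun y => (h.dilation_pos y).ne').mul hf
  exact this.comp h.contDiff_homeo_symm

/-- Differentiate `v ∘ Ψ = q^κ f`, where `v` is the transported function. The chain rule gives `DΨᵀ
∇v = ∇(q^κ f)`, and `DΨ` is symmetric and invertible. -/
theorem gradient_transport (h : IsSmallProfile F R) (κ : ℝ) {f : E → ℝ} (hf : ContDiff ℝ 1 f)
    (x : E) : ∇ (h.transport κ f) x = h.transportGrad κ f (∇ f) x := by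
  obtain ⟨y, rfl⟩ := h.homeo.surjective x
  rw [homeo_apply, transportGrad_radialMap]
  have hv := h.contDiff_transport κ hf
  have hq : HasFDerivAt (fun y => dilation F y ^ κ * f y)
      (dilation F y ^ κ • fderiv ℝ f y +
        f y • ((κ * dilation F y ^ (κ - 1)) • (slope F y • innerSL ℝ y))) y := by
    have h1 := (hasFDerivAt_dilation h.contDiff y).rpow_const (p := κ)
      (Or.inl (h.dilation_pos y).ne')
    exact h1.mul (hf.differentiable (by norm_num)).differentiableAt.hasFDerivAt
  have hcomp : HasFDerivAt (fun y => dilation F y ^ κ * f y)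
      ((fderiv ℝ (h.transport κ f) (radialMap F y)).comp (radialDeriv F y)) y := by
    have h2 : HasFDerivAt (h.transport κ f) _ (radialMap F y) :=
      (hv.differentiable (by norm_num)).differentiableAt.hasFDerivAt
    have h3 := h2.comp y (hasFDerivAt_radialMap h.contDiff y)
    have : h.transport κ f ∘ radialMap F = fun y => dilation F y ^ κ * f y := by
      funext z
      exact h.transport_radialMap κ f z
    rwa [this] at h3
  have heq := hcomp.unique hq
  refine ext_inner_right ℝ fun w => ?_
  rw [inner_gradient_left]
  have hw := h.radialDeriv_radialDerivInv y w
  conv_lhs => rw [← hw]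
  have := congrArg (fun L => L (radialDerivInv F y w)) heq
  simp only [ContinuousLinearMap.comp_apply] at this
  rw [this, transportVec, ← inner_radialDerivInv, inner_add_left, inner_smul_left, inner_smul_left,
    inner_gradient_left]
  simp
  ring

theorem transportVec_sub (F : ℝ → ℝ) (κ : ℝ) (y : E) (s s' : ℝ) (g g' : E) :
    transportVec F κ y s g - transportVec F κ y s' g' = transportVec F κ y (s - s') (g - g') := by
  rw [transportVec, transportVec, transportVec, ← map_sub]
  congr 1
  rw [add_sub_add_comm, ← smul_sub, ← sub_smul, ← mul_sub]

theorem continuous_rpow_dilation (h : IsSmallProfile F R) (κ : ℝ) :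
    Continuous fun y : E => dilation F y ^ κ :=
  (continuous_dilation h.contDiff.continuous).rpow_const fun y => Or.inl (h.dilation_pos y).ne'

theorem continuous_stretch (h : IsSmallProfile F R) : Continuous (stretch (E := E) F) :=
  (continuous_dilation h.contDiff.continuous).add
    ((continuous_norm.pow 2).mul (continuous_slope h.contDiff))

theorem continuous_radialDerivInv (h : IsSmallProfile F R) :
    Continuous (radialDerivInv (E := E) F) := by
  refine ((continuous_dilation h.contDiff.continuous).inv₀ fun y => (h.dilation_pos y).ne').smul
    (continuous_const.sub (((continuous_slope h.contDiff).div h.continuous_stretch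
      fun y => (h.stretch_pos y).ne').smul ?_))
  have : Continuous fun y : E => ContinuousLinearMap.smulRightL ℝ E E (innerSL ℝ y) y :=
    ((ContinuousLinearMap.smulRightL ℝ E E).continuous.comp (innerSL ℝ).continuous).clm_apply
      continuous_id
  exact this

/-- The transported gradient is linear in the value and the gradient, with coefficients continuous
in `y`. The resulting uniform bound makes transport continuous both in `L¹` and in weighted `L²`. -/
theorem exists_transportVec_bound [FiniteDimensional ℝ E] (h : IsSmallProfile F R) (κ : ℝ) :
    ∃ C, 0 ≤ C ∧ ∀ y ∈ ball (0 : E) 1, ∀ s g, ‖transportVec F κ y s g‖ ≤ C * (‖s‖ + ‖g‖) := by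
  obtain ⟨C₁, h₁⟩ := (isCompact_closedBall (0 : E) 1).exists_bound_of_continuousOn
    (h.continuous_radialDerivInv (E := E)).continuousOn
  obtain ⟨C₂, h₂⟩ := (isCompact_closedBall (0 : E) 1).exists_bound_of_continuousOn
    (h.continuous_rpow_dilation (E := E) κ).continuousOn
  obtain ⟨C₃, h₃⟩ := (isCompact_closedBall (0 : E) 1).exists_bound_of_continuousOn
    (f := fun y : E => (κ * dilation F y ^ (κ - 1) * slope F y) • y)
    (((continuous_const.mul (h.continuous_rpow_dilation (κ - 1))).mul
      (continuous_slope h.contDiff)).smul continuous_id).continuousOn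
  have hc1 : 0 ≤ C₁ := (norm_nonneg _).trans (h₁ 0 (by simp))
  have hc2 : 0 ≤ C₂ := (norm_nonneg _).trans (h₂ 0 (by simp))
  have hc3 : 0 ≤ C₃ := (norm_nonneg _).trans (h₃ 0 (by simp))
  refine ⟨C₁ * (C₂ + C₃), by positivity, fun y hy s g => ?_⟩
  have hy' := ball_subset_closedBall hy
  have e1 := h₁ y hy'
  have e2 := h₂ y hy'
  have e3 := h₃ y hy'
  calc ‖transportVec F κ y s g‖
      ≤ ‖radialDerivInv F y‖ * ‖dilation F y ^ κ • g +
        (κ * dilation F y ^ (κ - 1) * slope F y * s) • y‖ := ContinuousLinearMap.le_opNorm _ _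
    _ ≤ C₁ * (C₂ * ‖g‖ + ‖s‖ * C₃) := by
        gcongr
        refine (norm_add_le _ _).trans ?_
        rw [norm_smul, mul_comm _ s, mul_smul, norm_smul]
        gcongr
    _ ≤ C₁ * (C₂ + C₃) * (‖s‖ + ‖g‖) := by
        rw [mul_assoc]
        gcongr
        nlinarith [norm_nonneg s, norm_nonneg g, mul_nonneg hc2 (norm_nonneg s),
          mul_nonneg hc3 (norm_nonneg g)]

end IsSmallProfile

end Transport

/-- The Cauchy-Schwarz inequality with a weight. -/
theorem sq_lintegral_le {α : Type*} [MeasurableSpace α] {μ : Measure α} {h w : α → ENNReal}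
    (hh : AEMeasurable h μ) (hw : AEMeasurable w μ) (h0 : ∀ᵐ x ∂μ, w x ≠ 0)
    (htop : ∀ᵐ x ∂μ, w x ≠ ⊤) :
    (∫⁻ x, h x ∂μ) ^ 2 ≤ (∫⁻ x, h x ^ 2 * w x ∂μ) * ∫⁻ x, (w x)⁻¹ ∂μ := by
  have hpq : Real.HolderConjugate 2 2 := Real.HolderConjugate.two_two
  have key := ENNReal.lintegral_mul_le_Lp_mul_Lq μ hpq
    (f := fun x => h x * w x ^ (1 / 2 : ℝ)) (g := fun x => (w x)⁻¹ ^ (1 / 2 : ℝ))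
    (hh.mul (hw.pow_const _)) (hw.inv.pow_const _)
  have e1 : ∫⁻ x, ((fun x => h x * w x ^ (1 / 2 : ℝ)) * fun x => (w x)⁻¹ ^ (1 / 2 : ℝ)) x ∂μ =
      ∫⁻ x, h x ∂μ := by
    refine lintegral_congr_ae ?_
    filter_upwards [h0, htop] with x hx0 hxt
    simp only [Pi.mul_apply]
    rw [mul_assoc, ← ENNReal.mul_rpow_of_nonneg _ _ (by norm_num), ENNReal.mul_inv_cancel hx0 hxt,
      ENNReal.one_rpow, mul_one]
  have e2 : ∀ x, (h x * w x ^ (1 / 2 : ℝ)) ^ (2 : ℝ) = h x ^ 2 * w x := by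
    intro x
    rw [ENNReal.mul_rpow_of_nonneg _ _ (by norm_num), ← ENNReal.rpow_mul]
    norm_num
  have e3 : ∀ x, ((w x)⁻¹ ^ (1 / 2 : ℝ)) ^ (2 : ℝ) = (w x)⁻¹ := by
    intro x
    rw [← ENNReal.rpow_mul]
    norm_num
  simp only [e2, e3] at key
  rw [e1] at key
  calc (∫⁻ x, h x ∂μ) ^ 2
      ≤ ((∫⁻ x, h x ^ 2 * w x ∂μ) ^ (1 / 2 : ℝ) * (∫⁻ x, (w x)⁻¹ ∂μ) ^ (1 / 2 : ℝ)) ^ 2 := by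
        gcongr
    _ = _ := by
        rw [← ENNReal.mul_rpow_of_nonneg _ _ (by norm_num), ← ENNReal.rpow_natCast,
          ← ENNReal.rpow_mul]
        norm_num

/-! ### The measure of the thin space -/

section ThinMeasure

theorem measurableEmbedding_thinEmbedding : MeasurableEmbedding (thinEmbedding d) := by
  have : thinEmbedding d = slice ∘ fun y => (y, (0 : ℝ)) := rfl
  rw [this]
  exact measurableEmbedding_slice.comp (measurableEmbedding_prod_mk_right 0)

theorem thinEmbedding_preimage_ball (r : ℝ) :
    thinEmbedding d ⁻¹' ball 0 r = ball 0 r := by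
  ext y
  simp [thinEmbedding_eq_slice, norm_slice_zero]

theorem restrict_thinMeasure_ball (r : ℝ) :
    (thinMeasure d).restrict (ball 0 r) = ((volume : Measure (EuclideanSpace ℝ (Fin d))).restrict
      (ball 0 r)).map (thinEmbedding d) := by
  rw [thinMeasure, measurableEmbedding_thinEmbedding.restrict_map, thinEmbedding_preimage_ball]

theorem setIntegral_thinMeasure (f : Space d → ℝ) (r : ℝ) :
    ∫ x in ball 0 r, f x ∂(thinMeasure d) = ∫ y in ball 0 r, f (slice (y, 0)) := by
  rw [restrict_thinMeasure_ball, measurableEmbedding_thinEmbedding.integral_map]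
  rfl

theorem ae_thinMeasure_iff {p : Space d → Prop} (r : ℝ) :
    (∀ᵐ x ∂(thinMeasure d).restrict (ball 0 r), p x) ↔
      ∀ᵐ y ∂(volume : Measure (EuclideanSpace ℝ (Fin d))).restrict (ball 0 r), p (slice (y, 0)) := by
  rw [restrict_thinMeasure_ball, measurableEmbedding_thinEmbedding.ae_map_iff]
  rfl

end ThinMeasure

/-! ### A formula for the thin trace -/

section Formula

/-- A curve that enters the upper half ball from the thin point `(y, 0)`. -/
noncomputable def thinCurve (y : EuclideanSpace ℝ (Fin d)) (t : ℝ) : Space d :=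
  slice ((1 - t) • y, t)

theorem hasDerivAt_thinCurve (y : EuclideanSpace ℝ (Fin d)) (t : ℝ) :
    HasDerivAt (thinCurve y) (slice (-y, 1)) t := by
  have h : HasDerivAt (fun t : ℝ => ((1 - t) • y, t)) (-y, (1 : ℝ)) t := by
    refine HasDerivAt.prodMk ?_ (hasDerivAt_id t)
    simpa using ((hasDerivAt_id t).const_sub 1).smul_const y
  exact (sliceL (d := d)).hasFDerivAt.comp_hasDerivAt t h

theorem continuous_thinCurve :
    Continuous fun p : EuclideanSpace ℝ (Fin d) × ℝ => thinCurve p.1 p.2 :=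
  continuous_slice.comp (((continuous_const.sub continuous_snd).smul continuous_fst).prodMk
    continuous_snd)

theorem norm_slice_neg_one_le {y : EuclideanSpace ℝ (Fin d)} (hy : ‖y‖ ≤ 1) :
    ‖slice (-y, (1 : ℝ))‖ ≤ 2 := by
  have := norm_slice_sq (-y, (1 : ℝ))
  simp only [norm_neg] at this
  nlinarith [norm_nonneg y, norm_nonneg (slice (-y, (1 : ℝ)))]

/-- The integrand of the formula for the thin trace. -/
noncomputable def thinIntegrand (u : Space d → ℝ) (G : Space d → Space d)
    (y : EuclideanSpace ℝ (Fin d)) (t : ℝ) : ℝ :=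
  2 * u (thinCurve y t) - (1 - 2 * t) * inner ℝ (G (thinCurve y t)) (slice (-y, 1))

/-- The value at `(y, 0)`, expressed by an integral over the curve `thinCurve y`. -/
noncomputable def thinFormula (u : Space d → ℝ) (G : Space d → Space d)
    (y : EuclideanSpace ℝ (Fin d)) : ℝ :=
  ∫ t in Ioo (0 : ℝ) (1 / 2), thinIntegrand u G y t

/-- The integrand is the derivative of `-(1 - 2t) f(γ(t))` along the curve `γ`. The factor `1 - 2t`
vanishes at `t = 1/2`, so only the value at the thin point remains. -/
theorem thinFormula_gradient {f : Space d → ℝ} (hf : ContDiff ℝ 1 f)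
    (y : EuclideanSpace ℝ (Fin d)) : thinFormula f (∇ f) y = f (slice (y, 0)) := by
  have hd : ∀ t, HasDerivAt (fun t => -((1 - 2 * t) * f (thinCurve y t)))
      (thinIntegrand f (∇ f) y t) t := by
    intro t
    have h1 : HasDerivAt (fun t => f (thinCurve y t))
        (fderiv ℝ f (thinCurve y t) (slice (-y, 1))) t :=
      (hf.differentiable (by norm_num)).differentiableAt.hasFDerivAt.comp_hasDerivAt t
        (hasDerivAt_thinCurve y t)
    have h2 : HasDerivAt (fun t : ℝ => 1 - 2 * t) (-(2 * 1)) t :=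
      ((hasDerivAt_id t).const_mul 2).const_sub 1
    refine (h2.mul h1).neg.congr_deriv ?_
    rw [thinIntegrand, inner_gradient_left]
    ring
  have hc : Continuous (thinIntegrand f (∇ f) y) := by
    have hcurve : Continuous (thinCurve y) :=
      continuous_thinCurve.comp (continuous_const.prodMk continuous_id)
    exact (continuous_const.mul (hf.continuous.comp hcurve)).sub
      ((continuous_const.sub (continuous_const.mul continuous_id)).mul
        (((continuous_gradient hf).comp hcurve).inner continuous_const))
  rw [thinFormula, ← integral_Ioc_eq_integral_Ioo,
    ← intervalIntegral.integral_of_le (by norm_num),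
    intervalIntegral.integral_eq_sub_of_hasDerivAt (fun t _ => hd t) (hc.intervalIntegrable _ _)]
  simp [thinCurve]

/-- The squared norm `(1 - t)² ‖y‖² + t²` is convex in `t`. The two conditions on `ρ` control its
values at the ends `t = 0` and `t = 1/2`. -/
theorem thinCurve_mem_ball {R ρ : ℝ} (hRρ : R ≤ ρ) (hρ : (1 + R ^ 2) / 4 ≤ ρ ^ 2)
    {y : EuclideanSpace ℝ (Fin d)} (hy : y ∈ ball 0 R) {t : ℝ} (ht : t ∈ Ioo (0 : ℝ) (1 / 2)) :
    thinCurve y t ∈ ball (0 : Space d) ρ := by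
  have hy' : ‖y‖ < R := by simpa using hy
  have hn := norm_slice_sq ((1 - t) • y, t)
  simp only [norm_smul, Real.norm_eq_abs] at hn
  rw [mul_pow, sq_abs] at hn
  have hR0 : 0 < R := (norm_nonneg y).trans_lt hy'
  have hlt : ‖y‖ ^ 2 < R ^ 2 := by gcongr
  rw [mem_ball_zero_iff, thinCurve]
  refine lt_of_pow_lt_pow_left₀ 2 (hR0.le.trans hRρ) ?_
  rw [hn]
  have h1 : (1 - t) ^ 2 * ‖y‖ ^ 2 < (1 - t) ^ 2 * R ^ 2 := by
    have : 0 < (1 - t) ^ 2 := by have := ht.2; exact pow_pos (by linarith) 2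
    gcongr
  have h2 : R ^ 2 ≤ ρ ^ 2 := by gcongr
  nlinarith [ht.1, ht.2, mul_pos ht.1 (sub_pos.2 ht.2), sq_nonneg R]

/-- At each height `t` the curves act on `y` as the dilation by `1 - t`, and `t < 1/2` keeps the
Jacobian factor `(1 - t)^(-d)` below `2^d`. Fubini's theorem then gives the integral over the solid
ball. -/
theorem lintegral_thinCurve_le {g : Space d → ENNReal} (hg : Measurable g) {R ρ : ℝ}
    (hRρ : R ≤ ρ) (hρ : (1 + R ^ 2) / 4 ≤ ρ ^ 2) :
    ∫⁻ y in ball (0 : EuclideanSpace ℝ (Fin d)) R, ∫⁻ t in Ioo (0 : ℝ) (1 / 2), g (thinCurve y t)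
      ≤ 2 ^ d * ∫⁻ x in ball 0 ρ, g x := by
  set g' : Space d → ENNReal := (ball 0 ρ).indicator g with hg'
  have hg'm : Measurable g' := hg.indicator measurableSet_ball
  have hcm : Measurable fun p : EuclideanSpace ℝ (Fin d) × ℝ => g' (thinCurve p.1 p.2) :=
    hg'm.comp continuous_thinCurve.measurable
  calc ∫⁻ y in ball (0 : EuclideanSpace ℝ (Fin d)) R, ∫⁻ t in Ioo (0 : ℝ) (1 / 2),
        g (thinCurve y t)
      ≤ ∫⁻ y : EuclideanSpace ℝ (Fin d), ∫⁻ t in Ioo (0 : ℝ) (1 / 2), g' (thinCurve y t) := by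
        refine le_trans (setLIntegral_mono' measurableSet_ball fun y hy => ?_)
          (setLIntegral_le_lintegral (ball 0 R) _)
        refine setLIntegral_mono' measurableSet_Ioo fun t ht => ?_
        rw [hg', indicator_of_mem (thinCurve_mem_ball hRρ hρ hy ht)]
    _ = ∫⁻ t in Ioo (0 : ℝ) (1 / 2), ∫⁻ y : EuclideanSpace ℝ (Fin d), g' (thinCurve y t) :=
        lintegral_lintegral_swap hcm.aemeasurable
    _ ≤ ∫⁻ t in Ioo (0 : ℝ) (1 / 2), 2 ^ d * ∫⁻ y : EuclideanSpace ℝ (Fin d), g' (slice (y, t)) := by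
        refine setLIntegral_mono' measurableSet_Ioo fun t ht => ?_
        have ht1 : (0 : ℝ) < 1 - t := by linarith [ht.2]
        have hm : Measurable fun y : EuclideanSpace ℝ (Fin d) => g' (slice (y, t)) :=
          hg'm.comp (continuous_slice.comp (continuous_id.prodMk continuous_const)).measurable
        have := lintegral_map (μ := (volume : Measure (EuclideanSpace ℝ (Fin d)))) hm
          (measurable_const_smul (1 - t))
        rw [Measure.map_addHaar_smul _ ht1.ne', lintegral_smul_measure] at this
        rw [show (∫⁻ y : EuclideanSpace ℝ (Fin d), g' (thinCurve y t)) = _ from this.symm,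
          smul_eq_mul]
        gcongr
        rw [finrank_euclideanSpace_fin, abs_of_pos (by positivity), ← inv_pow,
          ENNReal.ofReal_pow (by positivity)]
        gcongr
        rw [show (2 : ENNReal) = ENNReal.ofReal 2 by simp]
        refine ENNReal.ofReal_le_ofReal ?_
        rw [inv_le_comm₀ ht1 (by norm_num)]
        linarith [ht.2]
    _ ≤ 2 ^ d * ∫⁻ t : ℝ, ∫⁻ y : EuclideanSpace ℝ (Fin d), g' (slice (y, t)) := by
        rw [lintegral_const_mul' _ _ (by simp)]
        gcongr
        exact Measure.restrict_le_self
    _ = 2 ^ d * ∫⁻ x in ball 0 ρ, g x := by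
        rw [← lintegral_eq_lintegral_slice hg'm, hg', lintegral_indicator measurableSet_ball]

theorem enorm_thinIntegrand_le (u : Space d → ℝ) (G : Space d → Space d)
    {y : EuclideanSpace ℝ (Fin d)} (hy : ‖y‖ ≤ 1) {t : ℝ} (ht : t ∈ Ioo (0 : ℝ) (1 / 2)) :
    ‖thinIntegrand u G y t‖ₑ ≤ 2 * (‖u (thinCurve y t)‖ₑ + ‖G (thinCurve y t)‖ₑ) := by
  have h1 : ‖thinIntegrand u G y t‖ ≤ 2 * (‖u (thinCurve y t)‖ + ‖G (thinCurve y t)‖) := by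
    rw [thinIntegrand, mul_add]
    refine (norm_sub_le _ _).trans (add_le_add (by simp) ?_)
    rw [norm_mul]
    have e1 : ‖1 - 2 * t‖ ≤ 1 := by
      rw [Real.norm_eq_abs, abs_le]
      constructor <;> linarith [ht.1, ht.2]
    have e2 := norm_inner_le_norm (𝕜 := ℝ) (G (thinCurve y t)) (slice (-y, 1))
    have e3 := norm_slice_neg_one_le hy
    calc _ ≤ 1 * (‖G (thinCurve y t)‖ * 2) := by
          gcongr
          exact e2.trans (by gcongr)
      _ = _ := by ring
  rw [← ofReal_norm, ← ofReal_norm, ← ofReal_norm,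
    ← ENNReal.ofReal_add (norm_nonneg _) (norm_nonneg _)]
  refine (ENNReal.ofReal_le_ofReal h1).trans (le_of_eq ?_)
  rw [ENNReal.ofReal_mul (by norm_num), ENNReal.ofReal_ofNat]

theorem measurable_thinIntegrand {u : Space d → ℝ} {G : Space d → Space d} (hu : Measurable u)
    (hG : Measurable G) :
    Measurable fun p : EuclideanSpace ℝ (Fin d) × ℝ => thinIntegrand u G p.1 p.2 := by
  have hc := (continuous_thinCurve (d := d)).measurable
  refine ((hu.comp hc).const_mul 2).sub (Measurable.mul (by fun_prop) ?_)
  refine (hG.comp hc).inner (Continuous.measurable ?_)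
  exact continuous_slice.comp (continuous_fst.neg.prodMk continuous_const)

theorem measurable_thinFormula {u : Space d → ℝ} {G : Space d → Space d} (hu : Measurable u)
    (hG : Measurable G) : Measurable (thinFormula u G) :=
  ((measurable_thinIntegrand hu hG).stronglyMeasurable.integral_prod_right
    (ν := volume.restrict (Ioo (0 : ℝ) (1 / 2)))).measurable

theorem thinIntegrand_sub (u v : Space d → ℝ) (G H : Space d → Space d)
    (y : EuclideanSpace ℝ (Fin d)) (t : ℝ) :
    thinIntegrand u G y t - thinIntegrand v H y t =
      thinIntegrand (fun x => u x - v x) (fun x => G x - H x) y t := by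
  simp only [thinIntegrand, inner_sub_left]
  ring

/-- `L¹` continuity of the thin trace formula. -/
theorem lintegral_thinFormula_sub_le {u v : Space d → ℝ} {G H : Space d → Space d}
    (hu : Measurable u) (hG : Measurable G) (hv : Measurable v) (hH : Measurable H) {R ρ : ℝ}
    (hR : R ≤ 1) (hRρ : R ≤ ρ) (hρ : (1 + R ^ 2) / 4 ≤ ρ ^ 2)
    (iu : IntegrableOn u (ball 0 ρ)) (iG : IntegrableOn G (ball 0 ρ))
    (iv : IntegrableOn v (ball 0 ρ)) (iH : IntegrableOn H (ball 0 ρ)) :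
    ∫⁻ y in ball 0 R, ‖thinFormula u G y - thinFormula v H y‖ₑ ≤
      2 * 2 ^ d * ((∫⁻ x in ball 0 ρ, ‖u x - v x‖ₑ) + ∫⁻ x in ball 0 ρ, ‖G x - H x‖ₑ) := by
  have hle1 : ∀ y ∈ ball (0 : EuclideanSpace ℝ (Fin d)) R, ‖y‖ ≤ 1 := fun y hy =>
    ((mem_ball_zero_iff.1 hy).le).trans hR
  -- This bound serves twice: for each pair it gives integrability along almost every curve, and for
  -- the pair of differences it gives the estimate itself, since the integrand is linear in the
  -- pair.
  have hbase : ∀ {f : Space d → ℝ} {K : Space d → Space d}, Measurable f → Measurable K →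
      ∫⁻ y in ball (0 : EuclideanSpace ℝ (Fin d)) R, ∫⁻ t in Ioo (0 : ℝ) (1 / 2),
        ‖thinIntegrand f K y t‖ₑ ≤
      2 * 2 ^ d * ((∫⁻ x in ball 0 ρ, ‖f x‖ₑ) + ∫⁻ x in ball 0 ρ, ‖K x‖ₑ) := by
    intro f K hf hK
    calc _ ≤ ∫⁻ y in ball (0 : EuclideanSpace ℝ (Fin d)) R, ∫⁻ t in Ioo (0 : ℝ) (1 / 2),
          2 * (‖f (thinCurve y t)‖ₑ + ‖K (thinCurve y t)‖ₑ) :=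
          setLIntegral_mono' measurableSet_ball fun y hy =>
            setLIntegral_mono' measurableSet_Ioo fun t ht => enorm_thinIntegrand_le f K (hle1 y hy) ht
      _ ≤ 2 ^ d * ∫⁻ x in ball 0 ρ, 2 * (‖f x‖ₑ + ‖K x‖ₑ) :=
          lintegral_thinCurve_le (g := fun x => 2 * (‖f x‖ₑ + ‖K x‖ₑ))
            ((hf.enorm.add hK.enorm).const_mul 2) hRρ hρ
      _ = _ := by
          rw [lintegral_const_mul 2 (f := fun x => ‖f x‖ₑ + ‖K x‖ₑ) (hf.enorm.add hK.enorm),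
            lintegral_add_left hf.enorm]
          ring
  have hint : ∀ {f : Space d → ℝ} {K : Space d → Space d}, Measurable f → Measurable K →
      IntegrableOn f (ball 0 ρ) → IntegrableOn K (ball 0 ρ) →
      ∀ᵐ y ∂(volume : Measure (EuclideanSpace ℝ (Fin d))).restrict (ball 0 R),
        IntegrableOn (thinIntegrand f K y) (Ioo 0 (1 / 2)) := by
    intro f K hf hK jf jK
    have hm := measurable_thinIntegrand hf hK
    have hfin : ∫⁻ y in ball (0 : EuclideanSpace ℝ (Fin d)) R, ∫⁻ t in Ioo (0 : ℝ) (1 / 2),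
        ‖thinIntegrand f K y t‖ₑ ≠ ⊤ := by
      refine ((hbase hf hK).trans_lt ?_).ne
      exact ENNReal.mul_lt_top (by simp [ENNReal.mul_lt_top])
        (ENNReal.add_lt_top.2 ⟨jf.2, jK.2⟩)
    filter_upwards [ae_lt_top (Measurable.lintegral_prod_right hm.enorm) hfin] with y hy
    exact ⟨(hm.comp measurable_prodMk_left).aestronglyMeasurable, hy⟩
  refine le_trans (lintegral_mono_ae ?_) (hbase (hu.sub hv) (hG.sub hH))
  filter_upwards [hint hu hG iu iG, hint hv hH iv iH] with y h1 h2
  rw [thinFormula, thinFormula, ← integral_sub h1 h2]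
  refine (enorm_integral_le_lintegral_enorm _).trans (le_of_eq ?_)
  simp only [thinIntegrand_sub]

end Formula

/-! ### Gauss-Green in the half ball and the thin trace -/

section GaussGreen

theorem setIntegral_eq_integral_slice {g : Space d → ℝ} (hg : Integrable g) :
    ∫ x in {x | 0 < lastCoord x}, g x =
      ∫ y : EuclideanSpace ℝ (Fin d), ∫ t in Ioi (0 : ℝ), g (slice (y, t)) := by
  have hS : MeasurableSet {x : Space d | 0 < lastCoord x} :=
    measurableSet_lt measurable_const continuous_lastCoord.measurable
  have e1 : ∫ x in {x | 0 < lastCoord x}, g x =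
      ∫ p in univ ×ˢ Ioi (0 : ℝ), g (slice p) := by
    rw [← measurePreserving_slice.setIntegral_preimage_emb measurableEmbedding_slice]
    congr 2
    ext p
    simp
  rw [e1, Measure.volume_eq_prod, setIntegral_prod]
  · simp
  · have := measurePreserving_slice.integrable_comp_of_integrable hg
    exact this.integrableOn

/-- On each vertical half line the fundamental theorem of calculus leaves only the value at height
0, with a minus sign. -/
theorem setIntegral_partialDeriv_last {p : Space d → ℝ} (hp : ContDiff ℝ 1 p)
    (hc : HasCompactSupport p) :
    ∫ x in {x | 0 < lastCoord x}, partialDeriv (Fin.last d) p x =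
      -∫ y : EuclideanSpace ℝ (Fin d), p (slice (y, 0)) := by
  rw [setIntegral_eq_integral_slice ((continuous_partialDeriv hp _).integrable_of_hasCompactSupport
    (hasCompactSupport_partialDeriv hc _)), ← integral_neg]
  congr 1
  funext y
  have hd : ∀ t : ℝ, HasDerivAt (fun t => slice (y, t)) (EuclideanSpace.single (Fin.last d) 1 :
      Space d) t := by
    intro t
    have h1 : HasDerivAt (fun t : ℝ => (y, t)) ((0 : EuclideanSpace ℝ (Fin d)), (1 : ℝ)) t :=
      (hasDerivAt_const t y).prodMk (hasDerivAt_id t)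
    have h2 := (sliceL (d := d)).hasFDerivAt.comp_hasDerivAt t h1
    refine h2.congr_deriv ?_
    symm
    refine slice_ext (fun i => ?_) ?_
    · simp [Fin.castSucc_ne_last]
    · simp [lastCoord]
  have hline : ∀ t, deriv (fun t => p (slice (y, t))) t = partialDeriv (Fin.last d) p (slice (y, t)) :=
    fun t => ((hp.differentiable (by norm_num)).differentiableAt.hasFDerivAt.comp_hasDerivAt t
      (hd t)).deriv
  have hcurve : ContDiff ℝ 1 fun t : ℝ => slice (y, t) :=
    (contDiff_slice.of_le (by exact_mod_cast le_top)).comp (contDiff_const.prodMk contDiff_id)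
  have hcs : HasCompactSupport fun t : ℝ => p (slice (y, t)) := by
    obtain ⟨C, hC⟩ := hc.isCompact.isBounded.subset_closedBall (0 : Space d)
    refine HasCompactSupport.of_support_subset_isCompact (isCompact_closedBall (0 : ℝ) C)
      fun t ht => ?_
    have := hC (subset_tsupport _ ht)
    rw [mem_closedBall_zero_iff] at this ⊢
    exact (abs_snd_le_norm_slice (y, t)).trans this
  have := HasCompactSupport.integral_Ioi_deriv_eq (hp.comp hcurve) hcs 0
  simp only [Function.comp_def] at this
  rw [← this]
  congr 1
  funext t
  exact (hline t).symm

end GaussGreen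

/-- The projection `x ↦ x'`. -/
noncomputable def thinPart (x : Space d) : EuclideanSpace ℝ (Fin d) :=
  WithLp.toLp 2 fun i => x (Fin.castSucc i)

@[simp]
theorem thinPart_slice (p : EuclideanSpace ℝ (Fin d) × ℝ) : thinPart (slice p) = p.1 := by
  ext i
  simp [thinPart]

theorem enorm_sq_mul_ofReal_weight {F : Type*} [NormedAddCommGroup F] (a : ℝ) (v : F)
    (x : Space d) : ‖‖v‖ ^ 2 * weight a x‖ₑ = ‖v‖ₑ ^ 2 * ENNReal.ofReal (weight a x) := by
  rw [← ofReal_norm, Real.norm_of_nonneg (mul_nonneg (sq_nonneg _) (weight_nonneg a x)),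
    ENNReal.ofReal_mul (sq_nonneg _), ENNReal.ofReal_pow (norm_nonneg _), ofReal_norm]

theorem enorm_add_sq_le {α β : Type*} [NormedAddCommGroup α] [NormedAddCommGroup β] (x : α) (y : β) :
    (‖x‖ₑ + ‖y‖ₑ) ^ 2 ≤ 2 * (‖x‖ₑ ^ 2 + ‖y‖ₑ ^ 2) := by
  rw [← ofReal_norm, ← ofReal_norm, ← ENNReal.ofReal_add (norm_nonneg _) (norm_nonneg _),
    ← ENNReal.ofReal_pow (by positivity), ← ENNReal.ofReal_pow (by positivity),
    ← ENNReal.ofReal_pow (by positivity), ← ENNReal.ofReal_add (by positivity) (by positivity),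
    show (2 : ENNReal) * ENNReal.ofReal (‖x‖ ^ 2 + ‖y‖ ^ 2) =
      ENNReal.ofReal (2 * (‖x‖ ^ 2 + ‖y‖ ^ 2)) by
      rw [ENNReal.ofReal_mul (by norm_num), ENNReal.ofReal_ofNat]]
  exact ENNReal.ofReal_le_ofReal (by nlinarith [sq_nonneg (‖x‖ - ‖y‖)])

namespace IsSobolevPair

variable {a : ℝ} {u : Space d → ℝ} {G : Space d → Space d}

theorem lintegral_sq_lt_top (h : IsSobolevPair a u G) :
    ∫⁻ x in ball 0 1, (‖u x‖ₑ + ‖G x‖ₑ) ^ 2 * ENNReal.ofReal (weight a x) < ⊤ := by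
  have h1 := h.integrable_sq.2
  have h2 := h.integrable_grad_sq.2
  simp only [hasFiniteIntegral_iff_enorm, enorm_sq_mul_ofReal_weight] at h1 h2
  have hm : Measurable fun x => ‖u x‖ₑ ^ 2 * ENNReal.ofReal (weight a x) :=
    (h.measurable.enorm.pow_const 2).mul (measurable_weight a).ennreal_ofReal
  have hm' : Measurable fun x => ‖G x‖ₑ ^ 2 * ENNReal.ofReal (weight a x) :=
    (h.measurable_grad.enorm.pow_const 2).mul (measurable_weight a).ennreal_ofReal
  calc _ ≤ ∫⁻ x in ball 0 1, 2 * (‖u x‖ₑ ^ 2 * ENNReal.ofReal (weight a x) +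
        ‖G x‖ₑ ^ 2 * ENNReal.ofReal (weight a x)) := by
        refine lintegral_mono fun x => ?_
        simp only
        rw [← add_mul, ← mul_assoc]
        gcongr
        exact enorm_add_sq_le _ _
    _ < ⊤ := by
        rw [lintegral_const_mul 2 (f := fun x => ‖u x‖ₑ ^ 2 * ENNReal.ofReal (weight a x) +
          ‖G x‖ₑ ^ 2 * ENNReal.ofReal (weight a x)) (hm.add hm'), lintegral_add_left hm]
        exact ENNReal.mul_lt_top (by simp) (ENNReal.add_lt_top.2 ⟨h1, h2⟩)

/-- The curve has height `t` at time `t`, so the weight along it is `t^a` and does not depend on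
`y`. Cauchy-Schwarz against this weight costs the constant `K = ∫ t^(-a)`, finite because `a < 1`.
Integrating in `y` then leaves the weighted `L²` norms; the choice `R = ρ = 1` covers the whole thin
ball. -/
theorem memLp_thinFormula (h : IsSobolevPair a u G) (ha : a < 1) :
    MemLp (thinFormula u G) 2 (volume.restrict (ball 0 1)) := by
  have hm := measurable_thinFormula h.measurable h.measurable_grad
  refine ⟨hm.aestronglyMeasurable, ?_⟩
  rw [eLpNorm_lt_top_iff_lintegral_rpow_enorm_lt_top (by norm_num) (by norm_num)]
  set K : ENNReal := ∫⁻ t in Ioo (0 : ℝ) (1 / 2), (ENNReal.ofReal (|t| ^ a))⁻¹ with hK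
  have hKtop : K < ⊤ := by
    have : IntegrableOn (fun t : ℝ => |t| ^ (-a)) (Ioo 0 (1 / 2)) :=
      (integrableOn_abs_rpow (by linarith) (1 / 2)).mono_set (Ioo_subset_Ioo_left (by norm_num))
    refine lt_of_le_of_lt (le_of_eq ?_) this.2
    refine setLIntegral_congr_fun measurableSet_Ioo fun t ht => ?_
    have htp : 0 < |t| := abs_pos.2 ht.1.ne'
    simp only
    rw [← ENNReal.ofReal_inv_of_pos (Real.rpow_pos_of_pos htp _), ← Real.rpow_neg htp.le,
      Real.enorm_of_nonneg (Real.rpow_nonneg htp.le _)]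
  have hg : Measurable fun x : Space d => (‖u x‖ₑ + ‖G x‖ₑ) ^ 2 * ENNReal.ofReal (weight a x) :=
    ((h.measurable.enorm.add h.measurable_grad.enorm).pow_const 2).mul
      (measurable_weight a).ennreal_ofReal
  have hcurve : ∀ y : EuclideanSpace ℝ (Fin d), Measurable (thinCurve y) := fun y =>
    (continuous_thinCurve.comp (continuous_const.prodMk continuous_id)).measurable
  calc ∫⁻ y in ball (0 : EuclideanSpace ℝ (Fin d)) 1, ‖thinFormula u G y‖ₑ ^ (2 : ENNReal).toReal
      ≤ ∫⁻ y in ball (0 : EuclideanSpace ℝ (Fin d)) 1, ∫⁻ t in Ioo (0 : ℝ) (1 / 2),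
          4 * K * ((‖u (thinCurve y t)‖ₑ + ‖G (thinCurve y t)‖ₑ) ^ 2 *
            ENNReal.ofReal (weight a (thinCurve y t))) := by
        refine setLIntegral_mono' measurableSet_ball fun y hy => ?_
        have hy1 : ‖y‖ ≤ 1 := (mem_ball_zero_iff.1 hy).le
        have hmc : Measurable fun t => ‖u (thinCurve y t)‖ₑ + ‖G (thinCurve y t)‖ₑ :=
          (h.measurable.comp (hcurve y)).enorm.add (h.measurable_grad.comp (hcurve y)).enorm
        have e1 : ‖thinFormula u G y‖ₑ ≤
            ∫⁻ t in Ioo (0 : ℝ) (1 / 2), 2 * (‖u (thinCurve y t)‖ₑ + ‖G (thinCurve y t)‖ₑ) :=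
          (enorm_integral_le_lintegral_enorm _).trans
            (setLIntegral_mono' measurableSet_Ioo fun t ht => enorm_thinIntegrand_le u G hy1 ht)
        have e2 := sq_lintegral_le (μ := volume.restrict (Ioo (0 : ℝ) (1 / 2)))
          (h := fun t => 2 * (‖u (thinCurve y t)‖ₑ + ‖G (thinCurve y t)‖ₑ))
          (w := fun t => ENNReal.ofReal (|t| ^ a)) (hmc.const_mul 2).aemeasurable
          (measurable_norm.pow_const a).ennreal_ofReal.aemeasurable
          (by
            refine (ae_restrict_iff' measurableSet_Ioo).2 (Eventually.of_forall fun t ht => ?_)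
            simpa using Real.rpow_pos_of_pos (abs_pos.2 ht.1.ne') a)
          (Eventually.of_forall fun t => ENNReal.ofReal_ne_top)
        have hw : ∀ t, weight a (thinCurve y t) = |t| ^ a := fun t => by
          simp [weight, thinCurve]
        simp only [hw]
        rw [ENNReal.toReal_ofNat, ENNReal.rpow_ofNat]
        refine (pow_le_pow_left₀ zero_le e1 2).trans (e2.trans (le_of_eq ?_))
        rw [← hK, ← lintegral_mul_const' _ _ hKtop.ne]
        congr 1
        funext t
        ring
    _ = ∫⁻ y in ball (0 : EuclideanSpace ℝ (Fin d)) 1, 4 * K * ∫⁻ t in Ioo (0 : ℝ) (1 / 2),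
          ((‖u (thinCurve y t)‖ₑ + ‖G (thinCurve y t)‖ₑ) ^ 2 *
            ENNReal.ofReal (weight a (thinCurve y t))) := by
        congr 1
        funext y
        rw [lintegral_const_mul' _ _ (ENNReal.mul_ne_top (by simp) hKtop.ne)]
    _ ≤ 4 * K * (2 ^ d * ∫⁻ x in ball 0 1, (‖u x‖ₑ + ‖G x‖ₑ) ^ 2 *
          ENNReal.ofReal (weight a x)) := by
        rw [lintegral_const_mul' _ _ (ENNReal.mul_ne_top (by simp) hKtop.ne)]
        gcongr
        exact lintegral_thinCurve_le hg le_rfl (by norm_num)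
    _ < ⊤ := ENNReal.mul_lt_top (ENNReal.mul_lt_top (by simp) hKtop)
        (ENNReal.mul_lt_top (by simp) h.lintegral_sq_lt_top)

/-- The thin values of smooth approximations converge to the thin trace formula. -/
theorem tendsto_thinFormula (h : IsSobolevPair a u G) (ha : a < 1) {R : ℝ} (hR0 : 0 ≤ R)
    (hR : R < 1) {f : ℕ → Space d → ℝ} (hf : ∀ k, ContDiff ℝ 1 (f k))
    (hfu : Tendsto (fun k => ∫⁻ x in ball 0 ((1 + R) / 2), ‖f k x - u x‖ₑ) atTop (𝓝 0))
    (hfG : Tendsto (fun k => ∫⁻ x in ball 0 ((1 + R) / 2), ‖∇ (f k) x - G x‖ₑ) atTop (𝓝 0)) :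
    Tendsto (fun k => ∫⁻ y in ball (0 : EuclideanSpace ℝ (Fin d)) R,
      ‖f k (slice (y, 0)) - thinFormula u G y‖ₑ) atTop (𝓝 0) := by
  have hlim := ENNReal.Tendsto.const_mul (a := 2 * 2 ^ d) (hfu.add hfG)
    (Or.inr (by simp [ENNReal.mul_eq_top]))
  rw [add_zero, mul_zero] at hlim
  have hsub : ball (0 : Space d) ((1 + R) / 2) ⊆ ball 0 1 := ball_subset_ball (by linarith)
  refine tendsto_of_tendsto_of_tendsto_of_le_of_le tendsto_const_nhds hlim (fun _ => zero_le)
    fun k => ?_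
  -- For `0 ≤ R < 1` the radius `ρ = (1 + R) / 2` is below 1 and meets both requirements, since `1 +
  -- R ^ 2 ≤ (1 + R) ^ 2`.
  have := lintegral_thinFormula_sub_le (R := R) (ρ := (1 + R) / 2) (hf k).continuous.measurable
    (continuous_gradient (hf k)).measurable h.measurable h.measurable_grad hR.le (by linarith)
    (by nlinarith) (continuousOn_integrableOn_ball (hf k).continuous _)
    (continuousOn_integrableOn_ball (continuous_gradient (hf k)) _)
    ((h.integrableOn ha).mono_set hsub) ((h.integrableOn_grad ha).mono_set hsub)
  simpa only [thinFormula_gradient (hf k)] using this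

/-- The identity is classical for the smooth approximations. Its solid terms converge in `L¹`, and
its boundary term converges because the thin values of the approximations tend in `L¹` to
`thinFormula`. -/
theorem setIntegral_gauss_green (h : IsSobolevPair a u G) (ha : a < 1) {φ : Space d → ℝ}
    (hφ : ContDiff ℝ ∞ φ) (hc : HasCompactSupport φ) (hs : tsupport φ ⊆ ball 0 1) :
    ∫ x in ball 0 1 ∩ {x : Space d | 0 < lastCoord x},
        (u x * partialDeriv (Fin.last d) φ x + lastCoord (G x) * φ x) =
      -∫ y in ball (0 : EuclideanSpace ℝ (Fin d)) 1, thinFormula u G y * φ (slice (y, 0)) := by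
  set H : Set (Space d) := {x : Space d | 0 < lastCoord x} with hH
  have hHm : MeasurableSet H :=
    measurableSet_lt measurable_const continuous_lastCoord.measurable
  have hφ1 : ContDiff ℝ 1 φ := hφ.of_le (by exact_mod_cast le_top)
  obtain ⟨R', hR', hsR'⟩ := exists_lt_subset_ball (isClosed_tsupport φ) hs
  -- `R'` may be negative when the support is empty, while the limit of thin values requires a
  -- nonnegative radius.
  set R := max R' 0 with hRdef
  have hR0 : 0 ≤ R := le_max_right _ _
  have hR : R < 1 := max_lt hR' one_pos
  have hsR : tsupport φ ⊆ ball 0 R := hsR'.trans (ball_subset_ball (le_max_left _ _))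
  set ρ := (1 + R) / 2 with hρ
  have hρ1 : ρ < 1 := by rw [hρ]; linarith
  have hRρ : R ≤ ρ := by rw [hρ]; linarith
  have hsub : ball (0 : Space d) ρ ⊆ ball 0 1 := ball_subset_ball hρ1.le
  obtain ⟨f, hf, hfu, hfG⟩ := h.isWeakGradient.isSmoothlyApproximable ρ hρ1
  have htr := h.tendsto_thinFormula ha hR0 hR hf hfu hfG
  obtain ⟨C₁, hC₁⟩ := exists_bound_of_hasCompactSupport hφ.continuous hc
  obtain ⟨C₂, hC₂⟩ := exists_bound_of_hasCompactSupport (continuous_partialDeriv hφ1 (Fin.last d))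
    (hasCompactSupport_partialDeriv hc (Fin.last d))
  have hz : ∀ x, x ∉ ball (0 : Space d) R → φ x = 0 := fun x hx =>
    image_eq_zero_of_notMem_tsupport fun hx' => hx (hsR hx')
  have hz' : ∀ x, x ∉ ball (0 : Space d) ρ → φ x = 0 := fun x hx =>
    hz x fun hx' => hx (ball_subset_ball hRρ hx')
  have hzd : ∀ x, x ∉ ball (0 : Space d) ρ → partialDeriv (Fin.last d) φ x = 0 := fun x hx =>
    partialDeriv_eq_zero_of_notMem_tsupport fun hx' => hx (ball_subset_ball hRρ (hsR hx'))
  have hmono : ∀ g : Space d → ENNReal, ∫⁻ x in ball 0 ρ ∩ H, g x ≤ ∫⁻ x in ball 0 ρ, g x :=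
    fun g => lintegral_mono_set inter_subset_left
  have iu : IntegrableOn u (ball 0 ρ ∩ H) :=
    (h.integrableOn ha).mono_set (inter_subset_left.trans hsub)
  have iG : IntegrableOn (fun x => lastCoord (G x)) (ball 0 ρ ∩ H) :=
    integrableOn_apply ((h.integrableOn_grad ha).mono_set (inter_subset_left.trans hsub)) _
  have l1 := tendsto_setIntegral_mul_of_L1 (S := ball 0 ρ ∩ H)
    (fun k => (continuousOn_integrableOn_ball (hf k).continuous ρ).mono_set inter_subset_left)
    iu (tendsto_of_tendsto_of_tendsto_of_le_of_le tendsto_const_nhds hfu (fun _ => zero_le)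
      fun k => hmono _)
    (continuous_partialDeriv hφ1 (Fin.last d)).aestronglyMeasurable hC₂
  have l2 := tendsto_setIntegral_mul_of_L1 (S := ball 0 ρ ∩ H)
    (F := fun k x => lastCoord (∇ (f k) x)) (f := fun x => lastCoord (G x))
    (fun k => (integrableOn_apply (continuousOn_integrableOn_ball (continuous_gradient (hf k)) ρ)
      (Fin.last d)).mono_set inter_subset_left) iG
    (tendsto_of_tendsto_of_tendsto_of_le_of_le tendsto_const_nhds hfG (fun _ => zero_le)
      fun k => le_trans (lintegral_mono fun x => by
        simp only [lastCoord, ← ofReal_norm, ← PiLp.sub_apply]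
        exact ENNReal.ofReal_le_ofReal (PiLp.norm_apply_le _ _)) (hmono _))
    hφ.continuous.aestronglyMeasurable hC₁
  have hfin : IsFiniteMeasure ((volume : Measure (EuclideanSpace ℝ (Fin d))).restrict
      (ball 0 1)) := ⟨by simpa using measure_ball_lt_top⟩
  have l3 := tendsto_setIntegral_mul_of_L1 (S := ball (0 : EuclideanSpace ℝ (Fin d)) R)
    (F := fun k y => f k (slice (y, 0))) (f := thinFormula u G) (ψ := fun y => φ (slice (y, 0)))
    (fun k => continuousOn_integrableOn_ball ((hf k).continuous.comp
      (continuous_slice.comp (continuous_id.prodMk continuous_const))) R)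
    (((h.memLp_thinFormula ha).integrable (by norm_num)).mono_measure
      (Measure.restrict_mono (ball_subset_ball hR.le) le_rfl)) htr
    (hφ.continuous.comp (continuous_slice.comp
      (continuous_id.prodMk continuous_const))).aestronglyMeasurable (fun y => hC₁ _)
  have hk : ∀ k, (∫ x in ball 0 ρ ∩ H, f k x * partialDeriv (Fin.last d) φ x) +
      ∫ x in ball 0 ρ ∩ H, lastCoord (∇ (f k) x) * φ x =
      -∫ y in ball (0 : EuclideanSpace ℝ (Fin d)) R, f k (slice (y, 0)) * φ (slice (y, 0)) := by
    intro k
    have hp : ContDiff ℝ 1 fun x => f k x * φ x := (hf k).mul hφ1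
    have hgg := setIntegral_partialDeriv_last hp hc.mul_left
    have hpd : ∀ x, partialDeriv (Fin.last d) (fun x => f k x * φ x) x =
        f k x * partialDeriv (Fin.last d) φ x + lastCoord (∇ (f k) x) * φ x := by
      intro x
      have : HasFDerivAt (fun x => f k x * φ x) _ x :=
        (((hf k).differentiable (by norm_num)).differentiableAt (x := x)).hasFDerivAt.mul
          ((hφ1.differentiable (by norm_num)).differentiableAt (x := x)).hasFDerivAt
      rw [lastCoord, gradient_apply, partialDeriv, this.fderiv]
      simp [partialDeriv]
      ring
    rw [← integral_add]
    · rw [inter_comm, ← setIntegral_eq_of_subset_of_forall_sdiff_eq_zero hHm inter_subset_left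
        fun x hx => by
          have hx' : x ∉ ball (0 : Space d) ρ := fun hb => hx.2 ⟨hx.1, hb⟩
          rw [hz' x hx', hzd x hx', mul_zero, mul_zero, add_zero]]
      simp_rw [← hpd]
      rw [hgg, setIntegral_eq_integral_of_forall_compl_eq_zero fun y hy => by
        rw [hz (slice (y, 0)) (by simpa [norm_slice_zero] using hy), mul_zero]]
    · exact (((hf k).continuous.mul (continuous_partialDeriv hφ1 _)).integrable_of_hasCompactSupport
        (hasCompactSupport_partialDeriv hc _).mul_left).integrableOn
    · exact (((continuous_lastCoord.comp (continuous_gradient (hf k))).mul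
        hφ.continuous).integrable_of_hasCompactSupport hc.mul_left).integrableOn
  have hfinal := tendsto_nhds_unique (l1.add l2) ((l3.neg).congr fun k => (hk k).symm)
  rw [setIntegral_eq_of_subset_of_forall_sdiff_eq_zero (s := ball 0 ρ ∩ H)
    (measurableSet_ball.inter hHm) (inter_subset_inter_left _ hsub) fun x hx => by
      have hx' : x ∉ ball (0 : Space d) ρ := fun hb => hx.2 ⟨hb, hx.1.2⟩
      rw [hz' x hx', hzd x hx', mul_zero, mul_zero, add_zero],
    integral_add, hfinal, setIntegral_ball_eq_of_support hR.le fun y hy => by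
      rw [hz (slice (y, 0)) (by simpa [norm_slice_zero] using hy), mul_zero]]
  · exact iu.mul_bdd (c := C₂) (continuous_partialDeriv hφ1 _).aestronglyMeasurable
      (Eventually.of_forall hC₂)
  · exact iG.mul_bdd (c := C₁) hφ.continuous.aestronglyMeasurable (Eventually.of_forall hC₁)

end IsSobolevPair

/-- The trace formula gives the thin trace of every function that agrees almost everywhere with the
given Sobolev function. -/
theorem IsSobolevPair.isThinTrace {a : ℝ} {u v : Space d → ℝ} {G : Space d → Space d}
    (h : IsSobolevPair a v G) (ha : a < 1)
    (huv : ∀ᵐ x, x ∈ ball (0 : Space d) 1 → u x = v x)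
    (hG : ∀ᵐ x, x ∈ ball (0 : Space d) 1 → weakGradient u x = G x) :
    IsThinTrace u fun x => thinFormula v G (thinPart x) where
  memLp := by
    rw [restrict_thinMeasure_ball, measurableEmbedding_thinEmbedding.memLp_map_measure_iff]
    have : (fun x => thinFormula v G (thinPart x)) ∘ thinEmbedding d = thinFormula v G := by
      funext y
      simp [thinEmbedding_eq_slice]
    rw [this]
    exact h.memLp_thinFormula ha
  gauss_green := by
    intro φ hφ hc hs
    have hHm : MeasurableSet {x : Space d | 0 < lastCoord x} :=
      measurableSet_lt measurable_const continuous_lastCoord.measurable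
    rw [setIntegral_thinMeasure]
    simp only [thinPart_slice]
    rw [← h.setIntegral_gauss_green ha hφ hc hs]
    refine setIntegral_congr_ae (measurableSet_ball.inter hHm) ?_
    filter_upwards [huv, hG] with x h1 h2 hx
    rw [h1 hx.1, h2 hx.1]

theorem isFiniteMeasureOnCompacts_thinMeasure : IsFiniteMeasureOnCompacts (thinMeasure d) where
  lt_top_of_isCompact := by
    intro K hK
    obtain ⟨R, hR⟩ := hK.isBounded.subset_ball (0 : Space d)
    refine (measure_mono hR).trans_lt ?_
    rw [thinMeasure, measurableEmbedding_thinEmbedding.map_apply, thinEmbedding_preimage_ball]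
    exact measure_ball_lt_top

/-- Thin traces are unique almost everywhere. -/
theorem IsThinTrace.ae_eq {u T T' : Space d → ℝ} (h : IsThinTrace u T) (h' : IsThinTrace u T') :
    ∀ᵐ x ∂(thinMeasure d).restrict (ball 0 1), T x = T' x := by
  have := isFiniteMeasureOnCompacts_thinMeasure (d := d)
  have hfin : IsFiniteMeasure ((thinMeasure d).restrict (ball 0 1)) := by
    constructor
    rw [Measure.restrict_apply_univ]
    exact (measure_mono ball_subset_closedBall).trans_lt
      (isCompact_closedBall (0 : Space d) 1).measure_lt_top
  have i1 : IntegrableOn T (ball 0 1) (thinMeasure d) := h.memLp.integrable (by norm_num)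
  have i2 : IntegrableOn T' (ball 0 1) (thinMeasure d) := h'.memLp.integrable (by norm_num)
  refine (ae_restrict_iff' measurableSet_ball).2 ?_
  have key := isOpen_ball.ae_eq_zero_of_integral_contDiff_smul_eq_zero (U := ball (0 : Space d) 1)
    (i1.sub i2).locallyIntegrableOn (fun φ hφ hc hs => ?_)
  · filter_upwards [key] with x hx hx1
    have := hx hx1
    simp only [Pi.sub_apply] at this
    linarith
  · have e1 := h.gauss_green φ hφ hc hs
    have e2 := h'.gauss_green φ hφ hc hs
    obtain ⟨C, hC⟩ := exists_bound_of_hasCompactSupport hφ.continuous hc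
    have j1 : IntegrableOn (fun x => T x * φ x) (ball 0 1) (thinMeasure d) :=
      i1.mul_bdd (c := C) hφ.continuous.aestronglyMeasurable (Eventually.of_forall hC)
    have j2 : IntegrableOn (fun x => T' x * φ x) (ball 0 1) (thinMeasure d) :=
      i2.mul_bdd (c := C) hφ.continuous.aestronglyMeasurable (Eventually.of_forall hC)
    rw [← setIntegral_eq_integral_of_forall_compl_eq_zero (s := ball (0 : Space d) 1) fun x hx => by
      rw [image_eq_zero_of_notMem_tsupport fun hx' => hx (hs hx'), zero_smul]]
    calc ∫ x in ball 0 1, φ x • (T - T') x ∂(thinMeasure d)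
        = ∫ x in ball 0 1, (T x * φ x - T' x * φ x) ∂(thinMeasure d) := by
          congr 1; funext x; simp only [Pi.sub_apply, smul_eq_mul]; ring
      _ = 0 := by rw [integral_sub j1 j2]; linarith

theorem IsThinTrace.thinTrace_ae_eq {u T : Space d → ℝ} (h : IsThinTrace u T) :
    ∀ᵐ y : EuclideanSpace ℝ (Fin d), y ∈ ball (0 : EuclideanSpace ℝ (Fin d)) 1 →
      thinTrace u (slice (y, 0)) = T (slice (y, 0)) := by
  have hex : ∃ T, IsThinTrace u T := ⟨T, h⟩
  have hT : IsThinTrace u (thinTrace u) := by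
    rw [thinTrace, dif_pos hex]
    exact hex.choose_spec
  exact (ae_restrict_iff' measurableSet_ball).1 ((ae_thinMeasure_iff 1).1 (hT.ae_eq h))

theorem IsSobolevPair.thinTrace_ae_eq {a : ℝ} {u v : Space d → ℝ} {G : Space d → Space d}
    (h : IsSobolevPair a v G) (ha : a < 1)
    (huv : ∀ᵐ x, x ∈ ball (0 : Space d) 1 → u x = v x)
    (hG : ∀ᵐ x, x ∈ ball (0 : Space d) 1 → weakGradient u x = G x) :
    ∀ᵐ y : EuclideanSpace ℝ (Fin d), y ∈ ball (0 : EuclideanSpace ℝ (Fin d)) 1 →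
      thinTrace u (slice (y, 0)) = thinFormula v G y := by
  simpa using (h.isThinTrace ha huv hG).thinTrace_ae_eq

/-! ### Transport of weighted Sobolev functions and of their traces -/

theorem lastCoord_smul (c : ℝ) (x : Space d) : lastCoord (c • x) = c * lastCoord x := by
  simp [lastCoord]

theorem dilation_slice (F : ℝ → ℝ) (y : EuclideanSpace ℝ (Fin d)) :
    dilation F (slice (y, 0)) = dilation F y := by
  rw [dilation, dilation, norm_slice_zero]

theorem radialMap_slice (F : ℝ → ℝ) (y : EuclideanSpace ℝ (Fin d)) :
    radialMap F (slice (y, 0)) = slice (radialMap F y, 0) := by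
  rw [radialMap, radialMap, dilation_slice, ← slice_smul]
  simp

namespace IsSmallProfile

variable {F : ℝ → ℝ} {R : ℝ}

theorem weight_radialMap (hF : IsSmallProfile F R) (a : ℝ) (y : Space d) :
    weight a (radialMap F y) = dilation F y ^ a * weight a y :=
  weight_smul a (hF.dilation_pos y).le y

theorem measurable_transport (hF : IsSmallProfile F R) (κ : ℝ) {u : Space d → ℝ}
    (hu : Measurable u) : Measurable (hF.transport κ u) := by
  have h1 : Measurable fun y : Space d => dilation F y ^ κ * u y :=
    (hF.continuous_rpow_dilation κ).measurable.mul hu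
  exact h1.comp hF.homeo.symm.continuous.measurable

theorem measurable_transportVec (hF : IsSmallProfile F R) (κ : ℝ) {u : Space d → ℝ}
    {G : Space d → Space d} (hu : Measurable u) (hG : Measurable G) :
    Measurable fun y => transportVec F κ y (u y) (G y) := by
  have hq := (continuous_dilation (E := Space d) hF.contDiff.continuous).measurable
  have hs := (continuous_slope (E := Space d) hF.contDiff).measurable
  have ht := (hF.continuous_stretch (E := Space d)).measurable
  have hX : Measurable fun y : Space d =>
      dilation F y ^ κ • G y + (κ * dilation F y ^ (κ - 1) * slope F y * u y) • y :=
    ((hF.continuous_rpow_dilation κ).measurable.smul hG).add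
      ((((measurable_const.mul (hF.continuous_rpow_dilation (κ - 1)).measurable).mul hs).mul
        hu).smul measurable_id)
  simp only [transportVec, radialDerivInv_apply]
  exact hq.inv.smul (hX.sub (((hs.div ht).mul (measurable_id.inner hX)).smul measurable_id))

theorem measurable_transportGrad (hF : IsSmallProfile F R) (κ : ℝ) {u : Space d → ℝ}
    {G : Space d → Space d} (hu : Measurable u) (hG : Measurable G) :
    Measurable (hF.transportGrad κ u G) :=
  (hF.measurable_transportVec κ hu hG).comp hF.homeo.symm.continuous.measurable

theorem exists_bound_on_ball {f : Space d → ℝ} (hf : Continuous f) :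
    ∃ C, 0 ≤ C ∧ ∀ y ∈ ball (0 : Space d) 1, ‖f y‖ ≤ C := by
  obtain ⟨C, hC⟩ := (isCompact_closedBall (0 : Space d) 1).exists_bound_of_continuousOn
    hf.continuousOn
  exact ⟨C, (norm_nonneg _).trans (hC 0 (by simp)), fun y hy => hC y (ball_subset_closedBall hy)⟩

theorem integrableOn_transport_sq (hF : IsSmallProfile F R) (κ a : ℝ) {u : Space d → ℝ}
    {G : Space d → Space d} (h : IsSobolevPair a u G) :
    IntegrableOn (fun x => ‖hF.transport κ u x‖ ^ 2 * weight a x) (ball 0 1) := by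
  rw [hF.integrableOn_ball hF.lt_one.le]
  simp only [transport_radialMap, weight_radialMap hF]
  have hcont : Continuous fun y : Space d =>
      jacobian F y * ((dilation F y ^ κ) ^ 2 * dilation F y ^ a) :=
    (continuous_jacobian hF).mul (((hF.continuous_rpow_dilation κ).pow 2).mul
      (hF.continuous_rpow_dilation a))
  obtain ⟨C, -, hC⟩ := exists_bound_on_ball hcont
  refine (h.integrable_sq.bdd_mul (c := C) hcont.aestronglyMeasurable
    ((ae_restrict_iff' measurableSet_ball).2 (Eventually.of_forall hC))).congr ?_
  refine Eventually.of_forall fun y => ?_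
  simp only [norm_mul, Real.norm_eq_abs]
  rw [abs_of_pos (Real.rpow_pos_of_pos (hF.dilation_pos y) κ)]
  ring

theorem integrableOn_transportGrad_sq (hF : IsSmallProfile F R) (κ a : ℝ) {u : Space d → ℝ}
    {G : Space d → Space d} (h : IsSobolevPair a u G) :
    IntegrableOn (fun x => ‖hF.transportGrad κ u G x‖ ^ 2 * weight a x) (ball 0 1) := by
  rw [hF.integrableOn_ball hF.lt_one.le]
  simp only [transportGrad_radialMap, weight_radialMap hF]
  have hcont : Continuous fun y : Space d => jacobian F y * dilation F y ^ a :=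
    (continuous_jacobian hF).mul (hF.continuous_rpow_dilation a)
  obtain ⟨C, hC0, hC⟩ := exists_bound_on_ball hcont
  obtain ⟨C', hC'0, hC'⟩ := hF.exists_transportVec_bound (E := Space d) κ
  refine Integrable.mono' (g := fun y => C * (2 * C' ^ 2) *
    (‖u y‖ ^ 2 * weight a y + ‖G y‖ ^ 2 * weight a y))
    ((h.integrable_sq.add h.integrable_grad_sq).const_mul _) ?_ ?_
  · exact ((continuous_jacobian hF).measurable.mul
      (((hF.measurable_transportVec κ h.measurable h.measurable_grad).norm.pow_const 2).mul
        ((hF.continuous_rpow_dilation a).measurable.mul (measurable_weight a)))).aestronglyMeasurable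
  · refine (ae_restrict_iff' measurableSet_ball).2 (Eventually.of_forall fun y hy => ?_)
    have e1 := hC y hy
    have e2 := hC' y hy (u y) (G y)
    have hw := weight_nonneg a y
    calc ‖jacobian F y * (‖transportVec F κ y (u y) (G y)‖ ^ 2 * (dilation F y ^ a * weight a y))‖
        = ‖jacobian F y * dilation F y ^ a‖ * (‖transportVec F κ y (u y) (G y)‖ ^ 2 * weight a y) := by
          rw [← Real.norm_of_nonneg (mul_nonneg (sq_nonneg ‖transportVec F κ y (u y) (G y)‖) hw),
            ← norm_mul]
          congr 1
          ring
      _ ≤ C * ((C' * (‖u y‖ + ‖G y‖)) ^ 2 * weight a y) := by gcongr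
      _ ≤ C * (2 * C' ^ 2) * (‖u y‖ ^ 2 * weight a y + ‖G y‖ ^ 2 * weight a y) := by
          have : (‖u y‖ + ‖G y‖) ^ 2 ≤ 2 * (‖u y‖ ^ 2 + ‖G y‖ ^ 2) := by
            nlinarith [sq_nonneg (‖u y‖ - ‖G y‖)]
          calc _ = C * C' ^ 2 * weight a y * (‖u y‖ + ‖G y‖) ^ 2 := by ring
            _ ≤ C * C' ^ 2 * weight a y * (2 * (‖u y‖ ^ 2 + ‖G y‖ ^ 2)) := by gcongr
            _ = _ := by ring

theorem tendsto_transport (hF : IsSmallProfile F R) (κ : ℝ) {ρ : ℝ} (hρ : R ≤ ρ) (hρ1 : ρ ≤ 1)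
    {f : ℕ → Space d → ℝ} {u : Space d → ℝ}
    (hfu : Tendsto (fun k => ∫⁻ x in ball 0 ρ, ‖f k x - u x‖ₑ) atTop (𝓝 0)) :
    Tendsto (fun k => ∫⁻ x in ball 0 ρ, ‖hF.transport κ (f k) x - hF.transport κ u x‖ₑ) atTop
      (𝓝 0) := by
  have hcont : Continuous fun y : Space d => jacobian F y * dilation F y ^ κ :=
    (continuous_jacobian hF).mul (hF.continuous_rpow_dilation κ)
  obtain ⟨C, hC0, hC⟩ := exists_bound_on_ball hcont
  have hlim := ENNReal.Tendsto.const_mul (a := ENNReal.ofReal C) hfu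
    (Or.inr ENNReal.ofReal_ne_top)
  rw [mul_zero] at hlim
  refine tendsto_of_tendsto_of_tendsto_of_le_of_le tendsto_const_nhds hlim (fun _ => zero_le)
    fun k => ?_
  simp only
  rw [hF.lintegral_ball hρ, ← lintegral_const_mul' _ _ ENNReal.ofReal_ne_top]
  refine setLIntegral_mono' measurableSet_ball fun y hy => ?_
  have e1 := hC y (ball_subset_ball hρ1 hy)
  rw [transport_radialMap, transport_radialMap, ← ofReal_norm, ← ofReal_norm,
    ← ENNReal.ofReal_mul (hF.jacobian_pos y).le, ← ENNReal.ofReal_mul hC0]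
  refine ENNReal.ofReal_le_ofReal ?_
  calc _ = ‖jacobian F y * dilation F y ^ κ‖ * ‖f k y - u y‖ := by
        rw [← mul_sub, norm_mul, norm_mul, Real.norm_of_nonneg (hF.jacobian_pos y).le]
        ring
    _ ≤ _ := by gcongr

theorem tendsto_transportGrad (hF : IsSmallProfile F R) (κ : ℝ) {ρ : ℝ} (hρ : R ≤ ρ) (hρ1 : ρ ≤ 1)
    {f : ℕ → Space d → ℝ} {u : Space d → ℝ} {G : Space d → Space d}
    (hf : ∀ k, ContDiff ℝ 1 (f k)) (hu : Measurable u)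
    (hfu : Tendsto (fun k => ∫⁻ x in ball 0 ρ, ‖f k x - u x‖ₑ) atTop (𝓝 0))
    (hfG : Tendsto (fun k => ∫⁻ x in ball 0 ρ, ‖∇ (f k) x - G x‖ₑ) atTop (𝓝 0)) :
    Tendsto (fun k => ∫⁻ x in ball 0 ρ, ‖∇ (hF.transport κ (f k)) x -
      hF.transportGrad κ u G x‖ₑ) atTop (𝓝 0) := by
  obtain ⟨C, hC0, hC⟩ := exists_bound_on_ball (d := d) (continuous_jacobian hF)
  obtain ⟨C', hC'0, hC'⟩ := hF.exists_transportVec_bound (E := Space d) κ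
  have hlim := ENNReal.Tendsto.const_mul (a := ENNReal.ofReal (C * C')) (hfu.add hfG)
    (Or.inr ENNReal.ofReal_ne_top)
  rw [add_zero, mul_zero] at hlim
  refine tendsto_of_tendsto_of_tendsto_of_le_of_le tendsto_const_nhds hlim (fun _ => zero_le)
    fun k => ?_
  simp only
  have hadd : Measurable fun x => ‖f k x - u x‖ₑ := ((hf k).continuous.measurable.sub hu).enorm
  rw [hF.lintegral_ball hρ, ← lintegral_add_left hadd,
    ← lintegral_const_mul' _ _ ENNReal.ofReal_ne_top]
  refine setLIntegral_mono' measurableSet_ball fun y hy => ?_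
  have hy1 := ball_subset_ball hρ1 hy
  have e1 := hC y hy1
  rw [gradient_transport hF κ (hf k), transportGrad_radialMap, transportGrad_radialMap,
    transportVec_sub, ← ofReal_norm, ← ofReal_norm, ← ofReal_norm,
    ← ENNReal.ofReal_mul (hF.jacobian_pos y).le,
    ← ENNReal.ofReal_add (norm_nonneg _) (norm_nonneg _), ← ENNReal.ofReal_mul (by positivity)]
  refine ENNReal.ofReal_le_ofReal ?_
  rw [mul_assoc]
  have e2 := hC' y hy1 (f k y - u y) (∇ (f k) y - G y)
  have e3 : jacobian F y ≤ C := (le_abs_self _).trans e1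
  exact mul_le_mul e3 e2 (norm_nonneg _) hC0

/-- Transport preserves the weighted Sobolev space. -/
theorem isSobolevPair_transport (hF : IsSmallProfile F R) (κ : ℝ) {a : ℝ} (ha : a < 1)
    {u : Space d → ℝ} {G : Space d → Space d} (h : IsSobolevPair a u G) :
    IsSobolevPair a (hF.transport κ u) (hF.transportGrad κ u G) := by
  have m1 := hF.measurable_transport κ h.measurable
  have m2 := hF.measurable_transportGrad κ h.measurable h.measurable_grad
  have s1 := hF.integrableOn_transport_sq κ a h
  have s2 := hF.integrableOn_transportGrad_sq κ a h
  have i1 : IntegrableOn (hF.transport κ u) (ball 0 1) :=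
    integrable_of_integrable_sq_weight (a := a) ae_restrict_lastCoord_ne_zero
      (integrableOn_weight (by linarith) 1) m1.aestronglyMeasurable s1
  have i2 : IntegrableOn (hF.transportGrad κ u G) (ball 0 1) :=
    integrable_of_integrable_sq_weight (a := a) ae_restrict_lastCoord_ne_zero
      (integrableOn_weight (by linarith) 1) m2.aestronglyMeasurable s2
  -- The transported approximations of `u` approximate the transported function. The radius `max r
  -- R` is used because the deformation maps balls onto themselves only from radius `R` on.
  refine ⟨m1, m2, IsSmoothlyApproximable.isWeakGradient (fun r hr => ?_) i1.locallyIntegrableOn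
    i2.locallyIntegrableOn, s1, s2⟩
  have hρ1 : max r R < 1 := max_lt hr hF.lt_one
  obtain ⟨f, hf, hfu, hfG⟩ := h.isWeakGradient.isSmoothlyApproximable (max r R) hρ1
  have hsub : ball (0 : Space d) r ⊆ ball 0 (max r R) := ball_subset_ball (le_max_left _ _)
  refine ⟨fun k => hF.transport κ (f k), fun k => hF.contDiff_transport κ (hf k), ?_, ?_⟩
  · exact tendsto_of_tendsto_of_tendsto_of_le_of_le tendsto_const_nhds
      (hF.tendsto_transport κ (le_max_right _ _) hρ1.le hfu) (fun _ => zero_le)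
      fun k => lintegral_mono_set hsub
  · exact tendsto_of_tendsto_of_tendsto_of_le_of_le tendsto_const_nhds
      (hF.tendsto_transportGrad κ (le_max_right _ _) hρ1.le hf h.measurable hfu hfG)
      (fun _ => zero_le) fun k => lintegral_mono_set hsub

/-- The thin trace of the transported function. -/
theorem thinFormula_transport (hF : IsSmallProfile F R) (κ : ℝ) {a : ℝ} (ha : a < 1)
    {u : Space d → ℝ} {G : Space d → Space d} (h : IsSobolevPair a u G) :
    ∀ᵐ y : EuclideanSpace ℝ (Fin d), y ∈ ball (0 : EuclideanSpace ℝ (Fin d)) 1 →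
      thinFormula (hF.transport κ u) (hF.transportGrad κ u G) (radialMap F y) =
        dilation F y ^ κ * thinFormula u G y := by
  have hv := hF.isSobolevPair_transport κ ha h
  set T := thinFormula u G
  set Tv := thinFormula (hF.transport κ u) (hF.transportGrad κ u G)
  have hTm : Measurable T := measurable_thinFormula h.measurable h.measurable_grad
  have hTvm : Measurable Tv := measurable_thinFormula hv.measurable hv.measurable_grad
  have hmap : Measurable (radialMap (E := EuclideanSpace ℝ (Fin d)) F) :=
    (contDiff_radialMap hF.contDiff).continuous.measurable
  have hqm : Measurable fun y : EuclideanSpace ℝ (Fin d) => dilation F y ^ κ :=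
    (hF.continuous_rpow_dilation κ).measurable
  have hstep : ∀ r : ℝ, R ≤ r → r < 1 → ∀ᵐ y : EuclideanSpace ℝ (Fin d),
      y ∈ ball (0 : EuclideanSpace ℝ (Fin d)) r → Tv (radialMap F y) = dilation F y ^ κ * T y := by
    intro r hRr hr
    have hr0 : 0 ≤ r := hF.pos.le.trans hRr
    have hρ1 : (1 + r) / 2 < 1 := by linarith
    have hρR : R ≤ (1 + r) / 2 := by linarith
    obtain ⟨f, hf, hfu, hfG⟩ := h.isWeakGradient.isSmoothlyApproximable ((1 + r) / 2) hρ1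
    have t1 : Tendsto (fun k => ∫⁻ y in ball (0 : EuclideanSpace ℝ (Fin d)) r,
        ‖f k (slice (y, 0)) - T y‖ₑ) atTop (𝓝 0) := h.tendsto_thinFormula ha hr0 hr hf hfu hfG
    have t2 : Tendsto (fun k => ∫⁻ y in ball (0 : EuclideanSpace ℝ (Fin d)) r,
        ‖hF.transport κ (f k) (slice (y, 0)) - Tv y‖ₑ) atTop (𝓝 0) := hv.tendsto_thinFormula ha hr0 hr (fun k => hF.contDiff_transport κ (hf k))
      (hF.tendsto_transport κ hρR hρ1.le hfu)
      (hF.tendsto_transportGrad κ hρR hρ1.le hf h.measurable hfu hfG)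
    obtain ⟨C, hC⟩ := (isCompact_closedBall (0 : EuclideanSpace ℝ (Fin d)) 1).exists_bound_of_continuousOn
      (f := fun y => jacobian F y * dilation F y ^ κ)
      ((continuous_jacobian hF).mul (hF.continuous_rpow_dilation κ)).continuousOn
    have hC0 : 0 ≤ C := (norm_nonneg _).trans (hC 0 (by simp))
    have t3 := (ENNReal.Tendsto.const_mul (a := ENNReal.ofReal C) t1
      (Or.inr ENNReal.ofReal_ne_top)).add t2
    rw [mul_zero, add_zero] at t3
    -- For the `C¹` approximations, transport commutes with restriction to the thin space. The
    -- integral is bounded by their distances to the two trace formulas, the one for the transported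
    -- function being pulled back by the radial map, and both distances tend to zero.
    have hz : ∫⁻ y in ball (0 : EuclideanSpace ℝ (Fin d)) r, ENNReal.ofReal (jacobian F y) *
        ‖Tv (radialMap F y) - dilation F y ^ κ * T y‖ₑ = 0 := by
      refine le_antisymm (ge_of_tendsto t3 (Eventually.of_forall fun k => ?_)) zero_le
      rw [hF.lintegral_ball hRr fun y => ‖hF.transport κ (f k) (slice (y, 0)) - Tv y‖ₑ,
        ← lintegral_const_mul' _ _ ENNReal.ofReal_ne_top, ← lintegral_add_left]
      · refine setLIntegral_mono' measurableSet_ball fun y hy => ?_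
        have hJ := (hF.jacobian_pos y).le
        have hy1 : y ∈ closedBall (0 : EuclideanSpace ℝ (Fin d)) 1 :=
          ball_subset_closedBall (ball_subset_ball hr.le hy)
        rw [← radialMap_slice, transport_radialMap, dilation_slice]
        rw [← ofReal_norm, ← ofReal_norm, ← ofReal_norm, ← ENNReal.ofReal_mul hJ,
          ← ENNReal.ofReal_mul hC0, ← ENNReal.ofReal_mul hJ,
          ← ENNReal.ofReal_add (by positivity) (by positivity)]
        refine ENNReal.ofReal_le_ofReal ?_
        have e1 := hC y hy1
        calc jacobian F y * ‖Tv (radialMap F y) - dilation F y ^ κ * T y‖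
            ≤ jacobian F y * (‖dilation F y ^ κ * (f k (slice (y, 0)) - T y)‖ +
              ‖dilation F y ^ κ * f k (slice (y, 0)) - Tv (radialMap F y)‖) := by
              gcongr
              rw [norm_sub_rev (dilation F y ^ κ * f k (slice (y, 0)))]
              refine le_trans (le_of_eq ?_) (norm_add_le _ _)
              congr 1
              ring
          _ = ‖jacobian F y * dilation F y ^ κ‖ * ‖f k (slice (y, 0)) - T y‖ +
              jacobian F y * ‖dilation F y ^ κ * f k (slice (y, 0)) - Tv (radialMap F y)‖ := by
              rw [norm_mul, norm_mul, Real.norm_of_nonneg hJ]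
              ring
          _ ≤ _ := by gcongr
      · exact (((hf k).continuous.comp (continuous_slice.comp
          (continuous_id.prodMk continuous_const))).measurable.sub hTm).enorm.const_mul _
    rw [lintegral_eq_zero_iff] at hz
    · refine (ae_restrict_iff' measurableSet_ball).1 ?_
      filter_upwards [hz] with y hy
      simp only [Pi.zero_apply, mul_eq_zero, ENNReal.ofReal_eq_zero, not_le.2 (hF.jacobian_pos y),
        false_or, enorm_eq_zero] at hy
      linarith
    · exact (continuous_jacobian hF).measurable.ennreal_ofReal.mul
        ((hTvm.comp hmap).sub (hqm.mul hTm)).enorm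
  -- These radii start at `R`, increase and exhaust the unit ball.
  have hseq : ∀ n : ℕ, ∀ᵐ y : EuclideanSpace ℝ (Fin d),
      y ∈ ball (0 : EuclideanSpace ℝ (Fin d)) (1 - (1 - R) * (1 / ((n : ℝ) + 1))) →
        Tv (radialMap F y) = dilation F y ^ κ * T y := by
    intro n
    have h1 : 0 < 1 - R := by linarith [hF.lt_one]
    have h2 : (1 - R) * (1 / ((n : ℝ) + 1)) ≤ 1 - R := by
      rw [mul_one_div]
      exact div_le_self h1.le (by linarith [(Nat.cast_nonneg n : (0 : ℝ) ≤ n)])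
    have h3 : 0 < (1 - R) * (1 / ((n : ℝ) + 1)) := by positivity
    exact hstep _ (by linarith) (by linarith)
  filter_upwards [ae_all_iff.2 hseq] with y hy hy1
  have hy1' : ‖y‖ < 1 := by simpa using hy1
  have htend : Tendsto (fun n : ℕ => 1 - (1 - R) * (1 / ((n : ℝ) + 1))) atTop
      (𝓝 (1 - (1 - R) * 0)) :=
    tendsto_const_nhds.sub (tendsto_one_div_add_atTop_nhds_zero_nat.const_mul (1 - R))
  rw [mul_zero, sub_zero] at htend
  obtain ⟨n, hn⟩ := (htend.eventually_const_lt hy1').exists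
  exact hy n (by simpa using hn)

theorem transport_eq_self (hF : IsSmallProfile F R) (κ : ℝ) (u : Space d → ℝ) {x : Space d}
    (hx : R ≤ ‖x‖) : hF.transport κ u x = u x := by
  rw [transport, hF.homeo_symm_eq_self hx, hF.dilation_eq_one hx, Real.one_rpow, one_mul]

theorem transportGrad_eq_self (hF : IsSmallProfile F R) (κ : ℝ) (u : Space d → ℝ)
    (G : Space d → Space d) {x : Space d} (hx : R ≤ ‖x‖) : hF.transportGrad κ u G x = G x := by
  rw [transportGrad, hF.homeo_symm_eq_self hx, transportVec, radialDerivInv_apply,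
    hF.slope_eq_zero hx, hF.dilation_eq_one hx]
  simp

end IsSmallProfile

/-- Changing a Sobolev function in a smaller ball does not change its trace on the unit sphere. -/
theorem IsSphereTrace.congr_of_eq_near_sphere {a R : ℝ} (ha : a < 1) (hR0 : 0 < R) (hR : R < 1)
    {u₀ u v g : Space d → ℝ} {G H : Space d → Space d} (hu : IsSobolevPair a u G)
    (hv : IsSobolevPair a v H) (huv : ∀ x, R ≤ ‖x‖ → v x = u x) (hGH : ∀ x, R ≤ ‖x‖ → H x = G x)
    (hu₀ : ∀ᵐ x, x ∈ ball (0 : Space d) 1 → u₀ x = u x)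
    (hG₀ : ∀ᵐ x, x ∈ ball (0 : Space d) 1 → weakGradient u₀ x = G x)
    (h : IsSphereTrace a u₀ 1 g) : IsSphereTrace a v 1 g where
  memLp := h.memLp
  gauss_green := by
    intro i φ hφ hc
    rw [← h.gauss_green i φ hφ hc]
    have hφ1 : ContDiff ℝ 1 φ := hφ.of_le (by exact_mod_cast le_top)
    have e1 : ∫ x in ball 0 1, (u₀ x * partialDeriv i φ x + weakGradient u₀ x i * φ x) =
        ∫ x in ball 0 1, (u x * partialDeriv i φ x + G x i * φ x) := by
      refine setIntegral_congr_ae measurableSet_ball ?_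
      filter_upwards [hu₀, hG₀] with x h1 h2 hx
      rw [h1 hx, h2 hx]
    have e2 : ∫ x in ball 0 1, (v x * partialDeriv i φ x + weakGradient v x i * φ x) =
        ∫ x in ball 0 1, (v x * partialDeriv i φ x + H x i * φ x) := by
      refine setIntegral_congr_ae measurableSet_ball ?_
      filter_upwards [hv.isWeakGradient.weakGradient_ae_eq] with x h2 hx
      rw [h2 hx]
    rw [e1, e2]
    -- The two functions differ only for `‖x‖ < R`, where `χ = 1`. In the difference of the two
    -- Gauss-Green integrals `φ` may thus be replaced by `χ φ`, whose support is compact in the open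
    -- ball. For such a test function each integral vanishes, by definition of the distributional
    -- gradient.
    let χ : ContDiffBump (0 : Space d) := ⟨R, (1 + R) / 2, hR0, by linarith⟩
    set ψ : Space d → ℝ := fun x => χ x * φ x with hψ
    have hψs : ContDiff ℝ ∞ ψ := χ.contDiff.mul hφ
    have hψc : HasCompactSupport ψ := hc.mul_left
    have hψt : tsupport ψ ⊆ ball 0 1 := by
      refine (closure_mono (Function.support_mul_subset_left _ _)).trans ?_
      change tsupport χ ⊆ _
      rw [χ.tsupport_eq]
      exact closedBall_subset_ball (by simp only [χ]; linarith)
    have hψ1 : ContDiff ℝ 1 ψ := hψs.of_le (by exact_mod_cast le_top)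
    have hin : ∀ x, ‖x‖ < R → ψ x = φ x ∧ partialDeriv i ψ x = partialDeriv i φ x := by
      intro x hx
      have hev : ψ =ᶠ[𝓝 x] φ := by
        have : ball (0 : Space d) R ∈ 𝓝 x := isOpen_ball.mem_nhds (by simpa using hx)
        filter_upwards [this] with z hz
        have : χ z = 1 := χ.one_of_mem_closedBall (ball_subset_closedBall hz)
        simp [hψ, this]
      exact ⟨hev.eq_of_nhds, by rw [partialDeriv, partialDeriv, hev.fderiv_eq]⟩
    have iu := hu.integrableOn ha
    have iv := hv.integrableOn ha
    have iG := integrableOn_apply (hu.integrableOn_grad ha) i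
    have iH := integrableOn_apply (hv.integrableOn_grad ha) i
    have hm : ∀ {w p : Space d → ℝ}, IntegrableOn w (ball 0 1) → Continuous p →
        HasCompactSupport p → IntegrableOn (fun x => w x * p x) (ball 0 1) := by
      intro w p hw hp hpc
      obtain ⟨C, hC⟩ := exists_bound_of_hasCompactSupport hp hpc
      exact hw.mul_bdd (c := C) hp.aestronglyMeasurable (Eventually.of_forall hC)
    have key : ∀ {w : Space d → ℝ} {K : Space d → Space d}, IsWeakGradient w K →
        IntegrableOn w (ball 0 1) → IntegrableOn (fun x => K x i) (ball 0 1) →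
        ∫ x in ball 0 1, (w x * partialDeriv i ψ x + K x i * ψ x) = 0 := by
      intro w K hwK hw hK
      rw [integral_add (hm hw (continuous_partialDeriv hψ1 i) (hasCompactSupport_partialDeriv hψc i))
        (hm hK hψs.continuous hψc), hwK.integral_eq i ψ hψs hψc hψt]
      ring
    have ku := key hu.isWeakGradient iu iG
    have kv := key hv.isWeakGradient iv iH
    have it : ∀ {w p : Space d → ℝ} {K : Space d → Space d}, IntegrableOn w (ball 0 1) →
        IntegrableOn (fun x => K x i) (ball 0 1) → ContDiff ℝ 1 p → HasCompactSupport p →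
        IntegrableOn (fun x => w x * partialDeriv i p x + K x i * p x) (ball 0 1) := by
      intro w p K hw hK hp hpc
      exact (hm hw (continuous_partialDeriv hp i) (hasCompactSupport_partialDeriv hpc i)).add
        (hm hK hp.continuous hpc)
    rw [← sub_eq_zero, ← integral_sub (it iv iH hφ1 hc) (it iu iG hφ1 hc)]
    have : ∫ x in ball 0 1, ((v x * partialDeriv i φ x + H x i * φ x) -
        (u x * partialDeriv i φ x + G x i * φ x)) =
        ∫ x in ball 0 1, ((v x * partialDeriv i ψ x + H x i * ψ x) -
        (u x * partialDeriv i ψ x + G x i * ψ x)) := by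
      congr 1
      funext x
      rcases lt_or_ge ‖x‖ R with hx | hx
      · rw [(hin x hx).1, (hin x hx).2]
      · rw [huv x hx, hGH x hx]
        ring
    rw [this, integral_sub (it iv iH hψ1 hψc) (it iu iG hψ1 hψc), ku, kv, sub_zero]

/-! ### Coefficients of the deformed energy -/

section Coefficients

/-- The factor of the energy densities under a radial deformation with dilation `1 + p.1`, slope
`p.2.1` and radial part `p.2.2`. -/
noncomputable def coeffScale (N : ℝ) (p : ℝ × ℝ × ℝ) : ℝ := (1 + p.1) ^ N * (1 + p.2.2 / (1 + p.1))

/-- The coefficient that measures the loss in the radial part of the gradient. -/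
noncomputable def coeffRadial (p : ℝ × ℝ × ℝ) : ℝ :=
  2 * p.2.1 / (1 + p.1 + p.2.2) - p.2.1 * p.2.2 / (1 + p.1 + p.2.2) ^ 2

/-- The coefficient of `⟨y, ∇u⟩²`. -/
noncomputable def coeffSq (N : ℝ) (p : ℝ × ℝ × ℝ) : ℝ := -(1 / 2) * (coeffScale N p * coeffRadial p)

/-- The coefficient of `u ⟨y, ∇u⟩`. -/
noncomputable def coeffMixed (N κ : ℝ) (p : ℝ × ℝ × ℝ) : ℝ :=
  coeffScale N p * ((κ * p.2.1 - κ * p.2.2 * coeffRadial p) / (1 + p.1))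

/-- The coefficient of `u²`. -/
noncomputable def coeffValue (N κ : ℝ) (p : ℝ × ℝ × ℝ) : ℝ :=
  1 / 2 * (coeffScale N p * ((κ ^ 2 * (p.2.1 * p.2.2) - κ ^ 2 * (p.2.2 * p.2.2) * coeffRadial p) /
    (1 + p.1) ^ 2))

theorem contDiffAt_coeffScale (N : ℝ) : ContDiffAt ℝ 1 (coeffScale N) 0 := by
  unfold coeffScale
  refine ContDiffAt.mul (ContDiffAt.rpow_const_of_ne (by fun_prop) (by simp))
    (contDiffAt_const.add (ContDiffAt.div (by fun_prop) (by fun_prop) (by simp)))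

theorem contDiffAt_coeffRadial : ContDiffAt ℝ 1 coeffRadial 0 := by
  unfold coeffRadial
  exact (ContDiffAt.div (by fun_prop) (by fun_prop) (by simp)).sub
    (ContDiffAt.div (by fun_prop) (by fun_prop) (by simp))

theorem contDiffAt_coeffSq (N : ℝ) : ContDiffAt ℝ 1 (coeffSq N) 0 :=
  contDiffAt_const.mul ((contDiffAt_coeffScale N).mul contDiffAt_coeffRadial)

theorem contDiffAt_coeffMixed (N κ : ℝ) : ContDiffAt ℝ 1 (coeffMixed N κ) 0 := by
  have h := contDiffAt_coeffRadial
  exact (contDiffAt_coeffScale N).mul (ContDiffAt.div (ContDiffAt.sub (by fun_prop)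
    (ContDiffAt.mul (by fun_prop) h)) (by fun_prop) (by simp))

theorem contDiffAt_coeffValue (N κ : ℝ) : ContDiffAt ℝ 1 (coeffValue N κ) 0 := by
  have h := contDiffAt_coeffRadial
  exact contDiffAt_const.mul ((contDiffAt_coeffScale N).mul (ContDiffAt.div (ContDiffAt.sub
    (by fun_prop) (ContDiffAt.mul (by fun_prop) h)) (by fun_prop) (by simp)))

theorem measurable_coeffScale (N : ℝ) : Measurable (coeffScale N) := by
  unfold coeffScale
  exact ((measurable_fst.const_add 1).pow_const N).mul (by fun_prop)

theorem measurable_coeffRadial : Measurable coeffRadial := by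
  unfold coeffRadial
  fun_prop

theorem measurable_coeffSq (N : ℝ) : Measurable (coeffSq N) :=
  ((measurable_coeffScale N).mul measurable_coeffRadial).const_mul _

theorem measurable_coeffMixed (N κ : ℝ) : Measurable (coeffMixed N κ) := by
  have h := measurable_coeffRadial
  exact (measurable_coeffScale N).mul (by fun_prop)

theorem measurable_coeffValue (N κ : ℝ) : Measurable (coeffValue N κ) := by
  have h := measurable_coeffRadial
  exact ((measurable_coeffScale N).mul (by fun_prop)).const_mul _

theorem hasDerivAt_coeffScale (N : ℝ) (p : ℝ × ℝ × ℝ) :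
    HasDerivAt (fun s : ℝ => coeffScale N (s • p)) (N * p.1 + p.2.2) 0 := by
  have h1 : HasDerivAt (fun s : ℝ => 1 + s * p.1) p.1 0 := by
    simpa using ((hasDerivAt_id (0 : ℝ)).mul_const p.1).const_add 1
  have h2 : HasDerivAt (fun s : ℝ => (1 + s * p.1) ^ N) (N * p.1) 0 := by
    have := h1.rpow_const (p := N) (Or.inl (by simp))
    simpa [mul_comm] using this
  have h3 : HasDerivAt (fun s : ℝ => s * p.2.2) p.2.2 0 := by
    simpa using (hasDerivAt_id (0 : ℝ)).mul_const p.2.2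
  have h4 : HasDerivAt (fun s : ℝ => 1 + s * p.2.2 / (1 + s * p.1)) p.2.2 0 := by
    simpa using (h3.fun_div h1 (by simp)).const_add 1
  have h5 := h2.mul h4
  simp only [coeffScale, Prod.smul_fst, Prod.smul_snd, smul_eq_mul]
  refine h5.congr_deriv ?_
  simp

theorem hasDerivAt_coeffRadial (p : ℝ × ℝ × ℝ) :
    HasDerivAt (fun s : ℝ => coeffRadial (s • p)) (2 * p.2.1) 0 := by
  have hl : ∀ c : ℝ, HasDerivAt (fun s : ℝ => s * c) c 0 := fun c => by
    simpa using (hasDerivAt_id (0 : ℝ)).mul_const c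
  have h1 : HasDerivAt (fun s : ℝ => 1 + s * p.1 + s * p.2.2) (p.1 + p.2.2) 0 :=
    ((hl p.1).const_add 1).add (hl p.2.2)
  have h2 : HasDerivAt (fun s : ℝ => 2 * (s * p.2.1) / (1 + s * p.1 + s * p.2.2)) (2 * p.2.1) 0 := by
    refine (((hl p.2.1).const_mul 2).fun_div h1 (by simp)).congr_deriv ?_
    simp
  have h3 : HasDerivAt (fun s : ℝ => s * p.2.1 * (s * p.2.2) / (1 + s * p.1 + s * p.2.2) ^ 2) 0
      0 := by
    refine (((hl p.2.1).mul (hl p.2.2)).fun_div (h1.fun_pow 2) (by simp)).congr_deriv ?_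
    simp
  simp only [coeffRadial, Prod.smul_fst, Prod.smul_snd, smul_eq_mul]
  refine (h2.sub h3).congr_deriv ?_
  simp

theorem coeffScale_zero (N : ℝ) : coeffScale N 0 = 1 := by simp [coeffScale]

theorem coeffRadial_zero : coeffRadial 0 = 0 := by simp [coeffRadial]

theorem hasDerivAt_coeffSq (N : ℝ) (p : ℝ × ℝ × ℝ) :
    HasDerivAt (fun s : ℝ => coeffSq N (s • p)) (-p.2.1) 0 := by
  refine (((hasDerivAt_coeffScale N p).mul (hasDerivAt_coeffRadial p)).const_mul
    (-(1 / 2))).congr_deriv ?_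
  simp [coeffScale_zero, coeffRadial_zero]

theorem hasDerivAt_coeffMixed (N κ : ℝ) (p : ℝ × ℝ × ℝ) :
    HasDerivAt (fun s : ℝ => coeffMixed N κ (s • p)) (κ * p.2.1) 0 := by
  have hl : ∀ c : ℝ, HasDerivAt (fun s : ℝ => s * c) c 0 := fun c => by
    simpa using (hasDerivAt_id (0 : ℝ)).mul_const c
  have h1 := ((hl p.2.1).const_mul κ).sub
    (((hl p.2.2).const_mul κ).mul (hasDerivAt_coeffRadial p))
  have h2 := h1.div ((hl p.1).const_add 1) (by simp)
  refine ((hasDerivAt_coeffScale N p).mul h2).congr_deriv ?_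
  simp [coeffScale_zero, coeffRadial_zero]

/-- Each term of this coefficient contains at least two factors linear in `s`, so `u²` does not
enter the first variation. -/
theorem hasDerivAt_coeffValue (N κ : ℝ) (p : ℝ × ℝ × ℝ) :
    HasDerivAt (fun s : ℝ => coeffValue N κ (s • p)) 0 0 := by
  have hl : ∀ c : ℝ, HasDerivAt (fun s : ℝ => s * c) c 0 := fun c => by
    simpa using (hasDerivAt_id (0 : ℝ)).mul_const c
  have h1 := (((hl p.2.1).mul (hl p.2.2)).const_mul (κ ^ 2)).sub
    ((((hl p.2.2).mul (hl p.2.2)).const_mul (κ ^ 2)).mul (hasDerivAt_coeffRadial p))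
  have h2 := h1.div (((hl p.1).const_add 1).pow 2) (by simp)
  refine (((hasDerivAt_coeffScale N p).mul h2).const_mul (1 / 2)).congr_deriv ?_
  simp [coeffScale_zero, coeffRadial_zero]

/-- Differentiation under the integral sign for coefficients of a deformation. -/
theorem hasDerivAt_integral_coeff {X : Type*} [MeasurableSpace X] {μ : Measure X}
    {c : ℝ × ℝ × ℝ → ℝ} (hc : ContDiffAt ℝ 1 c 0) (hcm : Measurable c) {p : X → ℝ × ℝ × ℝ}
    (hp : Measurable p) {B : ℝ} (hB : ∀ x, ‖p x‖ ≤ B) {M : X → ℝ} (hM : Integrable M μ)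
    {c' : X → ℝ} (hc'm : Measurable c') (hc' : ∀ x, HasDerivAt (fun s : ℝ => c (s • p x)) (c' x) 0) :
    HasDerivAt (fun ε : ℝ => ∫ x, c (ε • p x) * M x ∂μ) (∫ x, c' x * M x ∂μ) 0 := by
  rcases isEmpty_or_nonempty X with hX | ⟨⟨x₀⟩⟩
  · simpa [integral_of_isEmpty] using hasDerivAt_const (0 : ℝ) (0 : ℝ)
  have hB0 : 0 ≤ B := (norm_nonneg _).trans (hB x₀)
  -- A `C¹` coefficient is Lipschitz near 0. The bound `B` on the parameters keeps `ε • p x` in that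
  -- neighbourhood for all `x` at once, and `K * B * ‖M x‖` dominates the difference quotients.
  obtain ⟨K, t, ht, hK⟩ := hc.exists_lipschitzOnWith
  obtain ⟨δ, hδ, hδt⟩ := Metric.mem_nhds_iff.1 ht
  have hmem : ∀ ε ∈ ball (0 : ℝ) (δ / (B + 1)), ∀ x, ε • p x ∈ t := by
    intro ε hε x
    apply hδt
    rw [mem_ball_zero_iff, norm_smul]
    have h1 : ‖ε‖ < δ / (B + 1) := by simpa using hε
    calc ‖ε‖ * ‖p x‖ ≤ ‖ε‖ * (B + 1) := by
          gcongr
          linarith [hB x]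
      _ < δ := by rwa [lt_div_iff₀ (by positivity)] at h1
  refine (hasDerivAt_integral_of_dominated_loc_of_lip (F := fun ε x => c (ε • p x) * M x)
    (bound := fun x => K * B * ‖M x‖) (ball_mem_nhds (0 : ℝ) (by positivity : 0 < δ / (B + 1)))
    (Eventually.of_forall fun ε => ?_) ?_ ?_ ?_ ?_ ?_).2
  · exact (hcm.comp (hp.const_smul ε)).aestronglyMeasurable.mul hM.1
  · simp only [zero_smul]
    exact hM.const_mul _
  · exact hc'm.aestronglyMeasurable.mul hM.1
  · refine Eventually.of_forall fun x => LipschitzOnWith.of_dist_le_mul fun ε hε ε' hε' => ?_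
    have h1 := hK.dist_le_mul _ (hmem ε hε x) _ (hmem ε' hε' x)
    rw [Real.dist_eq, ← sub_mul, abs_mul]
    rw [Real.dist_eq, dist_eq_norm, ← sub_smul, norm_smul] at h1
    have e : ((Real.nnabs (K * B * ‖M x‖) : NNReal) : ℝ) = K * B * ‖M x‖ := by
      rw [Real.coe_nnabs, abs_of_nonneg (by positivity)]
    rw [e, Real.dist_eq]
    calc _ ≤ (K * (‖ε - ε'‖ * B)) * |M x| := by
          gcongr
          exact h1.trans (by gcongr; exact hB x)
      _ = _ := by rw [Real.norm_eq_abs, Real.norm_eq_abs]; ring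
  · exact hM.norm.const_mul _
  · exact Eventually.of_forall fun x => (hc' x).mul_const _

end Coefficients

/-! ### The energy of a deformed function and its first variation -/

section Deformation

/-- The parameters of a radial deformation at a point. -/
noncomputable def profilePoint {E : Type*} [NormedAddCommGroup E] (F : ℝ → ℝ) (y : E) : ℝ × ℝ × ℝ :=
  (F (‖y‖ ^ 2), slope F y, ‖y‖ ^ 2 * slope F y)

theorem profilePoint_const_mul {E : Type*} [NormedAddCommGroup E] [InnerProductSpace ℝ E] {F : ℝ → ℝ}
    (hF : ContDiff ℝ 1 F) (ε : ℝ) (y : E) :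
    profilePoint (fun t => ε * F t) y = ε • profilePoint F y := by
  have : slope (fun t => ε * F t) y = ε * slope F y := by
    rw [slope, slope, deriv_const_mul _ (hF.differentiable (by norm_num)).differentiableAt]
    ring
  simp only [profilePoint, this, Prod.smul_mk, smul_eq_mul]
  congr 2
  ring

/-- The Jacobian contributes `q^(d+1)`, the weight `q^a`, the amplitude `q^(2κ)` and the inverse
derivative `q^(-2)`. With `κ = 1 - a` these exponents add up to `d + 1 - a`. What remains after
expanding the square of `DΨ⁻¹ (q^κ g + e y)` is an identity of rational functions. -/
theorem IsSmallProfile.energyDensity_transport {F : ℝ → ℝ} {R : ℝ} (hF : IsSmallProfile F R) (a : ℝ)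
    (y : Space d) (s : ℝ) (g : Space d) :
    jacobian F y * (1 / 2 * ‖transportVec F (1 - a) y s g‖ ^ 2 * dilation F y ^ a) =
      coeffScale ((d : ℝ) + 1 - a) (profilePoint F y) * (1 / 2 * ‖g‖ ^ 2) +
      coeffSq ((d : ℝ) + 1 - a) (profilePoint F y) * (inner ℝ y g) ^ 2 +
      coeffMixed ((d : ℝ) + 1 - a) (1 - a) (profilePoint F y) * (s * inner ℝ y g) +
      coeffValue ((d : ℝ) + 1 - a) (1 - a) (profilePoint F y) * s ^ 2 := by
  set q := dilation F y with hq
  have hq0 : 0 < q := hF.dilation_pos y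
  set σ := slope F y with hσ
  have hQ0 : 0 < q + ‖y‖ ^ 2 * σ := hF.stretch_pos y
  set κ := 1 - a with hκ
  set P := q ^ κ with hP
  have hPκ : q ^ (κ - 1) = P / q := by rw [Real.rpow_sub_one hq0.ne']
  have hN : q ^ ((d : ℝ) + 1 - a) = q ^ (d + 1) * q ^ a * P ^ 2 / q ^ 2 := by
    have : (d : ℝ) + 1 - a = ((d + 1 : ℕ) : ℝ) + a + κ + κ - ((2 : ℕ) : ℝ) := by
      push_cast
      rw [hκ]
      ring
    rw [this, Real.rpow_sub hq0, Real.rpow_add hq0, Real.rpow_add hq0, Real.rpow_add hq0,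
      Real.rpow_natCast, Real.rpow_natCast, ← hP]
    ring
  set e := κ * (P / q) * σ * s with he
  set b := σ / (q + ‖y‖ ^ 2 * σ) with hb
  set i := (inner ℝ y g : ℝ) with hi
  have hX1 : inner ℝ y (P • g + e • y) = P * i + e * ‖y‖ ^ 2 := by
    rw [inner_add_right, inner_smul_right, inner_smul_right, real_inner_self_eq_norm_sq]
  have hX2 : ‖P • g + e • y‖ ^ 2 = P ^ 2 * ‖g‖ ^ 2 + 2 * P * e * i + e ^ 2 * ‖y‖ ^ 2 := by
    rw [norm_add_sq_real, norm_smul, norm_smul, inner_smul_left, inner_smul_right, mul_pow, mul_pow,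
      Real.norm_eq_abs, Real.norm_eq_abs, sq_abs, sq_abs, real_inner_comm, ← hi]
    simp only [conj_trivial]
    ring
  have hn : ∀ (c : ℝ) (z : Space d), ‖c • z‖ ^ 2 = c ^ 2 * ‖z‖ ^ 2 := fun c z => by
    rw [norm_smul, mul_pow, Real.norm_eq_abs, sq_abs]
  have hZ : ‖transportVec F κ y s g‖ ^ 2 = (q⁻¹) ^ 2 * ((P ^ 2 * ‖g‖ ^ 2 + 2 * P * e * i +
      e ^ 2 * ‖y‖ ^ 2) - 2 * b * (P * i + e * ‖y‖ ^ 2) ^ 2 +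
      b ^ 2 * ‖y‖ ^ 2 * (P * i + e * ‖y‖ ^ 2) ^ 2) := by
    rw [transportVec, radialDerivInv_apply]
    rw [← hq, ← hP, hPκ, ← hσ, ← he, show stretch F y = q + ‖y‖ ^ 2 * σ from rfl, ← hb, hX1,
      hn, norm_sub_sq_real, hX2, hn, inner_smul_right, real_inner_comm, hX1]
    ring
  have hq' : 1 + F (‖y‖ ^ 2) = q := rfl
  rw [hZ, jacobian, finrank_euclideanSpace_fin, ← hq, ← hσ]
  simp only [coeffScale, coeffSq, coeffMixed, coeffValue, coeffRadial, profilePoint, hq', ← hσ, hN]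
  rw [he, hb]
  field_simp
  ring

/-- In dimension `d` the Jacobian has one factor `q` less, and the density is of degree one in the
amplitude `q^(1-a)`. The exponent is again `d + 1 - a`; this coincidence fixes the choice `κ = 1 -
a`. -/
theorem IsSmallProfile.thinDensity_transport {F : ℝ → ℝ} {R : ℝ} (hF : IsSmallProfile F R) (a : ℝ)
    (y : EuclideanSpace ℝ (Fin d)) :
    jacobian F y * dilation F y ^ (1 - a) = coeffScale ((d : ℝ) + 1 - a) (profilePoint F y) := by
  have hq0 : 0 < dilation F y := hF.dilation_pos y
  have hq' : 1 + F (‖y‖ ^ 2) = dilation F y := rfl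
  rw [jacobian, finrank_euclideanSpace_fin, coeffScale]
  simp only [profilePoint, hq']
  rw [show (d : ℝ) + 1 - a = (d : ℝ) + (1 - a) by ring, Real.rpow_add hq0, Real.rpow_natCast]
  ring

theorem exists_isSmallProfile {F : ℝ → ℝ} {R : ℝ} (hF : ContDiff ℝ 1 F) (hR0 : 0 < R) (hR : R < 1)
    (hz : ∀ t, R ^ 2 ≤ t → F t = 0) :
    ∃ ε₀ > 0, ∀ ε, |ε| < ε₀ → IsSmallProfile (fun t => ε * F t) R := by
  have hF' : Continuous (deriv F) := hF.continuous_deriv (by norm_num)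
  obtain ⟨B₁, h₁⟩ := (isCompact_Icc (a := (0 : ℝ)) (b := R ^ 2)).exists_bound_of_continuousOn
    hF.continuous.continuousOn
  obtain ⟨B₂, h₂⟩ := (isCompact_Icc (a := (0 : ℝ)) (b := R ^ 2)).exists_bound_of_continuousOn
    (f := fun t => t * (2 * deriv F t)) (continuous_id.mul (continuous_const.mul hF')).continuousOn
  have hz' : ∀ t, R ^ 2 < t → deriv F t = 0 := by
    intro t ht
    have : F =ᶠ[𝓝 t] fun _ => 0 := by
      filter_upwards [Ioi_mem_nhds ht] with s hs
      exact hz s (le_of_lt hs)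
    rw [this.deriv_eq]
    simp
  have h0 : (0 : ℝ) ∈ Icc 0 (R ^ 2) := ⟨le_rfl, by positivity⟩
  set B := max B₁ B₂ with hB
  have hB0 : 0 ≤ B := ((norm_nonneg _).trans (h₁ 0 h0)).trans (le_max_left _ _)
  have e₁ : ∀ t, 0 ≤ t → |F t| ≤ B := by
    intro t ht
    rcases le_or_gt t (R ^ 2) with h | h
    · exact (h₁ t ⟨ht, h⟩).trans (le_max_left _ _)
    · rw [hz t h.le, abs_zero]
      exact hB0
  have e₂ : ∀ t, 0 ≤ t → |t * (2 * deriv F t)| ≤ B := by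
    intro t ht
    rcases le_or_gt t (R ^ 2) with h | h
    · exact (h₂ t ⟨ht, h⟩).trans (le_max_right _ _)
    · rw [hz' t h, mul_zero, mul_zero, abs_zero]
      exact hB0
  -- `B` bounds both `F t` and `2 t F' t` for `t ≥ 0`, so this threshold brings both below `1/4`.
  -- The summand 1 covers `B = 0`.
  refine ⟨1 / (4 * (B + 1)), by positivity, fun ε hε => ?_⟩
  have hεB : |ε| * B ≤ 1 / 4 := by
    calc |ε| * B ≤ 1 / (4 * (B + 1)) * (B + 1) := by gcongr; linarith
      _ = 1 / 4 := by field_simp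
  refine ⟨contDiff_const.mul hF, hR0, hR, fun t ht => by rw [hz t ht, mul_zero], fun t ht => ?_,
    fun t ht => ?_⟩
  · rw [abs_mul]
    exact (mul_le_mul_of_nonneg_left (e₁ t ht) (abs_nonneg ε)).trans hεB
  · rw [deriv_const_mul _ (hF.differentiable (by norm_num)).differentiableAt,
      show t * (2 * (ε * deriv F t)) = ε * (t * (2 * deriv F t)) by ring, abs_mul]
    exact (mul_le_mul_of_nonneg_left (e₂ t ht) (abs_nonneg ε)).trans hεB

end Deformation

/-- The density `λ₊ t⁺ + λ₋ t⁻` of the thin energy. -/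
noncomputable def thinDensity (lamP lamM t : ℝ) : ℝ := lamP * max t 0 + lamM * max (-t) 0

theorem thinDensity_mul (lamP lamM : ℝ) {c : ℝ} (hc : 0 ≤ c) (t : ℝ) :
    thinDensity lamP lamM (c * t) = c * thinDensity lamP lamM t := by
  have e1 : max (c * t) 0 = c * max t 0 := by rw [mul_max_of_nonneg _ _ hc, mul_zero]
  have e2 : max (-(c * t)) 0 = c * max (-t) 0 := by
    rw [mul_max_of_nonneg _ _ hc, mul_zero, mul_neg]
  rw [thinDensity, thinDensity, e1, e2]
  ring

theorem continuous_thinDensity (lamP lamM : ℝ) : Continuous (thinDensity lamP lamM) := by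
  unfold thinDensity
  fun_prop

theorem abs_thinDensity_le (lamP lamM t : ℝ) :
    ‖thinDensity lamP lamM t‖ ≤ (|lamP| + |lamM|) * ‖t‖ := by
  have h1 : |max t 0| ≤ |t| := by
    rw [abs_of_nonneg (le_max_right _ _)]
    exact max_le (le_abs_self t) (abs_nonneg t)
  have h2 : |max (-t) 0| ≤ |t| := by
    rw [abs_of_nonneg (le_max_right _ _)]
    exact max_le (neg_le_abs t) (abs_nonneg t)
  rw [thinDensity, Real.norm_eq_abs, Real.norm_eq_abs, add_mul]
  refine (abs_add_le _ _).trans (add_le_add ?_ ?_)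
  · rw [abs_mul]
    gcongr
  · rw [abs_mul]
    gcongr

namespace IsSobolevPair

variable {a : ℝ} {u : Space d → ℝ} {G : Space d → Space d}

theorem integrableOn_thinDensity (h : IsSobolevPair a u G) (ha : a < 1) (lamP lamM : ℝ) :
    IntegrableOn (fun y => thinDensity lamP lamM (thinFormula u G y))
      (ball (0 : EuclideanSpace ℝ (Fin d)) 1) := by
  have : IsFiniteMeasure ((volume : Measure (EuclideanSpace ℝ (Fin d))).restrict (ball 0 1)) :=
    ⟨by simpa using measure_ball_lt_top⟩
  have h1 : IntegrableOn (thinFormula u G) (ball 0 1) :=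
    (h.memLp_thinFormula ha).integrable (by norm_num)
  refine Integrable.mono' (h1.norm.const_mul (|lamP| + |lamM|)) ?_ ?_
  · exact ((continuous_thinDensity lamP lamM).measurable.comp
      (measurable_thinFormula h.measurable h.measurable_grad)).aestronglyMeasurable
  · exact Eventually.of_forall fun y => abs_thinDensity_le _ _ _

theorem integrableOn_inner_sq (h : IsSobolevPair a u G) :
    IntegrableOn (fun y => (inner ℝ y (G y)) ^ 2 * weight a y) (ball 0 1) := by
  refine Integrable.mono' h.integrable_grad_sq ?_ ?_
  · exact (((measurable_id.inner h.measurable_grad).pow_const 2).mul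
      (measurable_weight a)).aestronglyMeasurable
  · filter_upwards [ae_restrict_mem measurableSet_ball] with y hy
    have hy1 : ‖y‖ < 1 := by simpa using hy
    rw [norm_mul, Real.norm_of_nonneg (weight_nonneg a y), norm_pow]
    refine mul_le_mul_of_nonneg_right ?_ (weight_nonneg a y)
    refine pow_le_pow_left₀ (norm_nonneg _) ?_ 2
    exact (norm_inner_le_norm _ _).trans (by nlinarith [norm_nonneg (G y), norm_nonneg y])

theorem integrableOn_mul_inner (h : IsSobolevPair a u G) :
    IntegrableOn (fun y => u y * inner ℝ y (G y) * weight a y) (ball 0 1) := by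
  refine Integrable.mono' (h.integrable_sq.add h.integrableOn_inner_sq) ?_ ?_
  · exact ((h.measurable.mul (measurable_id.inner h.measurable_grad)).mul
      (measurable_weight a)).aestronglyMeasurable
  · refine Eventually.of_forall fun y => ?_
    simp only [Pi.add_apply]
    rw [norm_mul, Real.norm_of_nonneg (weight_nonneg a y), ← add_mul, norm_mul]
    refine mul_le_mul_of_nonneg_right ?_ (weight_nonneg a y)
    rw [← sq_abs (inner ℝ y (G y)), ← Real.norm_eq_abs]
    nlinarith [sq_nonneg (‖u y‖ - ‖(inner ℝ y (G y) : ℝ)‖), sq_nonneg ‖u y‖,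
      sq_nonneg ‖(inner ℝ y (G y) : ℝ)‖]

theorem energy_eq (h : IsSobolevPair a u G) (ha : a < 1) {u₀ : Space d → ℝ}
    (hu₀ : ∀ᵐ x, x ∈ ball (0 : Space d) 1 → u₀ x = u x)
    (hG₀ : ∀ᵐ x, x ∈ ball (0 : Space d) 1 → weakGradient u₀ x = G x) (lamP lamM : ℝ) :
    energy a lamP lamM u₀ = (∫ x in ball 0 1, 1 / 2 * ‖G x‖ ^ 2 * weight a x) +
      2 * ∫ y in ball (0 : EuclideanSpace ℝ (Fin d)) 1,
        thinDensity lamP lamM (thinFormula u G y) := by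
  rw [energy, dirichletEnergy, thinEnergy, setIntegral_thinMeasure, ← integral_const_mul]
  congr 1
  · refine setIntegral_congr_ae measurableSet_ball ?_
    filter_upwards [hG₀] with x hx hxb
    rw [hx hxb]
    ring
  · congr 1
    refine setIntegral_congr_ae measurableSet_ball ?_
    filter_upwards [h.thinTrace_ae_eq ha hu₀ hG₀] with x hx hxb
    rw [hx hxb, thinDensity]

end IsSobolevPair

/-- Pulled back to `y`, the deformation enters only through bounded coefficients, which multiply
integrable functions independent of it. Differentiating in the deformation parameter therefore
requires no differentiability of `u` beyond its distributional gradient. -/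
theorem IsSmallProfile.energy_transport {F : ℝ → ℝ} {R : ℝ} (hF : IsSmallProfile F R) {a : ℝ}
    (ha : a < 1) {u : Space d → ℝ} {G : Space d → Space d} (h : IsSobolevPair a u G)
    (lamP lamM : ℝ) :
    energy a lamP lamM (hF.transport (1 - a) u) =
      (∫ y in ball 0 1, (
        coeffScale ((d : ℝ) + 1 - a) (profilePoint F y) * (1 / 2 * (‖G y‖ ^ 2 * weight a y)) +
        coeffSq ((d : ℝ) + 1 - a) (profilePoint F y) * ((inner ℝ y (G y)) ^ 2 * weight a y) +
        coeffMixed ((d : ℝ) + 1 - a) (1 - a) (profilePoint F y) *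
          (u y * inner ℝ y (G y) * weight a y) +
        coeffValue ((d : ℝ) + 1 - a) (1 - a) (profilePoint F y) * (‖u y‖ ^ 2 * weight a y))) +
      2 * ∫ y in ball (0 : EuclideanSpace ℝ (Fin d)) 1,
        coeffScale ((d : ℝ) + 1 - a) (profilePoint F y) *
          thinDensity lamP lamM (thinFormula u G y) := by
  have hv := hF.isSobolevPair_transport (1 - a) ha h
  rw [hv.energy_eq ha (Eventually.of_forall fun _ _ => rfl) hv.isWeakGradient.weakGradient_ae_eq]
  congr 1
  · rw [hF.integral_ball hF.lt_one.le]
    refine setIntegral_congr_fun measurableSet_ball fun y _ => ?_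
    have := hF.energyDensity_transport a y (u y) (G y)
    simp only [transportGrad_radialMap, weight_radialMap hF]
    rw [show ‖u y‖ ^ 2 = u y ^ 2 by rw [Real.norm_eq_abs, sq_abs]]
    linear_combination (weight a y) * this
  · congr 1
    rw [hF.integral_ball hF.lt_one.le]
    refine setIntegral_congr_ae measurableSet_ball ?_
    filter_upwards [hF.thinFormula_transport (1 - a) ha h] with y hy hyb
    rw [hy hyb, thinDensity_mul _ _ (Real.rpow_nonneg (hF.dilation_pos y).le _),
      ← hF.thinDensity_transport]
    ring

theorem eventually_integrable_coeff {X : Type*} [MeasurableSpace X] {μ : Measure X}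
    {c : ℝ × ℝ × ℝ → ℝ} (hc : ContinuousAt c 0) (hcm : Measurable c) {p : X → ℝ × ℝ × ℝ}
    (hp : Measurable p) {B : ℝ} (hB : ∀ x, ‖p x‖ ≤ B) {M : X → ℝ} (hM : Integrable M μ) :
    ∀ᶠ ε : ℝ in 𝓝 0, Integrable (fun x => c (ε • p x) * M x) μ := by
  rcases isEmpty_or_nonempty X with hX | ⟨⟨x₀⟩⟩
  · refine Eventually.of_forall fun ε => hM.congr (Eventually.of_forall fun x => (hX.false x).elim)
  have hB0 : 0 ≤ B := (norm_nonneg _).trans (hB x₀)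
  obtain ⟨δ, hδ, hδc⟩ := Metric.continuousAt_iff.1 hc 1 one_pos
  filter_upwards [ball_mem_nhds (0 : ℝ) (by positivity : 0 < δ / (B + 1))] with ε hε
  refine hM.bdd_mul (c := ‖c 0‖ + 1) (hcm.comp (hp.const_smul ε)).aestronglyMeasurable
    (Eventually.of_forall fun x => ?_)
  have h1 : ‖ε‖ < δ / (B + 1) := by simpa using hε
  have h2 : dist (ε • p x) 0 < δ := by
    rw [dist_zero_right, norm_smul]
    calc ‖ε‖ * ‖p x‖ ≤ ‖ε‖ * (B + 1) := by
          gcongr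
          linarith [hB x]
      _ < δ := by rwa [lt_div_iff₀ (by positivity)] at h1
  have h3 := hδc h2
  rw [dist_eq_norm] at h3
  have := norm_le_insert' (c (ε • p x)) (c 0)
  linarith

theorem continuous_profilePoint {E : Type*} [NormedAddCommGroup E] [InnerProductSpace ℝ E] {F : ℝ → ℝ}
    (hF : ContDiff ℝ 1 F) : Continuous (profilePoint (E := E) F) := by
  have h1 := continuous_slope (E := E) hF
  have h2 := hF.continuous
  unfold profilePoint
  fun_prop

theorem exists_norm_profilePoint_le {E : Type*} [NormedAddCommGroup E] [InnerProductSpace ℝ E]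
    [ProperSpace E] {F : ℝ → ℝ} (hF : ContDiff ℝ 1 F) {R : ℝ} (hz : ∀ t, R ^ 2 ≤ t → F t = 0) :
    ∃ B, ∀ y : E, ‖profilePoint F y‖ ≤ B := by
  have hd : ∀ t, R ^ 2 < t → deriv F t = 0 := by
    intro t ht
    have : F =ᶠ[𝓝 t] fun _ => 0 := by
      filter_upwards [Ioi_mem_nhds ht] with s hs
      exact hz s (le_of_lt hs)
    rw [this.deriv_eq]
    simp
  have hc : HasCompactSupport (profilePoint (E := E) F) := by
    refine HasCompactSupport.intro (isCompact_closedBall (0 : E) |R|) fun y hy => ?_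
    have hy' : |R| < ‖y‖ := by simpa using hy
    have : R ^ 2 < ‖y‖ ^ 2 := by
      rw [← sq_abs R]
      exact pow_lt_pow_left₀ hy' (abs_nonneg R) (by norm_num)
    simp [profilePoint, slope, hd _ this, hz _ this.le]
  exact hc.exists_bound_of_continuous (continuous_profilePoint hF)

/-- The first variation of the energy of a minimizer along radial deformations. -/
theorem IsMinimizer.stationary {a lamP lamM : ℝ} (ha : a < 1) {g u₀ : Space d → ℝ}
    (hmin : IsMinimizer a lamP lamM g u₀) {u : Space d → ℝ} {G : Space d → Space d}
    (h : IsSobolevPair a u G) (hu₀ : ∀ᵐ x, x ∈ ball (0 : Space d) 1 → u₀ x = u x)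
    (hG₀ : ∀ᵐ x, x ∈ ball (0 : Space d) 1 → weakGradient u₀ x = G x)
    {F : ℝ → ℝ} {R : ℝ} (hF : ContDiff ℝ 1 F) (hR0 : 0 < R) (hR : R < 1)
    (hz : ∀ t, R ^ 2 ≤ t → F t = 0) :
    (∫ y in ball 0 1, (((d : ℝ) + 1 - a) * F (‖y‖ ^ 2) + ‖y‖ ^ 2 * slope F y) *
        (1 / 2 * (‖G y‖ ^ 2 * weight a y))) +
      (∫ y in ball 0 1, -slope F y * ((inner ℝ y (G y)) ^ 2 * weight a y)) +
      (∫ y in ball 0 1, (1 - a) * slope F y * (u y * inner ℝ y (G y) * weight a y)) +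
      2 * (∫ y in ball (0 : EuclideanSpace ℝ (Fin d)) 1,
        (((d : ℝ) + 1 - a) * F (‖y‖ ^ 2) + ‖y‖ ^ 2 * slope F y) *
          thinDensity lamP lamM (thinFormula u G y)) = 0 := by
  obtain ⟨ε₀, hε₀, hsmall⟩ := exists_isSmallProfile hF hR0 hR hz
  set N := (d : ℝ) + 1 - a with hN
  set κ := 1 - a with hκ
  obtain ⟨B, hB⟩ := exists_norm_profilePoint_le (E := Space d) hF hz
  obtain ⟨B', hB'⟩ := exists_norm_profilePoint_le (E := EuclideanSpace ℝ (Fin d)) hF hz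
  have hp := (continuous_profilePoint (E := Space d) hF).measurable
  have hp' := (continuous_profilePoint (E := EuclideanSpace ℝ (Fin d)) hF).measurable
  have hs := (continuous_slope (E := Space d) hF).measurable
  have hs' := (continuous_slope (E := EuclideanSpace ℝ (Fin d)) hF).measurable
  have hFm := hF.continuous.measurable
  have M1 := h.integrable_grad_sq.const_mul (1 / 2)
  have M2 := h.integrableOn_inner_sq
  have M3 := h.integrableOn_mul_inner
  have M4 := h.integrable_sq
  have M5 := h.integrableOn_thinDensity ha lamP lamM
  have D1 := hasDerivAt_integral_coeff (contDiffAt_coeffScale N) (measurable_coeffScale N) hp hB M1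
    (by fun_prop) fun y => hasDerivAt_coeffScale N (profilePoint F y)
  have D2 := hasDerivAt_integral_coeff (contDiffAt_coeffSq N) (measurable_coeffSq N) hp hB M2
    (by fun_prop) fun y => hasDerivAt_coeffSq N (profilePoint F y)
  have D3 := hasDerivAt_integral_coeff (contDiffAt_coeffMixed N κ) (measurable_coeffMixed N κ) hp hB
    M3 (by fun_prop) fun y => hasDerivAt_coeffMixed N κ (profilePoint F y)
  have D4 := hasDerivAt_integral_coeff (contDiffAt_coeffValue N κ) (measurable_coeffValue N κ) hp hB
    M4 (by fun_prop) fun y => hasDerivAt_coeffValue N κ (profilePoint F y)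
  have D5 := hasDerivAt_integral_coeff (contDiffAt_coeffScale N) (measurable_coeffScale N) hp' hB' M5
    (by fun_prop) fun y => hasDerivAt_coeffScale N (profilePoint F y)
  have I1 := eventually_integrable_coeff (contDiffAt_coeffScale N).continuousAt
    (measurable_coeffScale N) hp hB M1
  have I2 := eventually_integrable_coeff (contDiffAt_coeffSq N).continuousAt
    (measurable_coeffSq N) hp hB M2
  have I3 := eventually_integrable_coeff (contDiffAt_coeffMixed N κ).continuousAt
    (measurable_coeffMixed N κ) hp hB M3
  have I4 := eventually_integrable_coeff (contDiffAt_coeffValue N κ).continuousAt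
    (measurable_coeffValue N κ) hp hB M4
  have D := (((D1.add D2).add D3).add D4).add (D5.const_mul 2)
  set e : ℝ → ℝ := _ with he
  change HasDerivAt e _ 0 at D
  -- `e` is a sum of separate integrals, whereas the energy of the competitor has one solid
  -- integral. Its four summands are integrable for small `ε`, so the two agree.
  have hval : ∀ᶠ ε in 𝓝 (0 : ℝ), ∃ hε : IsSmallProfile (fun t => ε * F t) R,
      energy a lamP lamM (hε.transport (1 - a) u) = e ε := by
    filter_upwards [I1, I2, I3, I4, ball_mem_nhds (0 : ℝ) hε₀] with ε i1 i2 i3 i4 hε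
    have hε' : |ε| < ε₀ := by simpa using hε
    refine ⟨hsmall ε hε', ?_⟩
    rw [(hsmall ε hε').energy_transport ha h, he]
    simp only [Pi.add_apply, profilePoint_const_mul hF]
    have e2 := integral_add i1 i2
    have e3 := integral_add (i1.add i2) i3
    have e4 := integral_add ((i1.add i2).add i3) i4
    simp only [Pi.add_apply] at e3 e4
    rw [e4, e3, e2]
  -- The competitor and its gradient equal `u` and `G` for `‖x‖ ≥ R`, so it has the same trace on
  -- the unit sphere and minimality applies.
  have hlm : IsLocalMin e 0 := by
    have h0 : energy a lamP lamM u₀ = e 0 := by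
      rw [h.energy_eq ha hu₀ hG₀, he]
      simp [coeffScale_zero, coeffSq, coeffMixed, coeffValue, coeffRadial_zero, mul_assoc]
    filter_upwards [hval] with ε hε
    obtain ⟨hε, heq⟩ := hε
    rw [← h0, ← heq]
    have hv := hε.isSobolevPair_transport (1 - a) ha h
    exact hmin.energy_le _ hv.memSobolev (IsSphereTrace.congr_of_eq_near_sphere ha hR0 hR h hv
      (fun x hx => hε.transport_eq_self _ u hx) (fun x hx => hε.transportGrad_eq_self _ u G hx)
      hu₀ hG₀ hmin.trace_eq)
  have := hlm.hasDerivAt_eq_zero D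
  simpa [profilePoint] using this

/-! ### Profiles concentrated on a ring -/

theorem tendsto_integral_mul_of_bounded {X : Type*} [MeasurableSpace X] {μ : Measure X}
    {c : ℕ → X → ℝ} {c' M : X → ℝ} (hM : Integrable M μ) (hc : ∀ j, Measurable (c j)) {C : ℝ}
    (hC : ∀ j, ∀ᵐ x ∂μ, ‖c j x‖ ≤ C) (hlim : ∀ᵐ x ∂μ, Tendsto (fun j => c j x) atTop (𝓝 (c' x))) :
    Tendsto (fun j => ∫ x, c j x * M x ∂μ) atTop (𝓝 (∫ x, c' x * M x ∂μ)) := by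
  refine tendsto_integral_of_dominated_convergence (fun x => C * ‖M x‖)
    (fun j => (hc j).aestronglyMeasurable.mul hM.1) (hM.norm.const_mul C) (fun j => ?_) ?_
  · filter_upwards [hC j] with x hx
    rw [norm_mul]
    gcongr
  · filter_upwards [hlim] with x hx using hx.mul_const _

/-- Continuous functions that increase to the indicator function of an interval. -/
noncomputable def tent (s₁ s₂ : ℝ) (j : ℕ) (t : ℝ) : ℝ := min 1 (j * max 0 ((t - s₁) * (s₂ - t)))

theorem continuous_tent (s₁ s₂ : ℝ) (j : ℕ) : Continuous (tent s₁ s₂ j) := by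
  unfold tent
  fun_prop

theorem tent_nonneg (s₁ s₂ : ℝ) (j : ℕ) (t : ℝ) : 0 ≤ tent s₁ s₂ j t :=
  le_min zero_le_one (mul_nonneg (Nat.cast_nonneg j) (le_max_left _ _))

theorem tent_le_one (s₁ s₂ : ℝ) (j : ℕ) (t : ℝ) : tent s₁ s₂ j t ≤ 1 := min_le_left _ _

theorem tent_eq_zero {s₁ s₂ : ℝ} (h : s₁ ≤ s₂) (j : ℕ) {t : ℝ} (ht : t ∉ Ioo s₁ s₂) :
    tent s₁ s₂ j t = 0 := by
  have : (t - s₁) * (s₂ - t) ≤ 0 := by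
    rw [mem_Ioo, not_and_or, not_lt, not_lt] at ht
    rcases ht with h1 | h1 <;> nlinarith
  rw [tent, max_eq_left this, mul_zero, min_eq_right zero_le_one]

theorem tendsto_tent {s₁ s₂ : ℝ} (h : s₁ ≤ s₂) (t : ℝ) :
    Tendsto (fun j => tent s₁ s₂ j t) atTop (𝓝 ((Ioo s₁ s₂).indicator 1 t)) := by
  by_cases ht : t ∈ Ioo s₁ s₂
  · rw [indicator_of_mem ht]
    have hpos : 0 < (t - s₁) * (s₂ - t) := mul_pos (by linarith [ht.1]) (by linarith [ht.2])
    refine tendsto_const_nhds.congr' ?_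
    have : Tendsto (fun j : ℕ => (j : ℝ) * ((t - s₁) * (s₂ - t))) atTop atTop :=
      tendsto_natCast_atTop_atTop.atTop_mul_const hpos
    filter_upwards [this.eventually_ge_atTop 1] with j hj
    rw [tent, max_eq_right hpos.le, min_eq_left hj, Pi.one_apply]
  · simp [indicator_of_notMem ht, tent_eq_zero h _ ht]

/-- The profiles used for the deformations that concentrate on a ring. -/
noncomputable def ringProfile (N s₁ s₂ : ℝ) (j : ℕ) (t : ℝ) : ℝ :=
  tent s₁ s₂ j t * (max t s₁) ^ (-(N / 2) - 1)

section RingProfile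

variable {N s₁ s₂ : ℝ}

/-- The maximum with `s₁` keeps the base of the power away from 0. When `s₁ ≤ s₂` it changes nothing
else, because the tent vanishes for `t ≤ s₁`. -/
theorem continuous_ringProfile (h1 : 0 < s₁) (j : ℕ) : Continuous (ringProfile N s₁ s₂ j) :=
  (continuous_tent s₁ s₂ j).mul ((continuous_id.max continuous_const).rpow_const fun t =>
    Or.inl (h1.trans_le (le_max_right t s₁)).ne')

theorem norm_ringProfile_le (hN : 0 < N) (h1 : 0 < s₁) (j : ℕ) (t : ℝ) :
    ‖ringProfile N s₁ s₂ j t‖ ≤ s₁ ^ (-(N / 2) - 1) := by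
  rw [ringProfile, norm_mul, Real.norm_of_nonneg (tent_nonneg _ _ _ _),
    Real.norm_of_nonneg (Real.rpow_nonneg (h1.le.trans (le_max_right t s₁)) _)]
  have := Real.rpow_le_rpow_of_nonpos (z := -(N / 2) - 1) h1 (le_max_right t s₁) (by linarith)
  exact (mul_le_of_le_one_left (Real.rpow_nonneg (h1.le.trans (le_max_right t s₁)) _)
    (tent_le_one _ _ _ _)).trans this

theorem tendsto_ringProfile (h : s₁ ≤ s₂) (t : ℝ) :
    Tendsto (fun j => ringProfile N s₁ s₂ j t) atTop
      (𝓝 ((Ioo s₁ s₂).indicator (fun t => t ^ (-(N / 2) - 1)) t)) := by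
  have := (tendsto_tent h t).mul_const ((max t s₁) ^ (-(N / 2) - 1))
  have e : (Ioo s₁ s₂).indicator (fun t => t ^ (-(N / 2) - 1)) t =
      (Ioo s₁ s₂).indicator 1 t * max t s₁ ^ (-(N / 2) - 1) := by
    by_cases ht : t ∈ Ioo s₁ s₂
    · rw [indicator_of_mem ht, indicator_of_mem ht, max_eq_left ht.1.le, Pi.one_apply, one_mul]
    · rw [indicator_of_notMem ht, indicator_of_notMem ht, zero_mul]
  rw [e]
  exact this

theorem integral_rpow_ring (hN : 0 < N) {s t : ℝ} (hs : 0 < s) (ht : 0 < t) :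
    ∫ x in s..t, x ^ (-(N / 2) - 1) = 2 / N * (s ^ (-(N / 2)) - t ^ (-(N / 2))) := by
  rw [integral_rpow (Or.inr ⟨by linarith, notMem_uIcc_of_lt hs ht⟩)]
  rw [show -(N / 2) - 1 + 1 = -(N / 2) by ring]
  field_simp
  ring

theorem tendsto_integral_ringProfile (hN : 0 < N) (h1 : 0 < s₁) (h : s₁ ≤ s₂) (t : ℝ) :
    Tendsto (fun j => ∫ x in s₂..t, ringProfile N s₁ s₂ j x) atTop
      (𝓝 (∫ x in s₂..t, (Ioo s₁ s₂).indicator (fun t => t ^ (-(N / 2) - 1)) x)) := by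
  refine intervalIntegral.tendsto_integral_filter_of_dominated_convergence
    (fun _ => s₁ ^ (-(N / 2) - 1)) (Eventually.of_forall fun j =>
      (continuous_ringProfile h1 j).aestronglyMeasurable)
    (Eventually.of_forall fun j => Eventually.of_forall fun x _ => norm_ringProfile_le hN h1 j x)
    intervalIntegrable_const (Eventually.of_forall fun x _ => tendsto_ringProfile h x)

theorem integral_indicator_rpow_of_mem (hN : 0 < N) (h1 : 0 < s₁) {t : ℝ}
    (ht : t ∈ Icc s₁ s₂) :
    ∫ x in s₂..t, (Ioo s₁ s₂).indicator (fun t => t ^ (-(N / 2) - 1)) x =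
      2 / N * (s₂ ^ (-(N / 2)) - t ^ (-(N / 2))) := by
  rw [← integral_rpow_ring hN (h1.trans_le (ht.1.trans ht.2)) (h1.trans_le ht.1)]
  rw [intervalIntegral.integral_symm, intervalIntegral.integral_symm t s₂,
    intervalIntegral.integral_of_le ht.2, intervalIntegral.integral_of_le ht.2,
    integral_Ioc_eq_integral_Ioo, integral_Ioc_eq_integral_Ioo]
  congr 1
  refine setIntegral_congr_fun measurableSet_Ioo fun x hx => ?_
  exact indicator_of_mem (show x ∈ Ioo s₁ s₂ from ⟨ht.1.trans_lt hx.1, hx.2⟩) _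

theorem integral_indicator_rpow_of_ge {t : ℝ} (ht : s₂ ≤ t) :
    ∫ x in s₂..t, (Ioo s₁ s₂).indicator (fun t => t ^ (-(N / 2) - 1)) x = 0 := by
  rw [intervalIntegral.integral_of_le ht]
  refine setIntegral_eq_zero_of_forall_eq_zero fun x hx => ?_
  exact indicator_of_notMem (fun h => absurd h.2 (not_lt.2 hx.1.le)) _

theorem integral_indicator_rpow_of_le (hN : 0 < N) (h1 : 0 < s₁) (h : s₁ ≤ s₂) {t : ℝ}
    (ht : t ≤ s₁) :
    ∫ x in s₂..t, (Ioo s₁ s₂).indicator (fun t => t ^ (-(N / 2) - 1)) x =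
      2 / N * (s₂ ^ (-(N / 2)) - s₁ ^ (-(N / 2))) := by
  rw [← integral_indicator_rpow_of_mem hN h1 (left_mem_Icc.2 h), intervalIntegral.integral_symm,
    intervalIntegral.integral_symm s₁ s₂, intervalIntegral.integral_of_le (ht.trans h),
    intervalIntegral.integral_of_le h]
  congr 1
  refine setIntegral_eq_of_subset_of_forall_sdiff_eq_zero measurableSet_Ioc
    (Ioc_subset_Ioc_left ht) fun x hx => ?_
  refine indicator_of_notMem (fun h' => hx.2 ⟨h'.1, h'.2.le⟩) _

/-- The exponent of the profile is chosen so that its primitive `F` makes `N F + 2 t F'` constant on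
the ring: the two terms in `t^(-N/2)` cancel. Below the ring `F` is constant, and beyond it `F = 0`.
In the first variation the energy density is multiplied by this expression at `t = |y|²`, so only
the energies of two balls remain. -/
theorem scale_integral_indicator_rpow (hN : 0 < N) (h1 : 0 < s₁) (h : s₁ < s₂) (t : ℝ) :
    N * (∫ x in s₂..t, (Ioo s₁ s₂).indicator (fun t => t ^ (-(N / 2) - 1)) x) +
      t * (2 * (Ioo s₁ s₂).indicator (fun t => t ^ (-(N / 2) - 1)) t) =
    (Iio s₂).indicator (fun _ => 2 * s₂ ^ (-(N / 2))) t -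
      (Iic s₁).indicator (fun _ => 2 * s₁ ^ (-(N / 2))) t := by
  rcases le_or_gt t s₁ with ht | ht
  · rw [integral_indicator_rpow_of_le hN h1 h.le ht,
      indicator_of_notMem (fun h' : t ∈ Ioo s₁ s₂ => absurd h'.1 (not_lt.2 ht)),
      indicator_of_mem (mem_Iio.2 (ht.trans_lt h)), indicator_of_mem (mem_Iic.2 ht)]
    field_simp
    ring
  rw [indicator_of_notMem (fun h' : t ∈ Iic s₁ => absurd ht (not_lt.2 h'))]
  rcases le_or_gt s₂ t with ht2 | ht2
  · rw [integral_indicator_rpow_of_ge ht2,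
      indicator_of_notMem (fun h' : t ∈ Ioo s₁ s₂ => absurd h'.2 (not_lt.2 ht2)),
      indicator_of_notMem (fun h' : t ∈ Iio s₂ => absurd h' (not_lt.2 ht2))]
    ring
  · rw [integral_indicator_rpow_of_mem hN h1 ⟨ht.le, ht2.le⟩,
      indicator_of_mem (show t ∈ Ioo s₁ s₂ from ⟨ht, ht2⟩), indicator_of_mem (mem_Iio.2 ht2)]
    have : t ^ (-(N / 2)) = t * t ^ (-(N / 2) - 1) := by
      rw [Real.rpow_sub_one (h1.trans ht).ne']
      field_simp [(h1.trans ht).ne']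
    rw [this]
    field_simp
    ring

theorem norm_integral_ringProfile_le (hN : 0 < N) (h1 : 0 < s₁) (j : ℕ) (h2 : s₂ ≤ 1) (h0 : 0 ≤ s₂)
    {t : ℝ} (ht : t ∈ Icc (0 : ℝ) 1) :
    ‖∫ x in s₂..t, ringProfile N s₁ s₂ j x‖ ≤ s₁ ^ (-(N / 2) - 1) := by
  refine (intervalIntegral.norm_integral_le_of_norm_le_const
    fun x _ => norm_ringProfile_le hN h1 j x).trans ?_
  have : |t - s₂| ≤ 1 := by rw [abs_le]; constructor <;> linarith [ht.1, ht.2]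
  exact mul_le_of_le_one_right (Real.rpow_nonneg h1.le _) this

end RingProfile

/-- The ring `p₁ < |x| < p₂`. -/
def annulus (d : ℕ) (p₁ p₂ : ℝ) : Set (Space d) := {x | ‖x‖ ∈ Ioo p₁ p₂}

theorem measurableSet_annulus (p₁ p₂ : ℝ) : MeasurableSet (annulus d p₁ p₂) :=
  measurable_norm measurableSet_Ioo

theorem annulus_subset_ball (p₁ p₂ : ℝ) : annulus d p₁ p₂ ⊆ ball 0 p₂ := fun x hx => by
  simpa using hx.2

/-- The energy `½ ∫_{B_r} |∇u|² |xₙ|ᵃ + 2 ∫_{B_r'} (λ₊ u⁺ + λ₋ u⁻)`. -/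
noncomputable def localEnergy (a lamP lamM : ℝ) (u : Space d → ℝ) (G : Space d → Space d) (r : ℝ) :
    ℝ :=
  (∫ x in ball 0 r, 1 / 2 * (‖G x‖ ^ 2 * weight a x)) +
    2 * ∫ y in ball (0 : EuclideanSpace ℝ (Fin d)) r, thinDensity lamP lamM (thinFormula u G y)

/-- The limit of the profiles produces an open ball at `p₂` and a closed one at `p₁`; the sphere of
radius `p₁` is a null set. -/
theorem setIntegral_indicator_norm_sq {E : Type*} [NormedAddCommGroup E] [NormedSpace ℝ E]
    [MeasurableSpace E] [BorelSpace E] [FiniteDimensional ℝ E] (μ : Measure E) [μ.IsAddHaarMeasure]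
    {M : E → ℝ} (hM : IntegrableOn M (ball 0 1) μ) {p₁ p₂ : ℝ} (h1 : 0 < p₁) (h2 : 0 < p₂)
    (h1' : p₁ < 1) (h2' : p₂ < 1) (c₁ c₂ : ℝ) :
    ∫ y in ball 0 1, ((Iio (p₂ ^ 2)).indicator (fun _ => c₂) (‖y‖ ^ 2) -
      (Iic (p₁ ^ 2)).indicator (fun _ => c₁) (‖y‖ ^ 2)) * M y ∂μ =
    c₂ * (∫ y in ball 0 p₂, M y ∂μ) - c₁ * ∫ y in ball 0 p₁, M y ∂μ := by
  have e2 : ∀ y : E, (Iio (p₂ ^ 2)).indicator (fun _ => c₂) (‖y‖ ^ 2) * M y =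
      (ball 0 p₂).indicator (fun y => c₂ * M y) y := by
    intro y
    by_cases hy : y ∈ ball (0 : E) p₂
    · have : ‖y‖ ^ 2 < p₂ ^ 2 := pow_lt_pow_left₀ (by simpa using hy) (norm_nonneg y) (by norm_num)
      rw [indicator_of_mem (mem_Iio.2 this), indicator_of_mem hy]
    · have : ¬ ‖y‖ ^ 2 < p₂ ^ 2 := by
        rw [not_lt]
        exact pow_le_pow_left₀ h2.le (by simpa using hy) 2
      rw [indicator_of_notMem (by simpa using this), indicator_of_notMem hy, zero_mul]
  have e1 : ∀ y : E, (Iic (p₁ ^ 2)).indicator (fun _ => c₁) (‖y‖ ^ 2) * M y =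
      (closedBall 0 p₁).indicator (fun y => c₁ * M y) y := by
    intro y
    by_cases hy : y ∈ closedBall (0 : E) p₁
    · have : ‖y‖ ^ 2 ≤ p₁ ^ 2 := pow_le_pow_left₀ (norm_nonneg y) (by simpa using hy) 2
      rw [indicator_of_mem (mem_Iic.2 this), indicator_of_mem hy]
    · have : ¬ ‖y‖ ^ 2 ≤ p₁ ^ 2 := by
        rw [not_le]
        exact pow_lt_pow_left₀ (by simpa using hy) h1.le (by norm_num)
      rw [indicator_of_notMem (by simpa using this), indicator_of_notMem hy, zero_mul]
  simp only [sub_mul, e1, e2]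
  have hMc : ∀ c : ℝ, IntegrableOn (fun y => c * M y) (ball 0 1) μ := fun c => hM.const_mul c
  rw [integral_sub ((hMc c₂).indicator measurableSet_ball)
    ((hMc c₁).indicator measurableSet_closedBall),
    setIntegral_indicator measurableSet_ball, setIntegral_indicator measurableSet_closedBall,
    inter_eq_self_of_subset_right (ball_subset_ball h2'.le),
    inter_eq_self_of_subset_right (closedBall_subset_ball h1'), integral_const_mul,
    integral_const_mul]
  congr 2
  refine setIntegral_congr_set ?_
  refine ae_eq_set.2 ⟨?_, ?_⟩
  · have : closedBall (0 : E) p₁ \ ball 0 p₁ = sphere 0 p₁ := closedBall_sdiff_ball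
    rw [this]
    exact Measure.addHaar_sphere_of_ne_zero μ 0 h1.ne'
  · rw [sdiff_eq_empty.2 ball_subset_closedBall, measure_empty]

theorem rpow_sq_ring (N : ℝ) {p : ℝ} (hp : 0 ≤ p) : (p ^ 2) ^ (-(N / 2)) = p ^ (-N) := by
  rw [← Real.rpow_natCast, ← Real.rpow_mul hp]
  congr 1
  push_cast
  ring

theorem rpow_sq_ring_sub_one (N : ℝ) {p : ℝ} (hp : 0 ≤ p) :
    (p ^ 2) ^ (-(N / 2) - 1) = p ^ (-(N + 2)) := by
  rw [← Real.rpow_natCast, ← Real.rpow_mul hp]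
  congr 1
  push_cast
  ring

theorem setIntegral_indicator_annulus {M : Space d → ℝ} {N p₁ p₂ : ℝ} (h1 : 0 < p₁) (h12 : p₁ < p₂)
    (h2 : p₂ < 1) :
    ∫ y in ball 0 1, (2 * (Ioo (p₁ ^ 2) (p₂ ^ 2)).indicator (fun t => t ^ (-(N / 2) - 1))
      (‖y‖ ^ 2)) * M y = ∫ y in annulus d p₁ p₂, 2 * (‖y‖ ^ (-(N + 2)) * M y) := by
  have e : ∀ y : Space d, (2 * (Ioo (p₁ ^ 2) (p₂ ^ 2)).indicator (fun t => t ^ (-(N / 2) - 1))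
      (‖y‖ ^ 2)) * M y = (annulus d p₁ p₂).indicator (fun y => 2 * (‖y‖ ^ (-(N + 2)) * M y)) y := by
    intro y
    have hiff : ‖y‖ ^ 2 ∈ Ioo (p₁ ^ 2) (p₂ ^ 2) ↔ y ∈ annulus d p₁ p₂ := by
      simp only [annulus, mem_ofPred_eq, mem_Ioo]
      rw [pow_lt_pow_iff_left₀ h1.le (norm_nonneg y) (by norm_num),
        pow_lt_pow_iff_left₀ (norm_nonneg y) (h1.trans h12).le (by norm_num)]
    by_cases hy : y ∈ annulus d p₁ p₂
    · rw [indicator_of_mem hy, indicator_of_mem (hiff.2 hy), rpow_sq_ring_sub_one N (norm_nonneg y)]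
      ring
    · rw [indicator_of_notMem hy, indicator_of_notMem (fun h => hy (hiff.1 h))]
      ring
  simp only [e]
  rw [setIntegral_indicator (measurableSet_annulus p₁ p₂), inter_eq_self_of_subset_right]
  exact (annulus_subset_ball p₁ p₂).trans (ball_subset_ball h2.le)

/-- The growth of the scaled energy of a minimizer. -/
theorem IsMinimizer.localEnergy_sub {a lamP lamM : ℝ} (ha : a < 1) {g u₀ : Space d → ℝ}
    (hmin : IsMinimizer a lamP lamM g u₀) {u : Space d → ℝ} {G : Space d → Space d}
    (h : IsSobolevPair a u G) (hu₀ : ∀ᵐ x, x ∈ ball (0 : Space d) 1 → u₀ x = u x)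
    (hG₀ : ∀ᵐ x, x ∈ ball (0 : Space d) 1 → weakGradient u₀ x = G x)
    {p₁ p₂ : ℝ} (h1 : 0 < p₁) (h12 : p₁ < p₂) (h2 : p₂ < 1) :
    p₂ ^ (-((d : ℝ) + 1 - a)) * localEnergy a lamP lamM u G p₂ -
        p₁ ^ (-((d : ℝ) + 1 - a)) * localEnergy a lamP lamM u G p₁ =
      (∫ y in annulus d p₁ p₂, ‖y‖ ^ (-((d : ℝ) + 1 - a + 2)) *
          ((inner ℝ y (G y)) ^ 2 * weight a y)) -
        (1 - a) * ∫ y in annulus d p₁ p₂, ‖y‖ ^ (-((d : ℝ) + 1 - a + 2)) *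
          (u y * inner ℝ y (G y) * weight a y) := by
  set N := (d : ℝ) + 1 - a with hN
  have hN0 : 0 < N := by
    have : (0 : ℝ) ≤ d := Nat.cast_nonneg d
    linarith
  set κ := 1 - a with hκ
  have s1 : 0 < p₁ ^ 2 := by positivity
  have s12 : p₁ ^ 2 < p₂ ^ 2 := pow_lt_pow_left₀ h12 h1.le (by norm_num)
  have s2 : p₂ ^ 2 ≤ 1 := pow_le_one₀ (h1.trans h12).le h2.le
  set ξ := ringProfile N (p₁ ^ 2) (p₂ ^ 2) with hξ
  set ξ' : ℝ → ℝ := (Ioo (p₁ ^ 2) (p₂ ^ 2)).indicator (fun t => t ^ (-(N / 2) - 1)) with hξ'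
  set F : ℕ → ℝ → ℝ := fun j t => ∫ x in (p₂ ^ 2)..t, ξ j x with hF
  set F' : ℝ → ℝ := fun t => ∫ x in (p₂ ^ 2)..t, ξ' x with hF'
  have hξc : ∀ j, Continuous (ξ j) := fun j => continuous_ringProfile s1 j
  have hder : ∀ j t, HasDerivAt (F j) (ξ j t) t := fun j t => (hξc j).integral_hasStrictDerivAt _ t
    |>.hasDerivAt
  have hderiv : ∀ j, deriv (F j) = ξ j := fun j => funext fun t => (hder j t).deriv
  have hFC : ∀ j, ContDiff ℝ 1 (F j) := fun j => by
    rw [contDiff_one_iff_deriv, hderiv]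
    exact ⟨fun t => (hder j t).differentiableAt, hξc j⟩
  have hz : ∀ j t, p₂ ^ 2 ≤ t → F j t = 0 := by
    intro j t ht
    simp only [hF]
    rw [intervalIntegral.integral_of_le ht]
    refine setIntegral_eq_zero_of_forall_eq_zero fun x hx => ?_
    rw [hξ, ringProfile, tent_eq_zero s12.le j (fun h => absurd h.2 (not_lt.2 hx.1.le)), zero_mul]
  have hslope : ∀ {E : Type} [NormedAddCommGroup E] (j : ℕ) (y : E),
      slope (F j) y = 2 * ξ j (‖y‖ ^ 2) := fun j y => by rw [slope, hderiv]
  set C := (p₁ ^ 2) ^ (-(N / 2) - 1) with hC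
  have hC0 : 0 ≤ C := Real.rpow_nonneg s1.le _
  have bξ : ∀ j t, ‖ξ j t‖ ≤ C := fun j t => norm_ringProfile_le hN0 s1 j t
  have bF : ∀ j t, t ∈ Icc (0 : ℝ) 1 → ‖F j t‖ ≤ C := fun j t ht =>
    norm_integral_ringProfile_le hN0 s1 j s2 (by positivity) ht
  have lξ : ∀ t, Tendsto (fun j => ξ j t) atTop (𝓝 (ξ' t)) := fun t => tendsto_ringProfile s12.le t
  have lF : ∀ t, Tendsto (fun j => F j t) atTop (𝓝 (F' t)) := fun t =>
    tendsto_integral_ringProfile hN0 s1 s12.le t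
  have bS : ∀ j t, t ∈ Icc (0 : ℝ) 1 → ‖N * F j t + t * (2 * ξ j t)‖ ≤ N * C + 2 * C := by
    intro j t ht
    refine (norm_add_le _ _).trans (add_le_add ?_ ?_)
    · rw [norm_mul, Real.norm_of_nonneg hN0.le]
      exact mul_le_mul_of_nonneg_left (bF j t ht) hN0.le
    · rw [norm_mul, norm_mul, Real.norm_of_nonneg ht.1, Real.norm_of_nonneg zero_le_two]
      have := bξ j t
      have h0 := norm_nonneg (ξ j t)
      nlinarith [ht.1, ht.2]
  have lS : ∀ t, Tendsto (fun j => N * F j t + t * (2 * ξ j t)) atTop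
      (𝓝 ((Iio (p₂ ^ 2)).indicator (fun _ => 2 * p₂ ^ (-N)) t -
        (Iic (p₁ ^ 2)).indicator (fun _ => 2 * p₁ ^ (-N)) t)) := by
    intro t
    have := ((lF t).const_mul N).add (((lξ t).const_mul 2).const_mul t)
    rwa [scale_integral_indicator_rpow hN0 s1 s12, rpow_sq_ring N (h1.trans h12).le,
      rpow_sq_ring N h1.le] at this
  have hsq : ∀ {E : Type} [NormedAddCommGroup E] {y : E}, y ∈ ball (0 : E) 1 →
      ‖y‖ ^ 2 ∈ Icc (0 : ℝ) 1 := fun {E} _ {y} hy =>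
    ⟨by positivity, pow_le_one₀ (norm_nonneg y) (by simpa using (mem_ball_zero_iff.1 hy).le)⟩
  have hFm : ∀ j, Measurable (F j) := fun j => (hFC j).continuous.measurable
  have hξm : ∀ j, Measurable (ξ j) := fun j => (hξc j).measurable
  have M1 := h.integrable_grad_sq.const_mul (1 / 2)
  have M5 := h.integrableOn_thinDensity ha lamP lamM
  have T1 := tendsto_integral_mul_of_bounded M1
    (c := fun j y => N * F j (‖y‖ ^ 2) + ‖y‖ ^ 2 * (2 * ξ j (‖y‖ ^ 2))) (C := N * C + 2 * C)
    (fun j => by fun_prop) (fun j => by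
      filter_upwards [ae_restrict_mem measurableSet_ball] with y hy using bS j _ (hsq hy))
    (Eventually.of_forall fun y => lS (‖y‖ ^ 2))
  have T5 := tendsto_integral_mul_of_bounded M5
    (c := fun j y => N * F j (‖y‖ ^ 2) + ‖y‖ ^ 2 * (2 * ξ j (‖y‖ ^ 2))) (C := N * C + 2 * C)
    (fun j => by fun_prop) (fun j => by
      filter_upwards [ae_restrict_mem measurableSet_ball] with y hy using bS j _ (hsq hy))
    (Eventually.of_forall fun y => lS (‖y‖ ^ 2))
  have T2 := tendsto_integral_mul_of_bounded h.integrableOn_inner_sq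
    (c := fun j y => 2 * ξ j (‖y‖ ^ 2)) (C := 2 * C)
    (fun j => by fun_prop) (fun j => Eventually.of_forall fun y => by
      rw [norm_mul, Real.norm_of_nonneg zero_le_two]
      exact mul_le_mul_of_nonneg_left (bξ j _) zero_le_two)
    (Eventually.of_forall fun y => (lξ (‖y‖ ^ 2)).const_mul 2)
  have T3 := tendsto_integral_mul_of_bounded h.integrableOn_mul_inner
    (c := fun j y => 2 * ξ j (‖y‖ ^ 2)) (C := 2 * C)
    (fun j => by fun_prop) (fun j => Eventually.of_forall fun y => by
      rw [norm_mul, Real.norm_of_nonneg zero_le_two]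
      exact mul_le_mul_of_nonneg_left (bξ j _) zero_le_two)
    (Eventually.of_forall fun y => (lξ (‖y‖ ^ 2)).const_mul 2)
  have T := ((T1.sub T2).add (T3.const_mul κ)).add (T5.const_mul 2)
  have hzero : ∀ j, _ = (0 : ℝ) := fun j =>
    hmin.stationary ha h hu₀ hG₀ (hFC j) (h1.trans h12) h2 (hz j)
  simp only [hslope, neg_mul, integral_neg, ← hN, ← hκ, mul_assoc κ, integral_const_mul κ] at hzero
  have hlim := tendsto_nhds_unique T (tendsto_const_nhds.congr fun j => (by
    rw [← hzero j]
    ring : (0 : ℝ) = _))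
  rw [setIntegral_indicator_norm_sq volume M1 h1 (h1.trans h12) (h12.trans h2) h2,
    setIntegral_indicator_norm_sq volume M5 h1 (h1.trans h12) (h12.trans h2) h2,
    setIntegral_indicator_annulus h1 h12 h2, setIntegral_indicator_annulus h1 h12 h2] at hlim
  simp only [integral_const_mul] at hlim
  simp only [localEnergy, integral_const_mul]
  -- The factor 2 in `slope F = 2 F'` occurs in every term of the limit.
  linear_combination (1 / 2) * hlim

/-! ### Polar coordinates -/

/-- The surface measure of the unit sphere, as a measure on the ambient space. -/
noncomputable def unitSphereMeasure (d : ℕ) : Measure (Space d) :=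
  (volume : Measure (Space d)).toSphere.map (↑)

instance : IsFiniteMeasure (unitSphereMeasure d) := by
  unfold unitSphereMeasure
  infer_instance

theorem measurableEmbedding_sphere :
    MeasurableEmbedding ((↑) : sphere (0 : Space d) 1 → Space d) :=
  MeasurableEmbedding.subtype_coe isClosed_sphere.measurableSet

theorem ae_norm_eq_one : ∀ᵐ θ ∂(unitSphereMeasure d), ‖θ‖ = 1 := by
  rw [unitSphereMeasure, measurableEmbedding_sphere.ae_map_iff]
  exact Eventually.of_forall fun θ => by simp

/-- The measure `rᵈ dr` on the half line. -/
noncomputable def radialMeasure (d : ℕ) : Measure ℝ :=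
  (volume.restrict (Ioi 0)).withDensity fun r => ENNReal.ofReal (r ^ d)

instance : SFinite (radialMeasure d) := by
  unfold radialMeasure
  infer_instance

theorem measurable_ofReal_pow : Measurable fun r : ℝ => ENNReal.ofReal (r ^ d) :=
  (measurable_id.pow_const d).ennreal_ofReal

theorem measurable_ofReal_pow_snd : Measurable fun z : Space d × ℝ => ENNReal.ofReal (z.2 ^ d) :=
  measurable_ofReal_pow.comp measurable_snd

theorem lintegral_polar {g : Space d → ENNReal} (hg : Measurable g) :
    ∫⁻ x, g x = ∫⁻ θ, ∫⁻ r, g (r • θ) ∂(radialMeasure d) ∂(unitSphereMeasure d) := by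
  have h1 : ∫⁻ x, g x = ∫⁻ x : ({(0 : Space d)}ᶜ : Set (Space d)), g x.1
      ∂((volume : Measure (Space d)).comap (↑)) := by
    rw [lintegral_subtype_comap (measurableSet_singleton _).compl, restrict_compl_singleton]
  have hm : Measurable fun p : sphere (0 : Space d) 1 × Ioi (0 : ℝ) => g (p.2.1 • p.1.1) := by
    refine hg.comp ?_
    fun_prop
  have h2 := ((volume : Measure (Space d)).measurePreserving_homeomorphUnitSphereProd).lintegral_comp
    hm
  rw [h1, unitSphereMeasure, measurableEmbedding_sphere.lintegral_map]
  have e : ∀ x : ({(0 : Space d)}ᶜ : Set (Space d)),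
      g ((homeomorphUnitSphereProd (Space d) x).2.1 • (homeomorphUnitSphereProd (Space d) x).1.1) =
        g x.1 := fun x => by
    have hx : ‖x.1‖ ≠ 0 := norm_ne_zero_iff.2 x.2
    simp only [homeomorphUnitSphereProd_apply_snd_coe, homeomorphUnitSphereProd_apply_fst_coe,
      smul_smul, mul_inv_cancel₀ hx, one_smul]
  simp only [e] at h2
  rw [h2, lintegral_prod _ hm.aemeasurable]
  refine lintegral_congr fun θ => ?_
  have hmθ : Measurable fun r : ℝ => g (r • (θ : Space d)) := by
    refine hg.comp ?_
    fun_prop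
  rw [Measure.volumeIoiPow, finrank_euclideanSpace_fin, Nat.add_sub_cancel,
    lintegral_withDensity_eq_lintegral_mul _ (by fun_prop) (by fun_prop), radialMeasure,
    lintegral_withDensity_eq_lintegral_mul _ measurable_ofReal_pow hmθ]
  simp only [Pi.mul_apply]
  rw [lintegral_subtype_comap measurableSet_Ioi
    fun r : ℝ => ENNReal.ofReal (r ^ d) * g (r • (θ : Space d))]

/-- Polar coordinates. -/
noncomputable def polar (z : Space d × ℝ) : Space d := z.2 • z.1

theorem measurable_polar : Measurable (polar (d := d)) := by
  unfold polar
  fun_prop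

theorem measurePreserving_polar : MeasurePreserving (polar (d := d))
    ((unitSphereMeasure d).prod (radialMeasure d)) volume := by
  refine ⟨measurable_polar, Measure.ext fun s hs => ?_⟩
  have h1 := lintegral_polar (g := s.indicator 1) (measurable_const.indicator hs)
  rw [lintegral_indicator_one hs] at h1
  rw [Measure.map_apply measurable_polar hs, h1,
    ← lintegral_indicator_one (measurable_polar hs), lintegral_prod]
  · rfl
  · exact (measurable_const.indicator (measurable_polar hs)).aemeasurable

theorem ae_radialMeasure_iff {P : ℝ → Prop} :
    (∀ᵐ r ∂(radialMeasure d), P r) ↔ ∀ᵐ r : ℝ, 0 < r → P r := by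
  rw [radialMeasure, ae_withDensity_iff measurable_ofReal_pow, ae_restrict_iff' measurableSet_Ioi]
  refine eventually_congr (Eventually.of_forall fun r => ?_)
  refine imp_congr_right fun hr => ?_
  simp [pow_pos (mem_Ioi.1 hr)]

theorem ae_polar {P : Space d → Prop} (h : ∀ᵐ x, P x) :
    ∀ᵐ θ ∂(unitSphereMeasure d), ∀ᵐ r : ℝ, 0 < r → P (r • θ) := by
  have h1 := measurePreserving_polar.quasiMeasurePreserving.ae h
  filter_upwards [Measure.ae_ae_of_ae_prod h1] with θ hθ
  exact ae_radialMeasure_iff.1 hθ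

/-- The cone over a null set of directions is a null set. -/
theorem ae_normalize {P : Space d → Prop} (h : ∀ᵐ θ ∂(unitSphereMeasure d), P θ) :
    ∀ᵐ x : Space d, P (‖x‖⁻¹ • x) := by
  rw [unitSphereMeasure, measurableEmbedding_sphere.ae_map_iff] at h
  have h1 := ((volume : Measure (Space d)).measurePreserving_homeomorphUnitSphereProd).quasiMeasurePreserving.ae
    (Measure.quasiMeasurePreserving_fst.ae h)
  have h2 := (ae_restrict_iff_subtype (measurableSet_singleton (0 : Space d)).compl
    (p := fun x : Space d => P (‖x‖⁻¹ • x))).2 (by simpa using h1)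
  rwa [restrict_compl_singleton] at h2

theorem smul_mem_annulus_iff {θ : Space d} (hθ : ‖θ‖ = 1) {r p q : ℝ} (hr : 0 < r) :
    r • θ ∈ annulus d p q ↔ r ∈ Ioo p q := by
  rw [annulus, mem_ofPred_eq, norm_smul, hθ, mul_one, Real.norm_of_nonneg hr.le]

theorem lintegral_annulus {g : Space d → ENNReal} (hg : Measurable g) {p q : ℝ} (hp : 0 ≤ p) :
    ∫⁻ x in annulus d p q, g x =
      ∫⁻ θ, (∫⁻ r in Ioo p q, ENNReal.ofReal (r ^ d) * g (r • θ)) ∂(unitSphereMeasure d) := by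
  rw [← lintegral_indicator (measurableSet_annulus p q),
    lintegral_polar (hg.indicator (measurableSet_annulus p q))]
  refine lintegral_congr_ae ?_
  filter_upwards [ae_norm_eq_one] with θ hθ
  have hm : Measurable fun r : ℝ => (annulus d p q).indicator g (r • θ) :=
    (hg.indicator (measurableSet_annulus p q)).comp (by fun_prop)
  rw [radialMeasure, lintegral_withDensity_eq_lintegral_mul _ measurable_ofReal_pow hm,
    ← lintegral_indicator measurableSet_Ioi, ← lintegral_indicator measurableSet_Ioo]
  refine lintegral_congr fun r => ?_
  by_cases hr : r ∈ Ioo p q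
  · have h0 : 0 < r := hp.trans_lt hr.1
    rw [indicator_of_mem hr, indicator_of_mem (mem_Ioi.2 h0), Pi.mul_apply,
      indicator_of_mem ((smul_mem_annulus_iff hθ h0).2 hr)]
  · rw [indicator_of_notMem hr]
    by_cases h0 : r ∈ Ioi (0 : ℝ)
    · rw [indicator_of_mem h0, Pi.mul_apply,
        indicator_of_notMem (fun h => hr ((smul_mem_annulus_iff hθ h0).1 h)), mul_zero]
    · rw [indicator_of_notMem h0]

theorem measurePreserving_polar_annulus {p q : ℝ} (hp : 0 ≤ p) :
    MeasurePreserving (polar (d := d)) (((unitSphereMeasure d).prod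
      (volume.restrict (Ioo p q))).withDensity fun z => ENNReal.ofReal (z.2 ^ d))
      (volume.restrict (annulus d p q)) := by
  have hd := measurable_ofReal_pow_snd (d := d)
  refine ⟨measurable_polar, Measure.ext fun s hs => ?_⟩
  have h1 := lintegral_annulus (g := s.indicator 1) (p := p) (q := q) (measurable_const.indicator hs)
    hp
  have hi : Measurable ((polar ⁻¹' s).indicator (1 : Space d × ℝ → ENNReal)) :=
    measurable_const.indicator (measurable_polar hs)
  rw [lintegral_indicator_one hs] at h1
  rw [Measure.map_apply measurable_polar hs, h1, ← lintegral_indicator_one (measurable_polar hs),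
    lintegral_withDensity_eq_lintegral_mul _ hd hi, lintegral_prod _ (hd.mul hi).aemeasurable]
  rfl

section Integral

variable {f : Space d → ℝ} {p q : ℝ}

theorem integrable_polar_annulus (hf : IntegrableOn f (annulus d p q)) (hp : 0 ≤ p) :
    Integrable (fun z : Space d × ℝ => z.2 ^ d * f (z.2 • z.1))
      ((unitSphereMeasure d).prod (volume.restrict (Ioo p q))) := by
  have h := (measurePreserving_polar_annulus hp).integrable_comp_of_integrable hf
  rw [integrable_withDensity_iff_integrable_smul' measurable_ofReal_pow_snd
    (by simp)] at h
  refine h.congr ?_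
  have : ∀ᵐ z ∂(unitSphereMeasure d).prod (volume.restrict (Ioo p q)), z.2 ∈ Ioo p q :=
    Measure.quasiMeasurePreserving_snd.ae (ae_restrict_mem measurableSet_Ioo)
  filter_upwards [this] with z hz
  rw [ENNReal.toReal_ofReal (pow_nonneg (hp.trans hz.1.le) d)]
  rfl

theorem integral_annulus (hf : IntegrableOn f (annulus d p q)) (hp : 0 ≤ p) :
    ∫ x in annulus d p q, f x =
      ∫ θ, (∫ r in Ioo p q, r ^ d * f (r • θ)) ∂(unitSphereMeasure d) := by
  have hmp := measurePreserving_polar_annulus (d := d) (p := p) (q := q) hp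
  have hf' : AEStronglyMeasurable f (Measure.map polar (((unitSphereMeasure d).prod
      (volume.restrict (Ioo p q))).withDensity fun z => ENNReal.ofReal (z.2 ^ d))) := by
    rw [hmp.map_eq]
    exact hf.1
  rw [← hmp.map_eq, integral_map measurable_polar.aemeasurable hf',
    integral_withDensity_eq_integral_toReal_smul measurable_ofReal_pow_snd
      (by simp), ← integral_prod _ (integrable_polar_annulus hf hp)]
  refine integral_congr_ae ?_
  have : ∀ᵐ z ∂(unitSphereMeasure d).prod (volume.restrict (Ioo p q)), z.2 ∈ Ioo p q :=
    Measure.quasiMeasurePreserving_snd.ae (ae_restrict_mem measurableSet_Ioo)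
  filter_upwards [this] with z hz
  rw [ENNReal.toReal_ofReal (pow_nonneg (hp.trans hz.1.le) d)]
  rfl

end Integral

/-! ### Measures on spheres -/

theorem sphereMeasure_eq (d : ℕ) (r : ℝ) : sphereMeasure d r =
    ENNReal.ofReal (r ^ d) • (unitSphereMeasure d).map fun θ => r • θ := by
  rw [sphereMeasure, unitSphereMeasure, Measure.map_map (by fun_prop) measurable_subtype_coe]
  rfl

theorem measurableEmbedding_smul {r : ℝ} (hr : r ≠ 0) :
    MeasurableEmbedding fun x : Space d => r • x := measurableEmbedding_const_smul₀ hr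

theorem integral_sphereMeasure {r : ℝ} (hr : 0 < r) (f : Space d → ℝ) :
    ∫ x, f x ∂(sphereMeasure d r) = r ^ d * ∫ θ, f (r • θ) ∂(unitSphereMeasure d) := by
  rw [sphereMeasure_eq, integral_smul_measure, (measurableEmbedding_smul hr.ne').integral_map,
    ENNReal.toReal_ofReal (by positivity), smul_eq_mul]

theorem integrable_sphereMeasure {r : ℝ} (hr : 0 < r) {f : Space d → ℝ} :
    Integrable f (sphereMeasure d r) ↔ Integrable (fun θ => f (r • θ)) (unitSphereMeasure d) := by
  rw [sphereMeasure_eq, integrable_smul_measure (by simp [hr]) (by simp),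
    (measurableEmbedding_smul hr.ne').integrable_map_iff]
  rfl

theorem ae_sphereMeasure {r : ℝ} (hr : 0 < r) {P : Space d → Prop} :
    (∀ᵐ x ∂(sphereMeasure d r), P x) ↔ ∀ᵐ θ ∂(unitSphereMeasure d), P (r • θ) := by
  rw [sphereMeasure_eq, Measure.ae_ennreal_smul_measure_iff (by simp [hr]),
    (measurableEmbedding_smul hr.ne').ae_map_iff]

/-- A direction with vanishing last coordinate has its whole ray in the thin space. Since the thin
space is null, almost every ray meets it in a null set of radii. -/
theorem ae_unitSphere_lastCoord_ne_zero : ∀ᵐ θ ∂(unitSphereMeasure d), lastCoord θ ≠ 0 := by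
  filter_upwards [ae_polar (ae_lastCoord_ne_zero (d := d))] with θ hθ h0
  have : ∀ᵐ r : ℝ, ¬ 0 < r := by
    filter_upwards [hθ] with r hr hr0
    exact hr hr0 (by rw [lastCoord_smul, h0, mul_zero])
  have h2 : volume (Ioi (0 : ℝ)) = 0 := by
    rw [ae_iff] at this
    simp only [not_not] at this
    exact this
  rw [Real.volume_Ioi] at h2
  exact ENNReal.top_ne_zero h2

theorem ae_sphereMeasure_lastCoord_ne_zero {r : ℝ} (hr : 0 < r) :
    ∀ᵐ x ∂(sphereMeasure d r), lastCoord x ≠ 0 := by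
  rw [ae_sphereMeasure hr]
  filter_upwards [ae_unitSphere_lastCoord_ne_zero] with θ hθ
  rw [lastCoord_smul]
  exact mul_ne_zero hr.ne' hθ

/-- By Fubini's theorem in polar coordinates the weight is integrable on some sphere of radius
between `1/2` and 1, and homogeneity carries this over to the unit sphere. -/
theorem integrable_weight_unitSphere {b : ℝ} (hb : -1 < b) :
    Integrable (weight b) (unitSphereMeasure d) := by
  have h1 : IntegrableOn (weight b) (annulus d (1 / 2) 1) :=
    (integrableOn_weight hb 1).mono_set (annulus_subset_ball _ _)
  have h2 := (integrable_polar_annulus h1 (by norm_num)).prod_left_ae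
  have hne : volume.restrict (Ioo (1 / 2 : ℝ) 1) ≠ 0 := by
    rw [Ne, Measure.restrict_eq_zero]
    norm_num
  have : NeZero (volume.restrict (Ioo (1 / 2 : ℝ) 1)) := ⟨hne⟩
  obtain ⟨r, hr, hr'⟩ := (h2.and (ae_restrict_mem measurableSet_Ioo)).exists
  have hr0 : 0 < r := by linarith [hr'.1]
  simp only [weight_smul b hr0.le] at hr
  have := hr.const_mul ((r ^ d * r ^ b)⁻¹)
  refine this.congr (Eventually.of_forall fun θ => ?_)
  have h3 : r ^ b ≠ 0 := (Real.rpow_pos_of_pos hr0 b).ne'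
  field_simp

theorem integrable_weight_sphereMeasure {b : ℝ} (hb : -1 < b) {r : ℝ} (hr : 0 < r) :
    Integrable (weight b) (sphereMeasure d r) := by
  rw [integrable_sphereMeasure hr]
  simp only [weight_smul b hr.le]
  exact (integrable_weight_unitSphere hb).const_mul _

/-! ### Absolutely continuous representatives on rays -/

/-- The integrand of the formula for the value of a function in the middle of a ray. -/
noncomputable def rayIntegrand (u : Space d → ℝ) (G : Space d → Space d) (θ : Space d) (s : ℝ) : ℝ :=
  4 * u (s • θ) + (4 * s - 1) * inner ℝ (G (s • θ)) θ

/-- The value at `r θ` of the representative of `u` that is absolutely continuous on rays. -/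
noncomputable def rayValue (u : Space d → ℝ) (G : Space d → Space d) (θ : Space d) (r : ℝ) : ℝ :=
  (∫ s in (1 / 4 : ℝ)..(1 / 2), rayIntegrand u G θ s) +
    ∫ t in (1 / 2 : ℝ)..r, inner ℝ (G (t • θ)) θ

theorem hasDerivAt_ray {f : Space d → ℝ} (hf : ContDiff ℝ 1 f) (θ : Space d) (t : ℝ) :
    HasDerivAt (fun t : ℝ => f (t • θ)) (inner ℝ (∇ f (t • θ)) θ) t := by
  have h1 : HasDerivAt (fun t : ℝ => t • θ) θ t := by
    simpa using (hasDerivAt_id t).smul_const θ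
  have : HasDerivAt (fun t : ℝ => f (t • θ)) (fderiv ℝ f (t • θ) θ) t :=
    (hf.differentiable (by norm_num)).differentiableAt.hasFDerivAt.comp_hasDerivAt t h1
  rwa [← inner_gradient_left] at this

theorem continuous_ray_gradient {f : Space d → ℝ} (hf : ContDiff ℝ 1 f) (θ : Space d) :
    Continuous fun t : ℝ => (inner ℝ (∇ f (t • θ)) θ : ℝ) :=
  ((continuous_gradient hf).comp (by fun_prop)).inner continuous_const

theorem continuous_rayIntegrand {f : Space d → ℝ} (hf : ContDiff ℝ 1 f) (θ : Space d) :
    Continuous (rayIntegrand f (∇ f) θ) := by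
  have h1 := continuous_ray_gradient hf θ
  have h2 : Continuous fun t : ℝ => f (t • θ) := hf.continuous.comp (by fun_prop)
  unfold rayIntegrand
  fun_prop

/-- The first integrand is the derivative of `(4s - 1) f(sθ)`, whose factor is 0 at `s = 1/4` and 1
at `s = 1/2`; it yields the value at `θ / 2`. The second integral is the increment from there to
`rθ`. -/
theorem rayValue_gradient {f : Space d → ℝ} (hf : ContDiff ℝ 1 f) (θ : Space d) (r : ℝ) :
    rayValue f (∇ f) θ r = f (r • θ) := by
  have h1 := continuous_ray_gradient hf θ
  have e1 : ∫ t in (1 / 2 : ℝ)..r, inner ℝ (∇ f (t • θ)) θ = f (r • θ) - f ((1 / 2 : ℝ) • θ) :=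
    intervalIntegral.integral_eq_sub_of_hasDerivAt (fun t _ => hasDerivAt_ray hf θ t)
      (h1.intervalIntegrable _ _)
  have hd : ∀ s, HasDerivAt (fun s : ℝ => (4 * s - 1) * f (s • θ)) (rayIntegrand f (∇ f) θ s) s := by
    intro s
    have h2 : HasDerivAt (fun s : ℝ => 4 * s - 1) 4 s := by
      simpa using ((hasDerivAt_id s).const_mul 4).sub_const 1
    exact h2.mul (hasDerivAt_ray hf θ s)
  have e2 := intervalIntegral.integral_eq_sub_of_hasDerivAt (a := 1 / 4) (b := 1 / 2)
    (fun s _ => hd s) ((continuous_rayIntegrand hf θ).intervalIntegrable _ _)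
  rw [rayValue, e1, e2]
  norm_num

/-- The mass of a pair on a part of a ray. -/
noncomputable def rayMass (u : Space d → ℝ) (G : Space d → Space d) (p q : ℝ) (θ : Space d) :
    ENNReal := ∫⁻ t in Ioo p q, (‖u (t • θ)‖ₑ + ‖G (t • θ)‖ₑ)

section Bounds

variable {u : Space d → ℝ} {G : Space d → Space d} {p q : ℝ} {θ : Space d}

theorem enorm_ray_inner_le (hθ : ‖θ‖ = 1) (t : ℝ) :
    ‖(inner ℝ (G (t • θ)) θ : ℝ)‖ₑ ≤ ‖u (t • θ)‖ₑ + ‖G (t • θ)‖ₑ := by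
  have : ‖(inner ℝ (G (t • θ)) θ : ℝ)‖ ≤ ‖G (t • θ)‖ := by
    simpa [hθ] using norm_inner_le_norm (𝕜 := ℝ) (G (t • θ)) θ
  exact (enorm_le_iff_norm_le.2 this).trans le_add_self

theorem enorm_rayIntegrand_le (hθ : ‖θ‖ = 1) {s : ℝ} (hs : s ∈ Icc (1 / 4 : ℝ) (1 / 2)) :
    ‖rayIntegrand u G θ s‖ₑ ≤ 4 * (‖u (s • θ)‖ₑ + ‖G (s • θ)‖ₑ) := by
  have h1 : ‖(inner ℝ (G (s • θ)) θ : ℝ)‖ ≤ ‖G (s • θ)‖ := by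
    simpa [hθ] using norm_inner_le_norm (𝕜 := ℝ) (G (s • θ)) θ
  have h2 : ‖4 * s - 1‖ ≤ 1 := by
    rw [Real.norm_eq_abs, abs_le]
    constructor <;> linarith [hs.1, hs.2]
  have h : ‖rayIntegrand u G θ s‖ ≤ 4 * (‖u (s • θ)‖ + ‖G (s • θ)‖) := by
    refine (norm_add_le _ _).trans ?_
    rw [norm_mul, norm_mul, Real.norm_of_nonneg (by norm_num : (0 : ℝ) ≤ 4)]
    nlinarith [norm_nonneg (G (s • θ)), norm_nonneg (inner ℝ (G (s • θ)) θ : ℝ),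
      norm_nonneg (4 * s - 1)]
  rw [← ofReal_norm, ← ofReal_norm, ← ofReal_norm, ← ENNReal.ofReal_add (norm_nonneg _)
    (norm_nonneg _), show (4 : ENNReal) = ENNReal.ofReal 4 by simp, ← ENNReal.ofReal_mul (by norm_num)]
  exact ENNReal.ofReal_le_ofReal h

/-- The constant is `4 + 1`, for the averaged value at the middle and for the increment. The
conditions on `p` and `q` put both integration ranges inside the segment. -/
theorem enorm_rayValue_le (hθ : ‖θ‖ = 1) (hp : p < 1 / 4) (hq : 1 / 2 < q) {r : ℝ}
    (hr : r ∈ Ioo p q) : ‖rayValue u G θ r‖ₑ ≤ 5 * rayMass u G p q θ := by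
  have h1 : ‖∫ s in (1 / 4 : ℝ)..(1 / 2), rayIntegrand u G θ s‖ₑ ≤ 4 * rayMass u G p q θ := by
    rw [intervalIntegral.integral_of_le (by norm_num), rayMass,
      ← lintegral_const_mul' _ _ (by norm_num)]
    refine (enorm_integral_le_lintegral_enorm _).trans ?_
    refine (setLIntegral_mono_ae' measurableSet_Ioc (Eventually.of_forall fun s hs =>
      enorm_rayIntegrand_le hθ ⟨hs.1.le, hs.2⟩)).trans ?_
    exact lintegral_mono_set fun s hs => ⟨hp.trans hs.1, hs.2.trans_lt hq⟩
  have h2 : ‖∫ t in (1 / 2 : ℝ)..r, inner ℝ (G (t • θ)) θ‖ₑ ≤ rayMass u G p q θ := by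
    rw [← ofReal_norm, intervalIntegral.norm_intervalIntegral_eq, ofReal_norm]
    refine (enorm_integral_le_lintegral_enorm _).trans ?_
    refine (lintegral_mono fun t => enorm_ray_inner_le (u := u) hθ t).trans ?_
    refine lintegral_mono_set fun t ht => ?_
    rw [uIoc, mem_Ioc, inf_lt_iff, le_sup_iff] at ht
    constructor
    · rcases ht.1 with h | h <;> linarith [hr.1]
    · rcases ht.2 with h | h <;> linarith [hr.2]
  calc _ ≤ 4 * rayMass u G p q θ + rayMass u G p q θ := (enorm_add_le _ _).trans (add_le_add h1 h2)
    _ = 5 * rayMass u G p q θ := by ring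

/-- On the ring the polar Jacobian is at least `p^d`, so it can be dropped at the cost of a constant
that blows up only at the origin. -/
theorem lintegral_ray_le {g : Space d → ENNReal} (hg : Measurable g) (hp : 0 < p) :
    ∫⁻ θ, (∫⁻ t in Ioo p q, g (t • θ)) ∂(unitSphereMeasure d) ≤
      (ENNReal.ofReal (p ^ d))⁻¹ * ∫⁻ x in annulus d p q, g x := by
  have hpd : ENNReal.ofReal (p ^ d) ≠ 0 := by simp [pow_pos hp]
  rw [lintegral_annulus hg hp.le, ← lintegral_const_mul' _ _ (ENNReal.inv_ne_top.2 hpd)]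
  refine lintegral_mono fun θ => ?_
  rw [← lintegral_const_mul' _ _ (ENNReal.inv_ne_top.2 hpd)]
  refine setLIntegral_mono_ae' measurableSet_Ioo (Eventually.of_forall fun t ht => ?_)
  rw [← mul_assoc]
  refine le_mul_of_one_le_left zero_le ?_
  rw [← ENNReal.inv_mul_cancel hpd ENNReal.ofReal_ne_top]
  gcongr
  exact ht.1.le

theorem measurable_rayMass (hu : Measurable u) (hG : Measurable G) :
    Measurable (rayMass u G p q) := by
  unfold rayMass
  refine Measurable.lintegral_prod_right' (f := fun z : Space d × ℝ =>
    ‖u (z.2 • z.1)‖ₑ + ‖G (z.2 • z.1)‖ₑ) ?_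
  have : Measurable fun z : Space d × ℝ => z.2 • z.1 := by fun_prop
  exact (hu.comp this).enorm.add (hG.comp this).enorm

theorem integrableOn_ray (hu : Measurable u) (hG : Measurable G) (h : rayMass u G p q θ < ⊤)
    (hθ : ‖θ‖ = 1) : IntegrableOn (fun t => u (t • θ)) (Ioo p q) ∧
      IntegrableOn (fun t => (inner ℝ (G (t • θ)) θ : ℝ)) (Ioo p q) := by
  have hm : Measurable fun t : ℝ => t • θ := by fun_prop
  refine ⟨⟨(hu.comp hm).aestronglyMeasurable, ?_⟩,
    ⟨((hG.comp hm).inner measurable_const).aestronglyMeasurable, ?_⟩⟩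
  · rw [hasFiniteIntegral_iff_enorm]
    exact (lintegral_mono fun t => le_self_add).trans_lt h
  · rw [hasFiniteIntegral_iff_enorm]
    exact (lintegral_mono fun t => enorm_ray_inner_le (u := u) hθ t).trans_lt h

theorem rayValue_sub {v : Space d → ℝ} {H : Space d → Space d} (hp : p < 1 / 4) (hq : 1 / 2 < q)
    (hu : IntegrableOn (fun t => u (t • θ)) (Ioo p q))
    (hG : IntegrableOn (fun t => (inner ℝ (G (t • θ)) θ : ℝ)) (Ioo p q))
    (hv : IntegrableOn (fun t => v (t • θ)) (Ioo p q))
    (hH : IntegrableOn (fun t => (inner ℝ (H (t • θ)) θ : ℝ)) (Ioo p q)) {r : ℝ}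
    (hr : r ∈ Ioo p q) : rayValue (fun x => u x - v x) (fun x => G x - H x) θ r =
      rayValue u G θ r - rayValue v H θ r := by
  have hsub : ∀ {x y : ℝ}, x ∈ Ioo p q → y ∈ Ioo p q → uIoc x y ⊆ Ioo p q := by
    intro x y hx hy t ht
    exact ⟨(lt_min hx.1 hy.1).trans ht.1, ht.2.trans_lt (max_lt hx.2 hy.2)⟩
  have hi : ∀ {f : ℝ → ℝ} {x y : ℝ}, IntegrableOn f (Ioo p q) → x ∈ Ioo p q → y ∈ Ioo p q →
      IntervalIntegrable f volume x y := fun hf hx hy =>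
    intervalIntegrable_iff.2 (hf.mono_set (hsub hx hy))
  have m1 : (1 / 4 : ℝ) ∈ Ioo p q := ⟨hp, by linarith⟩
  have m2 : (1 / 2 : ℝ) ∈ Ioo p q := ⟨by linarith, hq⟩
  have hray : ∀ {f : Space d → ℝ} {F : Space d → Space d},
      IntegrableOn (fun t => f (t • θ)) (Ioo p q) →
      IntegrableOn (fun t => (inner ℝ (F (t • θ)) θ : ℝ)) (Ioo p q) →
      IntervalIntegrable (rayIntegrand f F θ) volume (1 / 4) (1 / 2) := fun hf hF =>
    ((hi hf m1 m2).const_mul 4).add ((hi hF m1 m2).continuousOn_mul (by fun_prop))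
  have e1 : rayIntegrand (fun x => u x - v x) (fun x => G x - H x) θ =
      fun s => rayIntegrand u G θ s - rayIntegrand v H θ s := by
    funext s
    simp only [rayIntegrand, inner_sub_left]
    ring
  simp only [rayValue, e1, inner_sub_left]
  rw [intervalIntegral.integral_sub (hray hu hG) (hray hv hH),
    intervalIntegral.integral_sub (hi hG m2 hr) (hi hH m2 hr)]
  ring

end Bounds

/-- On the ray through `θ`, the function `u` is almost everywhere equal to the primitive of its
radial derivative. -/
structure IsRegularRay (u : Space d → ℝ) (G : Space d → Space d) (θ : Space d) : Prop where
  norm_eq_one : ‖θ‖ = 1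
  rayMass_lt_top : ∀ p > 0, rayMass u G p 1 θ < ⊤
  ae_eq : ∀ᵐ r : ℝ, r ∈ Ioo (0 : ℝ) 1 → u (r • θ) = rayValue u G θ r

theorem measurable_rayValue {u : Space d → ℝ} {G : Space d → Space d} (hu : Measurable u)
    (hG : Measurable G) : Measurable fun z : Space d × ℝ => rayValue u G z.1 z.2 := by
  have hm : Measurable fun z : Space d × ℝ => z.2 • z.1 := by fun_prop
  have h1 : Measurable fun z : Space d × ℝ => rayIntegrand u G z.1 z.2 := by
    unfold rayIntegrand
    have := hu.comp hm
    have := (hG.comp hm).inner (𝕜 := ℝ) measurable_fst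
    fun_prop
  have h2 : Measurable fun θ : Space d => ∫ s in (1 / 4 : ℝ)..(1 / 2), rayIntegrand u G θ s := by
    simp only [intervalIntegral.integral_of_le (by norm_num : (1 / 4 : ℝ) ≤ 1 / 2)]
    exact (h1.stronglyMeasurable.integral_prod_right
      (ν := volume.restrict (Ioc (1 / 4 : ℝ) (1 / 2)))).measurable
  have hm' : Measurable fun z : (Space d × ℝ) × ℝ => (inner ℝ (G (z.2 • z.1.1)) z.1.1 : ℝ) :=
    (hG.comp (by fun_prop)).inner (by fun_prop)
  have h3 : Measurable fun z : Space d × ℝ => ∫ t in Ioc (1 / 2) z.2, inner ℝ (G (t • z.1)) z.1 := by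
    simp only [← integral_indicator measurableSet_Ioc]
    have hs : MeasurableSet {z : (Space d × ℝ) × ℝ | z.2 ∈ Ioc (1 / 2) z.1.2} :=
      (measurableSet_lt measurable_const measurable_snd).inter
        (measurableSet_le measurable_snd (measurable_snd.comp measurable_fst))
    exact ((hm'.indicator hs).stronglyMeasurable.integral_prod_right' (ν := volume)).measurable
  have h4 : Measurable fun z : Space d × ℝ => ∫ t in Ioc z.2 (1 / 2), inner ℝ (G (t • z.1)) z.1 := by
    simp only [← integral_indicator measurableSet_Ioc]
    have hs : MeasurableSet {z : (Space d × ℝ) × ℝ | z.2 ∈ Ioc z.1.2 (1 / 2)} :=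
      (measurableSet_lt (measurable_snd.comp measurable_fst) measurable_snd).inter
        (measurableSet_le measurable_snd measurable_const)
    exact ((hm'.indicator hs).stronglyMeasurable.integral_prod_right' (ν := volume)).measurable
  exact (h2.comp measurable_fst).add (h3.sub h4)

theorem IsSobolevPair.lintegral_lt_top {a : ℝ} {u : Space d → ℝ} {G : Space d → Space d}
    (h : IsSobolevPair a u G) (ha : a < 1) : ∫⁻ x in ball 0 1, (‖u x‖ₑ + ‖G x‖ₑ) < ⊤ := by
  rw [lintegral_add_left h.measurable.enorm]
  exact ENNReal.add_lt_top.2 ⟨hasFiniteIntegral_iff_enorm.1 (h.integrableOn ha).2,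
    hasFiniteIntegral_iff_enorm.1 (h.integrableOn_grad ha).2⟩

theorem lintegral_rayMass_le {u : Space d → ℝ} {G : Space d → Space d} (hu : Measurable u)
    (hG : Measurable G) {p q : ℝ} (hp : 0 < p) :
    ∫⁻ θ, rayMass u G p q θ ∂(unitSphereMeasure d) ≤
      (ENNReal.ofReal (p ^ d))⁻¹ * ∫⁻ x in ball 0 q, (‖u x‖ₑ + ‖G x‖ₑ) :=
  (lintegral_ray_le (hu.enorm.add hG.enorm) hp).trans
    (mul_le_mul_right (lintegral_mono_set (annulus_subset_ball p q)) _)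

theorem IsSobolevPair.lintegral_rayMass_lt_top {a : ℝ} {u : Space d → ℝ} {G : Space d → Space d}
    (h : IsSobolevPair a u G) (ha : a < 1) {p : ℝ} (hp : 0 < p) :
    ∫⁻ θ, rayMass u G p 1 θ ∂(unitSphereMeasure d) < ⊤ := by
  have hpd : ENNReal.ofReal (p ^ d) ≠ 0 := by simp [pow_pos hp]
  exact (lintegral_rayMass_le h.measurable h.measurable_grad hp).trans_lt
    (ENNReal.mul_lt_top (ENNReal.inv_lt_top.2 (pos_iff_ne_zero.2 hpd)) (h.lintegral_lt_top ha))

theorem rayMass_anti {u : Space d → ℝ} {G : Space d → Space d} {p p' q q' : ℝ} (hp : p' ≤ p)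
    (hq : q ≤ q') (θ : Space d) : rayMass u G p q θ ≤ rayMass u G p' q' θ :=
  lintegral_mono_set (Ioo_subset_Ioo hp hq)

theorem IsSobolevPair.ae_rayMass_lt_top {a : ℝ} {u : Space d → ℝ} {G : Space d → Space d}
    (h : IsSobolevPair a u G) (ha : a < 1) :
    ∀ᵐ θ ∂(unitSphereMeasure d), ∀ p > 0, rayMass u G p 1 θ < ⊤ := by
  have h1 : ∀ n : ℕ, ∀ᵐ θ ∂(unitSphereMeasure d), rayMass u G (1 / ((n : ℝ) + 1)) 1 θ < ⊤ :=
    fun n => ae_lt_top (measurable_rayMass h.measurable h.measurable_grad)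
      (h.lintegral_rayMass_lt_top ha (by positivity)).ne
  filter_upwards [ae_all_iff.2 h1] with θ hθ p hp
  obtain ⟨n, hn⟩ := exists_nat_one_div_lt hp
  exact (rayMass_anti hn.le le_rfl θ).trans_lt (hθ n)

/-- For a `C¹` approximation the ray formula returns the function itself, and by linearity the error
of the formula for `u` is controlled by the `rayMass` of the differences. This tends to zero after
integration over the sphere. The constant 6 in `key` is 1 for `u` itself and 5 for the ray formula.
-/
theorem IsSobolevPair.ae_eq_rayValue_of_mem {a : ℝ} {u : Space d → ℝ} {G : Space d → Space d}
    (h : IsSobolevPair a u G) (ha : a < 1) {p q : ℝ} (hp : 0 < p) (hp' : p < 1 / 4)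
    (hq : 1 / 2 < q) (hq' : q < 1) :
    ∀ᵐ θ ∂(unitSphereMeasure d), ∀ᵐ r : ℝ, r ∈ Ioo p q → u (r • θ) = rayValue u G θ r := by
  obtain ⟨f, hf, hfu, hfG⟩ := h.isWeakGradient.isSmoothlyApproximable q hq'
  have hm : Measurable fun z : Space d × ℝ => ‖u (z.2 • z.1) - rayValue u G z.1 z.2‖ₑ :=
    ((h.measurable.comp (by fun_prop)).sub
      (measurable_rayValue h.measurable h.measurable_grad)).enorm
  have hfm : ∀ k, Measurable (f k) := fun k => (hf k).continuous.measurable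
  have hgm : ∀ k, Measurable (∇ (f k)) := fun k => (continuous_gradient (hf k)).measurable
  have key : ∀ k, ∫⁻ θ, (∫⁻ r in Ioo p q, ‖u (r • θ) - rayValue u G θ r‖ₑ) ∂(unitSphereMeasure d) ≤
      6 * ((ENNReal.ofReal (p ^ d))⁻¹ *
        ((∫⁻ x in ball 0 q, ‖f k x - u x‖ₑ) + ∫⁻ x in ball 0 q, ‖∇ (f k) x - G x‖ₑ)) := by
    intro k
    have d1 : Measurable fun x => f k x - u x := (hfm k).sub h.measurable
    have d2 : Measurable fun x => ∇ (f k) x - G x := (hgm k).sub h.measurable_grad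
    have hb := lintegral_rayMass_le (q := q) d1 d2 hp
    rw [lintegral_add_left d1.enorm] at hb
    refine le_trans ?_ (mul_le_mul_right hb 6)
    rw [← lintegral_const_mul _ (measurable_rayMass d1 d2)]
    refine lintegral_mono_ae ?_
    filter_upwards [h.ae_rayMass_lt_top ha, ae_norm_eq_one] with θ hθ hθ1
    have i1 := integrableOn_ray h.measurable h.measurable_grad
      ((rayMass_anti le_rfl hq'.le θ).trans_lt (hθ p hp)) hθ1
    have i2 : IntegrableOn (fun t : ℝ => f k (t • θ)) (Ioo p q) :=
      (((hf k).continuous.comp (by fun_prop : Continuous fun t : ℝ => t • θ)).integrableOn_Icc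
        (a := p) (b := q)).mono_set Ioo_subset_Icc_self
    have i3 : IntegrableOn (fun t : ℝ => (inner ℝ (∇ (f k) (t • θ)) θ : ℝ)) (Ioo p q) :=
      ((continuous_ray_gradient (hf k) θ).integrableOn_Icc (a := p) (b := q)).mono_set
        Ioo_subset_Icc_self
    set R := rayMass (fun x => f k x - u x) (fun x => ∇ (f k) x - G x) p q θ with hR
    have hpt : ∀ r ∈ Ioo p q, ‖u (r • θ) - rayValue u G θ r‖ₑ ≤
        ‖f k (r • θ) - u (r • θ)‖ₑ + 5 * R := by
      intro r hr
      have e := rayValue_sub hp' hq i2 i3 i1.1 i1.2 hr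
      rw [rayValue_gradient (hf k)] at e
      have e' : u (r • θ) - rayValue u G θ r = -(f k (r • θ) - u (r • θ)) +
          rayValue (fun x => f k x - u x) (fun x => ∇ (f k) x - G x) θ r := by
        rw [e]
        ring
      rw [e']
      refine (enorm_add_le _ _).trans ?_
      rw [enorm_neg]
      exact add_le_add le_rfl (enorm_rayValue_le hθ1 hp' hq hr)
    refine (setLIntegral_mono_ae' measurableSet_Ioo (Eventually.of_forall hpt)).trans ?_
    rw [lintegral_add_right _ measurable_const]
    have e1 : ∫⁻ r in Ioo p q, ‖f k (r • θ) - u (r • θ)‖ₑ ≤ R := lintegral_mono fun r => le_self_add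
    have e2 : ∫⁻ _ in Ioo p q, 5 * R ≤ 5 * R := by
      rw [setLIntegral_const, Real.volume_Ioo]
      refine mul_le_of_le_one_right zero_le ?_
      rw [← ENNReal.ofReal_one]
      exact ENNReal.ofReal_le_ofReal (by linarith)
    calc _ ≤ R + 5 * R := add_le_add e1 e2
      _ = 6 * R := by ring
  have hpd : ENNReal.ofReal (p ^ d) ≠ 0 := by simp [pow_pos hp]
  have hlim := ENNReal.Tendsto.const_mul (a := 6) (ENNReal.Tendsto.const_mul
    (a := (ENNReal.ofReal (p ^ d))⁻¹) (hfu.add hfG) (Or.inr (ENNReal.inv_ne_top.2 hpd)))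
    (Or.inr (by norm_num))
  simp only [add_zero, mul_zero] at hlim
  have hz := le_antisymm (ge_of_tendsto' hlim key) zero_le
  rw [lintegral_eq_zero_iff hm.lintegral_prod_right'] at hz
  filter_upwards [hz] with θ hθ
  have hmθ : Measurable fun r : ℝ => ‖u (r • θ) - rayValue u G θ r‖ₑ :=
    hm.comp (measurable_const.prodMk measurable_id)
  have := (lintegral_eq_zero_iff hmθ).1 hθ
  filter_upwards [(ae_restrict_iff' measurableSet_Ioo).1 this] with r hr hrm
  have := hr hrm
  simpa [sub_eq_zero] using this

theorem IsSobolevPair.ae_isRegularRay {a : ℝ} {u : Space d → ℝ} {G : Space d → Space d}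
    (h : IsSobolevPair a u G) (ha : a < 1) : ∀ᵐ θ ∂(unitSphereMeasure d), IsRegularRay u G θ := by
  -- The shifts by 5 and 3 keep `p` below `1/4` and `q` above `1/2` for every `n`; the intervals
  -- exhaust `(0, 1)`.
  have h1 := fun n : ℕ => h.ae_eq_rayValue_of_mem ha (p := 1 / ((n : ℝ) + 5))
    (q := 1 - 1 / ((n : ℝ) + 3)) (by positivity)
    (one_div_lt_one_div_of_lt (by norm_num) (by linarith [(Nat.cast_nonneg n : (0 : ℝ) ≤ n)]))
    (by
      have : 1 / ((n : ℝ) + 3) < 1 / 2 :=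
        one_div_lt_one_div_of_lt (by norm_num) (by linarith [(Nat.cast_nonneg n : (0 : ℝ) ≤ n)])
      linarith)
    (by linarith [(by positivity : (0 : ℝ) < 1 / ((n : ℝ) + 3))])
  filter_upwards [ae_all_iff.2 h1, h.ae_rayMass_lt_top ha, ae_norm_eq_one] with θ hθ hθ2 hθ1
  refine ⟨hθ1, hθ2, ?_⟩
  filter_upwards [ae_all_iff.2 hθ] with r hr hr01
  obtain ⟨n, hn⟩ := exists_nat_one_div_lt (lt_min hr01.1 (sub_pos.2 hr01.2))
  refine hr n ⟨?_, ?_⟩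
  · refine lt_of_le_of_lt ?_ (hn.trans_le (min_le_left _ _))
    exact one_div_le_one_div_of_le (by positivity) (by linarith)
  · have : 1 / ((n : ℝ) + 3) < 1 - r := by
      refine lt_of_le_of_lt ?_ (hn.trans_le (min_le_right _ _))
      exact one_div_le_one_div_of_le (by positivity) (by linarith)
    linarith

/-- Cauchy-Schwarz on the segment, whose length is at most 1 when nonempty, bounds the squared mass
by the mass of the square. For `p < t < 1` and `a < 1` one has `t^a ≥ t > p`, so `w(θ) ≤ p⁻¹ w(tθ)`,
and the result is a weighted `L²` norm over a ring. -/
theorem IsSobolevPair.lintegral_rayMass_sq_lt_top {a : ℝ} {u : Space d → ℝ} {G : Space d → Space d}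
    (h : IsSobolevPair a u G) (ha : a < 1) {p : ℝ} (hp : 0 < p) :
    ∫⁻ θ, rayMass u G p 1 θ ^ 2 * ENNReal.ofReal (weight a θ) ∂(unitSphereMeasure d) < ⊤ := by
  set g : Space d → ENNReal := fun x => (‖u x‖ₑ + ‖G x‖ₑ) ^ 2 * ENNReal.ofReal (weight a x) with hg
  have hgm : Measurable g := ((h.measurable.enorm.add h.measurable_grad.enorm).pow_const 2).mul
    (measurable_weight a).ennreal_ofReal
  have hpd : ENNReal.ofReal (p ^ d) ≠ 0 := by simp [pow_pos hp]
  have hfin : ENNReal.ofReal p⁻¹ * ((ENNReal.ofReal (p ^ d))⁻¹ * ∫⁻ x in annulus d p 1, g x) < ⊤ :=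
    ENNReal.mul_lt_top ENNReal.ofReal_lt_top (ENNReal.mul_lt_top
      (ENNReal.inv_lt_top.2 (pos_iff_ne_zero.2 hpd))
      ((lintegral_mono_set (annulus_subset_ball p 1)).trans_lt h.lintegral_sq_lt_top))
  refine lt_of_le_of_lt ?_ hfin
  refine le_trans ?_ (mul_le_mul_right (lintegral_ray_le hgm hp) _)
  rw [← lintegral_const_mul' _ _ ENNReal.ofReal_ne_top]
  refine lintegral_mono fun θ => ?_
  rw [← lintegral_const_mul' _ _ ENNReal.ofReal_ne_top]
  have hm : Measurable fun t : ℝ => ‖u (t • θ)‖ₑ + ‖G (t • θ)‖ₑ :=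
    (h.measurable.enorm.add h.measurable_grad.enorm).comp (by fun_prop : Measurable fun t : ℝ => t • θ)
  have h1 : rayMass u G p 1 θ ^ 2 ≤ ∫⁻ t in Ioo p 1, (‖u (t • θ)‖ₑ + ‖G (t • θ)‖ₑ) ^ 2 := by
    have := sq_lintegral_le (μ := volume.restrict (Ioo p 1)) (w := fun _ => 1)
      hm.aemeasurable aemeasurable_const (by simp) (by simp)
    refine this.trans ?_
    simp only [mul_one, inv_one, lintegral_const, Measure.restrict_apply_univ, Real.volume_Ioo,
      one_mul]
    refine mul_le_of_le_one_right zero_le ?_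
    rw [← ENNReal.ofReal_one]
    exact ENNReal.ofReal_le_ofReal (by linarith)
  refine (mul_le_mul_left h1 _).trans ?_
  rw [← lintegral_mul_const _ (hm.pow_const 2)]
  refine setLIntegral_mono_ae' measurableSet_Ioo (Eventually.of_forall fun t ht => ?_)
  have ht0 : 0 < t := hp.trans ht.1
  have h2 : weight a θ ≤ p⁻¹ * weight a (t • θ) := by
    rw [weight_smul a ht0.le, ← mul_assoc]
    refine le_mul_of_one_le_left (weight_nonneg a θ) ?_
    have h3 : t ≤ t ^ a := by
      simpa using Real.rpow_le_rpow_of_exponent_ge ht0 ht.2.le ha.le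
    rw [← inv_mul_cancel₀ hp.ne']
    exact mul_le_mul_of_nonneg_left (ht.1.le.trans h3) (inv_nonneg.2 hp.le)
  rw [hg, mul_left_comm, ← ENNReal.ofReal_mul (inv_nonneg.2 hp.le)]
  exact mul_le_mul_right (ENNReal.ofReal_le_ofReal h2) _

/-- The representative of `u` that is absolutely continuous on rays. -/
noncomputable def sphereValue (u : Space d → ℝ) (G : Space d → Space d) (x : Space d) : ℝ :=
  rayValue u G (‖x‖⁻¹ • x) ‖x‖

theorem sphereValue_smul (u : Space d → ℝ) (G : Space d → Space d) {θ : Space d} (hθ : ‖θ‖ = 1)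
    {r : ℝ} (hr : 0 < r) : sphereValue u G (r • θ) = rayValue u G θ r := by
  rw [sphereValue, norm_smul, hθ, mul_one, Real.norm_of_nonneg hr.le, smul_smul,
    inv_mul_cancel₀ hr.ne', one_smul]

theorem measurable_sphereValue {u : Space d → ℝ} {G : Space d → Space d} (hu : Measurable u)
    (hG : Measurable G) : Measurable (sphereValue u G) := by
  have h1 : Measurable fun x : Space d => ‖x‖⁻¹ • x := measurable_norm.inv.smul measurable_id
  have h2 : Measurable fun x : Space d => (‖x‖⁻¹ • x, ‖x‖) := h1.prodMk measurable_norm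
  have h3 := (measurable_rayValue hu hG).comp h2
  exact h3

theorem exists_lt_quarter {r : ℝ} (hr : 0 < r) : ∃ p, 0 < p ∧ p < 1 / 4 ∧ p < r :=
  ⟨min (1 / 8) (r / 2), lt_min (by norm_num) (by linarith),
    (min_le_left _ _).trans_lt (by norm_num), (min_le_right _ _).trans_lt (by linarith)⟩

theorem IsSobolevPair.integrable_rayValue_sq {a : ℝ} {u : Space d → ℝ} {G : Space d → Space d}
    (h : IsSobolevPair a u G) (ha : a < 1) {r : ℝ} (hr : r ∈ Ioo (0 : ℝ) 1) :
    Integrable (fun θ => rayValue u G θ r ^ 2 * weight a θ) (unitSphereMeasure d) := by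
  obtain ⟨p, hp, hp4, hpr⟩ := exists_lt_quarter hr.1
  have hm : Measurable fun θ : Space d => rayValue u G θ r :=
    (measurable_rayValue h.measurable h.measurable_grad).comp
      (measurable_id.prodMk measurable_const)
  refine ⟨((hm.pow_const 2).mul (measurable_weight a)).aestronglyMeasurable, ?_⟩
  rw [hasFiniteIntegral_iff_enorm]
  have hfin := ENNReal.mul_lt_top (a := 25) (by norm_num) (h.lintegral_rayMass_sq_lt_top ha hp)
  refine lt_of_le_of_lt ?_ hfin
  rw [← lintegral_const_mul' _ _ (by norm_num)]
  refine lintegral_mono_ae ?_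
  filter_upwards [ae_norm_eq_one] with θ hθ
  have e : rayValue u G θ r ^ 2 = ‖rayValue u G θ r‖ ^ 2 := by rw [Real.norm_eq_abs, sq_abs]
  rw [e, enorm_sq_mul_ofReal_weight, ← mul_assoc]
  refine mul_le_mul_left ?_ _
  calc ‖rayValue u G θ r‖ₑ ^ 2 ≤ (5 * rayMass u G p 1 θ) ^ 2 :=
        pow_le_pow_left' (enorm_rayValue_le hθ hp4 (by norm_num) ⟨hpr, hr.2⟩) 2
    _ = 25 * rayMass u G p 1 θ ^ 2 := by ring

namespace IsRegularRay

variable {u : Space d → ℝ} {G : Space d → Space d} {θ : Space d}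

theorem intervalIntegrable (h : IsRegularRay u G θ) (hu : Measurable u) (hG : Measurable G)
    {x y : ℝ} (hx : x ∈ Ioc (0 : ℝ) 1) (hy : y ∈ Ioc (0 : ℝ) 1) :
    IntervalIntegrable (fun t => (inner ℝ (G (t • θ)) θ : ℝ)) volume x y := by
  have hp : 0 < min x y := lt_min hx.1 hy.1
  have h1 := (integrableOn_ray hu hG (h.rayMass_lt_top _ hp) h.norm_eq_one).2
  rw [← integrableOn_Ioc_iff_integrableOn_Ioo] at h1
  exact intervalIntegrable_iff.2 (h1.mono_set fun t ht => ⟨ht.1, ht.2.trans (max_le hx.2 hy.2)⟩)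

theorem absolutelyContinuous_rayValue (h : IsRegularRay u G θ) (hu : Measurable u)
    (hG : Measurable G) {p q : ℝ} (hp : p ∈ Ioo (0 : ℝ) 1) (hq : q ∈ Ioo (0 : ℝ) 1) :
    AbsolutelyContinuousOnInterval (rayValue u G θ) p q := by
  have hmin : min (min p q) (1 / 2) ∈ Ioc (0 : ℝ) 1 :=
    ⟨lt_min (lt_min hp.1 hq.1) (by norm_num), (min_le_right _ _).trans (by norm_num)⟩
  have h1 := (h.intervalIntegrable hu hG hmin (right_mem_Ioc.2 zero_lt_one)
    ).absolutelyContinuousOnInterval_intervalIntegral (c := 1 / 2)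
    ⟨(inf_le_left).trans (min_le_right _ _), le_sup_of_le_right (by norm_num)⟩
  have h2 : AbsolutelyContinuousOnInterval
      (fun _ : ℝ => ∫ s in (1 / 4 : ℝ)..(1 / 2), rayIntegrand u G θ s) p q :=
    contDiff_const.contDiffOn.absolutelyContinuousOnInterval
  refine h2.fun_add (h1.mono ?_)
  refine uIcc_subset_uIcc ?_ ?_
  · exact ⟨inf_le_of_left_le ((min_le_left _ _).trans (min_le_left _ _)),
      le_sup_of_le_right hp.2.le⟩
  · exact ⟨inf_le_of_left_le ((min_le_left _ _).trans (min_le_right _ _)),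
      le_sup_of_le_right hq.2.le⟩

theorem continuousOn_rayValue (h : IsRegularRay u G θ) (hu : Measurable u) (hG : Measurable G) :
    ContinuousOn (rayValue u G θ) (Ioo 0 1) := by
  intro r hr
  have hp : r / 2 ∈ Ioo (0 : ℝ) 1 := ⟨by linarith [hr.1], by linarith [hr.1, hr.2]⟩
  have hq : (1 + r) / 2 ∈ Ioo (0 : ℝ) 1 := ⟨by linarith [hr.1], by linarith [hr.2]⟩
  have h1 := (h.absolutelyContinuous_rayValue hu hG hp hq).continuousOn
  rw [uIcc_of_le (by linarith [hr.1, hr.2])] at h1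
  exact (h1.continuousAt (Icc_mem_nhds (by linarith [hr.1]) (by linarith [hr.2]))).continuousWithinAt

theorem ae_hasDerivAt_rayValue (h : IsRegularRay u G θ) (hu : Measurable u) (hG : Measurable G) :
    ∀ᵐ r : ℝ, r ∈ Ioo (0 : ℝ) 1 → HasDerivAt (rayValue u G θ) (inner ℝ (G (r • θ)) θ) r := by
  have h1 : ∀ n : ℕ, _ := fun n => (h.intervalIntegrable hu hG (x := 1 / ((n : ℝ) + 2)) (y := 1)
    ⟨by positivity, by rw [div_le_one (by positivity)]; linarith [(Nat.cast_nonneg n : (0:ℝ) ≤ n)]⟩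
    (right_mem_Ioc.2 zero_lt_one)).ae_hasDerivAt_integral
  filter_upwards [ae_all_iff.2 h1] with r hr hr01
  obtain ⟨n, hn⟩ := exists_nat_one_div_lt hr01.1
  have hn2 : 1 / ((n : ℝ) + 2) ≤ 1 / ((n : ℝ) + 1) :=
    one_div_le_one_div_of_le (by positivity) (by linarith)
  have hle : 1 / ((n : ℝ) + 2) ≤ 1 / 2 :=
    one_div_le_one_div_of_le (by norm_num) (by linarith [(Nat.cast_nonneg n : (0 : ℝ) ≤ n)])
  have hu' : uIcc (1 / ((n : ℝ) + 2)) 1 = Icc (1 / ((n : ℝ) + 2)) 1 := uIcc_of_le (by linarith)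
  have := hr n (by rw [hu']; exact ⟨by linarith, hr01.2.le⟩) (1 / 2)
    (by rw [hu']; exact ⟨hle, by norm_num⟩)
  exact this.const_add _

/-- The growth of the square of the scaled values on a ray. -/
theorem scaled_sq_sub (h : IsRegularRay u G θ) (hu : Measurable u) (hG : Measurable G) (κ : ℝ)
    {p q : ℝ} (hp : 0 < p) (hpq : p ≤ q) (hq : q < 1) :
    (q ^ (-κ) * rayValue u G θ q) ^ 2 - (p ^ (-κ) * rayValue u G θ p) ^ 2 =
      ∫ r in Ioo p q, 2 * (r ^ (-(2 * κ) - 1) *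
        (u (r • θ) * (r * inner ℝ (G (r • θ)) θ - κ * u (r • θ)))) := by
  have hp1 : p ∈ Ioo (0 : ℝ) 1 := ⟨hp, hpq.trans_lt hq⟩
  have hq1 : q ∈ Ioo (0 : ℝ) 1 := ⟨hp.trans_le hpq, hq⟩
  have h1 := h.absolutelyContinuous_rayValue hu hG hp1 hq1
  have h2 : AbsolutelyContinuousOnInterval (fun r : ℝ => r ^ (-κ)) p q := by
    refine ContDiffOn.absolutelyContinuousOnInterval fun r hr => ?_
    rw [uIcc_of_le hpq] at hr
    exact (Real.contDiffAt_rpow_const_of_ne (hp.trans_le hr.1).ne').contDiffWithinAt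
  have h3 := h2.fun_mul h1
  -- Products of absolutely continuous functions are absolutely continuous, so the fundamental
  -- theorem of calculus applies to the square of the scaled value.
  have h4 := h3.fun_mul h3
  have h5 := h4.integral_deriv_eq_sub
  simp only [← pow_two] at h5
  rw [← h5, intervalIntegral.integral_of_le hpq, integral_Ioc_eq_integral_Ioo]
  refine setIntegral_congr_ae measurableSet_Ioo ?_
  filter_upwards [h.ae_hasDerivAt_rayValue hu hG, h.ae_eq] with r hr1 hr2 hr
  have hr0 : 0 < r := hp.trans hr.1
  have hr01 : r ∈ Ioo (0 : ℝ) 1 := ⟨hr0, hr.2.trans hq⟩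
  have d1 := Real.hasDerivAt_rpow_const (p := -κ) (Or.inl hr0.ne')
  have d2 : HasDerivAt (fun r => r ^ (-κ) * rayValue u G θ r) _ r := d1.mul (hr1 hr01)
  rw [(d2.fun_pow 2).deriv, hr2 hr01]
  have e1 : r ^ (-(2 * κ) - 1) = r ^ (-κ) * r ^ (-κ - 1) := by
    rw [← Real.rpow_add hr0]
    congr 1
    ring
  have e2 : r ^ (-κ) = r * r ^ (-κ - 1) := by
    rw [Real.rpow_sub_one hr0.ne']
    field_simp
  rw [e1]
  simp only [Nat.cast_ofNat, Nat.add_one_sub_one, pow_one]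
  rw [e2]
  ring

end IsRegularRay

/-! ### Radial cutoffs and Gauss-Green on balls -/

section Cutoff

variable {r : ℝ} (f : ContDiffBump r)

/-- The smooth cutoff function of `[0, r]` whose derivative is minus a bump function at `r`. -/
noncomputable def cutoff (t : ℝ) : ℝ := ∫ s in t..1, f.normed volume s

theorem hasDerivAt_cutoff (t : ℝ) : HasDerivAt (cutoff f) (-f.normed volume t) t := by
  have h := (f.continuous_normed (μ := volume)).integral_hasStrictDerivAt 1 t |>.hasDerivAt
  have e : cutoff f = fun t => -∫ s in (1 : ℝ)..t, f.normed volume s := by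
    funext t
    rw [cutoff, intervalIntegral.integral_symm]
  rw [e]
  exact h.fun_neg

theorem contDiff_cutoff : ContDiff ℝ ∞ (cutoff f) := by
  rw [contDiff_infty_iff_deriv]
  refine ⟨fun t => (hasDerivAt_cutoff f t).differentiableAt, ?_⟩
  have : deriv (cutoff f) = fun t => -f.normed volume t := funext fun t => (hasDerivAt_cutoff f t).deriv
  rw [this]
  exact f.contDiff_normed.neg

theorem normed_eq_zero {t : ℝ} (ht : t ∉ Ioo (r - f.rOut) (r + f.rOut)) :
    f.normed volume t = 0 := by
  have h : t ∉ Function.support (f.normed volume) := by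
    rwa [f.support_normed_eq, Real.ball_eq_Ioo]
  simpa using h

theorem integral_normed_eq_one {x y : ℝ} (hx : x ≤ r - f.rOut) (hy : r + f.rOut ≤ y) :
    ∫ s in Ioo x y, f.normed volume s = 1 := by
  rw [← f.integral_normed (μ := volume)]
  refine setIntegral_eq_integral_of_forall_compl_eq_zero fun s hs => ?_
  exact normed_eq_zero f fun h => hs ⟨hx.trans_lt h.1, h.2.trans_le hy⟩

theorem cutoff_eq_zero (hr : r + f.rOut ≤ 1) {t : ℝ} (ht : r + f.rOut ≤ t) : cutoff f t = 0 := by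
  refine intervalIntegral.integral_zero_ae (Eventually.of_forall fun s hs => ?_)
  refine normed_eq_zero f fun h => ?_
  have : r + f.rOut < s := (le_min ht hr).trans_lt hs.1
  linarith [h.2]

theorem cutoff_eq_one (hr : r + f.rOut ≤ 1) {t : ℝ} (ht : t ≤ r - f.rOut) : cutoff f t = 1 := by
  have := f.rOut_pos
  rw [cutoff, intervalIntegral.integral_of_le (by linarith), integral_Ioc_eq_integral_Ioo]
  exact integral_normed_eq_one f ht hr

theorem cutoff_mem_Icc {t : ℝ} (ht : t ≤ 1) : cutoff f t ∈ Icc (0 : ℝ) 1 := by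
  rw [cutoff, intervalIntegral.integral_of_le ht]
  constructor
  · exact integral_nonneg fun s => f.nonneg_normed s
  · rw [← f.integral_normed (μ := volume)]
    exact setIntegral_le_integral f.integrable_normed (Eventually.of_forall fun s => f.nonneg_normed s)

/-- Near the origin, where the norm is not smooth, the cutoff is constantly 1. -/
theorem contDiff_cutoff_norm (h0 : f.rOut < r) (hr : r + f.rOut ≤ 1) :
    ContDiff ℝ ∞ fun x : Space d => cutoff f ‖x‖ := by
  rw [contDiff_iff_contDiffAt]
  intro x
  by_cases hx : x = 0
  · have : (fun x : Space d => cutoff f ‖x‖) =ᶠ[𝓝 x] fun _ => 1 := by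
      rw [hx]
      filter_upwards [ball_mem_nhds (0 : Space d) (sub_pos.2 h0)] with y hy
      exact cutoff_eq_one f hr (by simpa using (mem_ball_zero_iff.1 hy).le)
    exact contDiffAt_const.congr_of_eventuallyEq this
  · exact (contDiff_cutoff f).contDiffAt.comp x (contDiffAt_norm ℝ hx)

theorem partialDeriv_mul_cutoff {φ : Space d → ℝ} (hφ : ContDiff ℝ ∞ φ) (i : Fin (d + 1))
    {x : Space d} (hx : x ≠ 0) :
    partialDeriv i (fun x => φ x * cutoff f ‖x‖) x =
      partialDeriv i φ x * cutoff f ‖x‖ - φ x * (f.normed volume ‖x‖ * (x i / ‖x‖)) := by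
  have hn : HasFDerivAt (fun x : Space d => ‖x‖) (‖x‖⁻¹ • innerSL ℝ x) x := by
    have h1 := (hasStrictFDerivAt_norm_sq x).hasFDerivAt.sqrt (by simpa using hx)
    simp only [Real.sqrt_sq (norm_nonneg _)] at h1
    refine h1.congr_fderiv ?_
    ext v
    simp
    field_simp
  have h1 : HasFDerivAt φ (fderiv ℝ φ x) x :=
    (hφ.differentiable (by norm_num)).differentiableAt.hasFDerivAt
  have h2 := (hasDerivAt_cutoff f ‖x‖).comp_hasFDerivAt x hn
  have h3 : HasFDerivAt (fun x : Space d => φ x * cutoff f ‖x‖) _ x := h1.mul h2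
  rw [partialDeriv, h3.fderiv, partialDeriv]
  simp [EuclideanSpace.inner_single_right]
  ring

/-- Bump functions are approximate identities. -/
theorem abs_setIntegral_normed_mul_sub_le {p q : ℝ} (hp : p ≤ r - f.rOut) (hq : r + f.rOut ≤ q)
    {k : ℝ → ℝ} (hk : IntegrableOn (fun s => f.normed volume s * k s) (Ioo p q)) {ε : ℝ}
    (hε : ∀ s ∈ Ioo (r - f.rOut) (r + f.rOut), |k s - k r| ≤ ε) :
    |(∫ s in Ioo p q, f.normed volume s * k s) - k r| ≤ ε := by
  have h1 := integral_normed_eq_one f hp hq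
  have hi : IntegrableOn (f.normed volume) (Ioo p q) := f.integrable_normed.integrableOn
  have e : (∫ s in Ioo p q, f.normed volume s * k s) - k r =
      ∫ s in Ioo p q, f.normed volume s * (k s - k r) := by
    simp only [mul_sub]
    rw [integral_sub hk (hi.mul_const _), integral_mul_const, h1, one_mul]
  rw [e, ← Real.norm_eq_abs]
  calc _ ≤ ∫ s in Ioo p q, f.normed volume s * ε := by
        refine norm_integral_le_of_norm_le (hi.mul_const ε) (Eventually.of_forall fun s => ?_)
        rw [norm_mul, Real.norm_of_nonneg (f.nonneg_normed s)]
        by_cases hs : s ∈ Ioo (r - f.rOut) (r + f.rOut)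
        · exact mul_le_mul_of_nonneg_left (hε s hs) (f.nonneg_normed s)
        · rw [normed_eq_zero f hs, zero_mul, zero_mul]
    _ = ε := by rw [integral_mul_const, h1, one_mul]

end Cutoff

/-- A sequence of bump functions at `r` whose supports shrink. -/
noncomputable def bumpSeq (r : ℝ) {δ : ℝ} (hδ : 0 < δ) (j : ℕ) : ContDiffBump r where
  rIn := δ / (2 * ((j : ℝ) + 1))
  rOut := δ / ((j : ℝ) + 1)
  rIn_pos := by positivity
  rIn_lt_rOut := by
    apply div_lt_div_of_pos_left hδ <;> linarith [(Nat.cast_nonneg j : (0 : ℝ) ≤ j)]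

theorem bumpSeq_rOut_le (r : ℝ) {δ : ℝ} (hδ : 0 < δ) (j : ℕ) : (bumpSeq r hδ j).rOut ≤ δ :=
  div_le_self hδ.le (by linarith [(Nat.cast_nonneg j : (0 : ℝ) ≤ j)])

theorem tendsto_bumpSeq_rOut (r : ℝ) {δ : ℝ} (hδ : 0 < δ) :
    Tendsto (fun j => (bumpSeq r hδ j).rOut) atTop (𝓝 0) := by
  have := (tendsto_one_div_add_atTop_nhds_zero_nat (𝕜 := ℝ)).const_mul δ
  simpa [bumpSeq, div_eq_mul_inv] using this

/-- The Gauss-Green formula on balls. -/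
theorem IsSobolevPair.ball_gauss_green {a : ℝ} {u : Space d → ℝ} {G : Space d → Space d}
    (h : IsSobolevPair a u G) (ha : a < 1) {r : ℝ} (hr : r ∈ Ioo (0 : ℝ) 1) (i : Fin (d + 1))
    {φ : Space d → ℝ} (hφ : ContDiff ℝ ∞ φ) (hφc : HasCompactSupport φ) :
    ∫ x in ball 0 r, (u x * partialDeriv i φ x + G x i * φ x) =
      r ^ d * ∫ θ, rayValue u G θ r * φ (r • θ) * θ i ∂(unitSphereMeasure d) := by
  obtain ⟨hr0, hr1⟩ := hr
  -- With this bound on the radii, every bump at `r` lives between `p = r / 2` and `q = (1 + r) / 2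
  -- < 1`.
  set δ := min (r / 4) ((1 - r) / 2) with hδ
  have hδ0 : 0 < δ := lt_min (by linarith) (by linarith)
  have hδr : δ ≤ r / 4 := min_le_left _ _
  have hδ1 : δ ≤ (1 - r) / 2 := min_le_right _ _
  set f := bumpSeq r hδ0 with hf
  have fO : ∀ j, (f j).rOut ≤ δ := fun j => bumpSeq_rOut_le r hδ0 j
  have fT : Tendsto (fun j => (f j).rOut) atTop (𝓝 0) := tendsto_bumpSeq_rOut r hδ0
  set p := r / 2 with hp
  set q := (1 + r) / 2 with hq
  have hp0 : 0 < p := by positivity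
  have hpj : ∀ j, p ≤ r - (f j).rOut := fun j => by linarith [fO j]
  have hqj : ∀ j, r + (f j).rOut ≤ q := fun j => by linarith [fO j]
  have hq1 : q < 1 := by linarith
  obtain ⟨C, hC⟩ := exists_bound_of_hasCompactSupport hφ.continuous hφc
  obtain ⟨C', hC'⟩ := exists_bound_of_hasCompactSupport (continuous_partialDeriv
    (hφ.of_le (by norm_num)) i) (hasCompactSupport_partialDeriv hφc i)
  have hC0 : 0 ≤ C := (norm_nonneg _).trans (hC 0)
  have hui := h.integrableOn ha
  have hGi := integrableOn_apply (h.integrableOn_grad ha) i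
  have hφm := hφ.continuous.measurable
  have hM : IntegrableOn (fun x => u x * partialDeriv i φ x + G x i * φ x) (ball 0 1) :=
    (hui.mul_bdd (c := C') (continuous_partialDeriv (hφ.of_le (by norm_num)) i).aestronglyMeasurable
      (Eventually.of_forall hC')).add (hGi.mul_bdd (c := C) hφ.continuous.aestronglyMeasurable
      (Eventually.of_forall hC))
  have hcm : ∀ j, Measurable fun x : Space d => cutoff (f j) ‖x‖ := fun j =>
    (contDiff_cutoff (f j)).continuous.measurable.comp measurable_norm
  have hnm : ∀ j, Measurable fun x : Space d => (f j).normed volume ‖x‖ := fun j =>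
    (f j).continuous_normed.measurable.comp measurable_norm
  have T1 : Tendsto (fun j => ∫ x in ball 0 1, cutoff (f j) ‖x‖ *
      (u x * partialDeriv i φ x + G x i * φ x)) atTop
      (𝓝 (∫ x in ball 0 r, (u x * partialDeriv i φ x + G x i * φ x))) := by
    have key := tendsto_integral_mul_of_bounded hM (c := fun j x => cutoff (f j) ‖x‖)
      (c' := (ball 0 r).indicator 1) (C := 1) hcm (fun j => ?_) ?_
    · have e : ∀ x : Space d, (ball 0 r).indicator 1 x * (u x * partialDeriv i φ x + G x i * φ x) =
          (ball 0 r).indicator (fun x => u x * partialDeriv i φ x + G x i * φ x) x := by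
        intro x
        by_cases hx : x ∈ ball (0 : Space d) r
        · rw [indicator_of_mem hx, indicator_of_mem hx, Pi.one_apply, one_mul]
        · rw [indicator_of_notMem hx, indicator_of_notMem hx, zero_mul]
      simp only [e] at key
      rwa [setIntegral_indicator measurableSet_ball,
        inter_eq_self_of_subset_right (ball_subset_ball hr1.le)] at key
    · filter_upwards [ae_restrict_mem measurableSet_ball] with x hx
      have := cutoff_mem_Icc (f j) (mem_ball_zero_iff.1 hx).le
      rw [Real.norm_of_nonneg this.1]
      exact this.2
    · have hsph : ∀ᵐ x : Space d, ‖x‖ ≠ r := by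
        have := Measure.addHaar_sphere_of_ne_zero (volume : Measure (Space d)) 0 hr0.ne'
        rw [ae_iff]
        convert this using 2
        ext x
        simp
      filter_upwards [ae_restrict_of_ae hsph] with x hx
      refine tendsto_const_nhds.congr' ?_
      rcases lt_or_gt_of_ne hx with hlt | hgt
      · filter_upwards [fT.eventually_lt_const (sub_pos.2 hlt)] with j hj
        rw [indicator_of_mem (by simpa using hlt), Pi.one_apply,
          cutoff_eq_one (f j) ((hqj j).trans hq1.le) (by linarith)]
      · filter_upwards [fT.eventually_lt_const (sub_pos.2 hgt)] with j hj
        rw [indicator_of_notMem (by simpa using hgt.le),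
          cutoff_eq_zero (f j) ((hqj j).trans hq1.le) (by linarith)]
  have hA : ∀ j, IntegrableOn (fun x => u x * (φ x * ((f j).normed volume ‖x‖ * (x i / ‖x‖))))
      (ball 0 1) := by
    intro j
    obtain ⟨D, hD⟩ := exists_bound_of_hasCompactSupport ((f j).continuous_normed (μ := volume))
      ((f j).hasCompactSupport_normed)
    refine hui.mul_bdd (c := C * D) (hφm.mul ((hnm j).mul (by fun_prop))).aestronglyMeasurable
      (Eventually.of_forall fun x => ?_)
    rw [norm_mul, norm_mul]
    have hx : ‖x i / ‖x‖‖ ≤ 1 := by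
      rw [norm_div, norm_norm]
      exact div_le_one_of_le₀ (PiLp.norm_apply_le x i) (norm_nonneg x)
    refine mul_le_mul (hC x) ?_ (by positivity) hC0
    exact (mul_le_mul (hD _) hx (norm_nonneg _) ((norm_nonneg _).trans (hD 0))).trans_eq (mul_one D)
  -- The distributional gradient is tested with `φ` times the cutoff. The derivative of the cutoff
  -- leaves a layer term that concentrates on the sphere of radius `r`.
  have E1 : ∀ j, ∫ x in ball 0 1, cutoff (f j) ‖x‖ * (u x * partialDeriv i φ x + G x i * φ x) =
      ∫ x in ball 0 1, u x * (φ x * ((f j).normed volume ‖x‖ * (x i / ‖x‖))) := by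
    intro j
    have hψ : ContDiff ℝ ∞ fun x : Space d => φ x * cutoff (f j) ‖x‖ :=
      hφ.mul (contDiff_cutoff_norm (f j) ((fO j).trans_lt (by linarith)) ((hqj j).trans hq1.le))
    have hψs : tsupport (fun x : Space d => φ x * cutoff (f j) ‖x‖) ⊆ closedBall 0 q := by
      refine closure_minimal (fun x hx => ?_) isClosed_closedBall
      rw [mem_closedBall_zero_iff]
      by_contra hlt
      refine hx ?_
      simp only [cutoff_eq_zero (f j) ((hqj j).trans hq1.le) ((hqj j).trans (not_le.1 hlt).le),
        mul_zero]
    have hw := h.isWeakGradient.integral_eq i _ hψ hφc.mul_right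
      (hψs.trans (closedBall_subset_ball hq1))
    have hne : ∀ᵐ x : Space d, x ≠ 0 := by
      simp [ae_iff, measure_singleton]
    have i1 : IntegrableOn (fun x => G x i * (φ x * cutoff (f j) ‖x‖)) (ball 0 1) := by
      refine hGi.mul_bdd (c := C) (hφm.mul (hcm j)).aestronglyMeasurable ?_
      filter_upwards [ae_restrict_mem measurableSet_ball] with x hx
      have := cutoff_mem_Icc (f j) (mem_ball_zero_iff.1 hx).le
      rw [norm_mul, Real.norm_of_nonneg this.1]
      exact (mul_le_of_le_one_right (norm_nonneg _) this.2).trans (hC x)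
    have i2 : IntegrableOn (fun x => cutoff (f j) ‖x‖ * (u x * partialDeriv i φ x + G x i * φ x))
        (ball 0 1) := by
      refine hM.bdd_mul (c := 1) (hcm j).aestronglyMeasurable ?_
      filter_upwards [ae_restrict_mem measurableSet_ball] with x hx
      have := cutoff_mem_Icc (f j) (mem_ball_zero_iff.1 hx).le
      rw [Real.norm_of_nonneg this.1]
      exact this.2
    have e : ∫ x in ball 0 1, u x * partialDeriv i (fun x => φ x * cutoff (f j) ‖x‖) x =
        ∫ x in ball 0 1, (cutoff (f j) ‖x‖ * (u x * partialDeriv i φ x + G x i * φ x) -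
          G x i * (φ x * cutoff (f j) ‖x‖) -
          u x * (φ x * ((f j).normed volume ‖x‖ * (x i / ‖x‖)))) := by
      refine integral_congr_ae ?_
      filter_upwards [ae_restrict_of_ae hne] with x hx
      rw [partialDeriv_mul_cutoff (f j) hφ i hx]
      ring
    have e2 := integral_sub (i2.sub i1) (hA j)
    have e3 := integral_sub i2 i1
    simp only [Pi.sub_apply] at e2
    rw [e, e2, e3] at hw
    linarith
  set k : Space d → ℝ → ℝ := fun θ s => s ^ d * (rayValue u G θ s * (φ (s • θ) * θ i)) with hk
  have hsub : annulus d p q ⊆ ball 0 1 :=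
    (annulus_subset_ball p q).trans (ball_subset_ball hq1.le)
  -- In polar coordinates `u` may be replaced by its ray value. This is continuous in the radius, so
  -- the approximate identity converges to its value at the given `r`, not merely at almost every
  -- radius.
  have E2 : ∀ j, ∫ x in ball 0 1, u x * (φ x * ((f j).normed volume ‖x‖ * (x i / ‖x‖))) =
      ∫ θ, (∫ s in Ioo p q, (f j).normed volume s * k θ s) ∂(unitSphereMeasure d) := by
    intro j
    have e : ∫ x in ball 0 1, u x * (φ x * ((f j).normed volume ‖x‖ * (x i / ‖x‖))) =
        ∫ x in annulus d p q, u x * (φ x * ((f j).normed volume ‖x‖ * (x i / ‖x‖))) := by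
      refine setIntegral_eq_of_subset_of_forall_sdiff_eq_zero measurableSet_ball hsub
        fun x hx => ?_
      rw [normed_eq_zero (f j) fun hx' => hx.2 ⟨(hpj j).trans_lt hx'.1, hx'.2.trans_le (hqj j)⟩]
      ring
    rw [e, integral_annulus ((hA j).mono_set hsub) hp0.le]
    refine integral_congr_ae ?_
    filter_upwards [h.ae_isRegularRay ha] with θ hθ
    refine setIntegral_congr_ae measurableSet_Ioo ?_
    filter_upwards [hθ.ae_eq] with s hs hsm
    have hs0 : 0 < s := hp0.trans hsm.1
    rw [hs ⟨hs0, hsm.2.trans hq1⟩, norm_smul, hθ.norm_eq_one, mul_one, Real.norm_of_nonneg hs0.le, hk]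
    have : (s • θ) i / s = θ i := by
      rw [PiLp.smul_apply, smul_eq_mul, mul_div_cancel_left₀ _ hs0.ne']
    rw [this]
    ring
  -- The bound for ray values requires a left end below `1/4`, which `p` itself need not satisfy.
  obtain ⟨p', hp', hp'4, hp'p⟩ := exists_lt_quarter hp0
  have hkb : ∀ θ, IsRegularRay u G θ → ∀ s ∈ Ioo p' 1,
      ‖k θ s‖ ≤ C * (5 * (rayMass u G p' 1 θ).toReal) := by
    intro θ hθ s hs
    have h1 := enorm_rayValue_le (u := u) (G := G) hθ.norm_eq_one hp'4 (by norm_num : (1 : ℝ) / 2 < 1)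
      hs
    have h2 : ‖rayValue u G θ s‖ ≤ 5 * (rayMass u G p' 1 θ).toReal := by
      have := ENNReal.toReal_mono (ENNReal.mul_ne_top (by norm_num)
        (hθ.rayMass_lt_top p' hp').ne) h1
      simpa using this
    have hs0 : 0 ≤ s := (hp'.trans hs.1).le
    have h3 : ‖s ^ d‖ ≤ 1 := by
      rw [Real.norm_of_nonneg (pow_nonneg hs0 d)]
      exact pow_le_one₀ hs0 hs.2.le
    have h4 : ‖θ i‖ ≤ 1 := hθ.norm_eq_one ▸ PiLp.norm_apply_le θ i
    rw [hk, norm_mul, norm_mul, norm_mul]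
    calc ‖s ^ d‖ * (‖rayValue u G θ s‖ * (‖φ (s • θ)‖ * ‖θ i‖))
        ≤ 1 * ((5 * (rayMass u G p' 1 θ).toReal) * (C * 1)) := by
          gcongr
          exact hC _
      _ = _ := by ring
  have hkc : ∀ θ, IsRegularRay u G θ → ContinuousOn (k θ) (Ioo 0 1) := by
    intro θ hθ
    have h1 := hθ.continuousOn_rayValue h.measurable h.measurable_grad
    have h2 : Continuous fun s : ℝ => φ (s • θ) := hφ.continuous.comp (by fun_prop)
    exact ((continuous_pow d).continuousOn).mul (h1.mul (h2.mul continuous_const).continuousOn)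
  have hkm : Measurable fun z : Space d × ℝ => k z.1 z.2 := by
    have h1 := measurable_rayValue h.measurable h.measurable_grad
    have h2 : Measurable fun z : Space d × ℝ => φ (z.2 • z.1) := hφm.comp (by fun_prop)
    exact (measurable_snd.pow_const d).mul (h1.mul (h2.mul (by fun_prop)))
  have hki : ∀ j θ, IsRegularRay u G θ →
      IntegrableOn (fun s => (f j).normed volume s * k θ s) (Ioo p q) := by
    intro j θ hθ
    refine (f j).integrable_normed.integrableOn.mul_bdd
      (c := C * (5 * (rayMass u G p' 1 θ).toReal))
      (hkm.comp (measurable_const.prodMk measurable_id)).aestronglyMeasurable ?_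
    filter_upwards [ae_restrict_mem measurableSet_Ioo] with s hs
    exact hkb θ hθ s ⟨hp'p.trans hs.1, hs.2.trans hq1⟩
  have hR : Integrable (fun θ => (rayMass u G p' 1 θ).toReal) (unitSphereMeasure d) :=
    integrable_toReal_of_lintegral_ne_top
      (measurable_rayMass h.measurable h.measurable_grad).aemeasurable
      (h.lintegral_rayMass_lt_top ha hp').ne
  have T2 : Tendsto (fun j => ∫ θ, (∫ s in Ioo p q, (f j).normed volume s * k θ s)
      ∂(unitSphereMeasure d)) atTop (𝓝 (∫ θ, k θ r ∂(unitSphereMeasure d))) := by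
    refine tendsto_integral_of_dominated_convergence
      (fun θ => C * (5 * (rayMass u G p' 1 θ).toReal)) (fun j => ?_) ((hR.const_mul 5).const_mul C)
      (fun j => ?_) ?_
    · have : Measurable fun z : Space d × ℝ => (f j).normed volume z.2 * k z.1 z.2 :=
        ((f j).continuous_normed.measurable.comp measurable_snd).mul hkm
      exact (this.stronglyMeasurable.integral_prod_right'
        (ν := volume.restrict (Ioo p q))).aestronglyMeasurable
    · filter_upwards [h.ae_isRegularRay ha] with θ hθ
      have h1 := integral_normed_eq_one (f j) (hpj j) (hqj j)
      calc _ ≤ ∫ s in Ioo p q, (f j).normed volume s * (C * (5 * (rayMass u G p' 1 θ).toReal)) := by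
            refine norm_integral_le_of_norm_le
              ((f j).integrable_normed.integrableOn.mul_const _) ?_
            filter_upwards [ae_restrict_mem measurableSet_Ioo] with s hs
            rw [norm_mul, Real.norm_of_nonneg ((f j).nonneg_normed s)]
            exact mul_le_mul_of_nonneg_left (hkb θ hθ s ⟨hp'p.trans hs.1, hs.2.trans hq1⟩)
              ((f j).nonneg_normed s)
        _ = _ := by rw [integral_mul_const, h1, one_mul]
    · filter_upwards [h.ae_isRegularRay ha] with θ hθ
      rw [Metric.tendsto_nhds]
      intro ε hε
      have hcr := (hkc θ hθ).continuousAt (Ioo_mem_nhds hr0 hr1)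
      obtain ⟨η, hη, hηk⟩ := Metric.continuousAt_iff.1 hcr (ε / 2) (by positivity)
      filter_upwards [fT.eventually_lt_const hη] with j hj
      rw [Real.dist_eq]
      refine (abs_setIntegral_normed_mul_sub_le (f j) (hpj j) (hqj j) (hki j θ hθ)
        fun s hs => ?_).trans_lt (half_lt_self hε)
      have : dist s r < η := by
        rw [Real.dist_eq, abs_lt]
        constructor <;> linarith [hs.1, hs.2]
      exact (hηk this).le
  simp only [E1, E2] at T1
  rw [tendsto_nhds_unique T1 T2, ← integral_const_mul]
  refine integral_congr_ae (Eventually.of_forall fun θ => ?_)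
  simp only [hk]
  ring

/-! ### Traces on spheres -/

theorem IsSobolevPair.isSphereTrace {a : ℝ} {u u₀ : Space d → ℝ} {G : Space d → Space d}
    (h : IsSobolevPair a u G) (ha : a < 1) (hu₀ : ∀ᵐ x, x ∈ ball (0 : Space d) 1 → u₀ x = u x)
    (hG₀ : ∀ᵐ x, x ∈ ball (0 : Space d) 1 → weakGradient u₀ x = G x) {r : ℝ}
    (hr : r ∈ Ioo (0 : ℝ) 1) : IsSphereTrace a u₀ r (sphereValue u G) where
  memLp := by
    rw [memLp_weighted_iff (ae_sphereMeasure_lastCoord_ne_zero hr.1)]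
    refine ⟨(measurable_sphereValue h.measurable h.measurable_grad).aestronglyMeasurable, ?_⟩
    rw [integrable_sphereMeasure hr.1]
    refine ((h.integrable_rayValue_sq ha hr).const_mul (r ^ a)).congr ?_
    filter_upwards [ae_norm_eq_one] with θ hθ
    rw [sphereValue_smul u G hθ hr.1, weight_smul a hr.1.le, Real.norm_eq_abs, sq_abs]
    ring
  gauss_green := by
    intro i φ hφ hφc
    have e : ∫ x in ball 0 r, (u₀ x * partialDeriv i φ x + weakGradient u₀ x i * φ x) =
        ∫ x in ball 0 r, (u x * partialDeriv i φ x + G x i * φ x) := by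
      refine setIntegral_congr_ae measurableSet_ball ?_
      filter_upwards [hu₀, hG₀] with x hx hx' hxr
      have hxb := ball_subset_ball hr.2.le hxr
      rw [hx hxb, hx' hxb]
    rw [e, h.ball_gauss_green ha hr i hφ hφc, integral_sphereMeasure hr.1]
    congr 1
    refine integral_congr_ae ?_
    filter_upwards [ae_norm_eq_one] with θ hθ
    rw [sphereValue_smul u G hθ hr.1, PiLp.smul_apply, smul_eq_mul, mul_div_cancel_left₀ _ hr.1.ne']

theorem IsSphereTrace.integrable {a r : ℝ} {u T : Space d → ℝ} (h : IsSphereTrace a u r T)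
    (ha : a < 1) (hr : 0 < r) : Integrable T (sphereMeasure d r) := by
  have h1 := (memLp_weighted_iff (ae_sphereMeasure_lastCoord_ne_zero hr)).1 h.memLp
  exact integrable_of_integrable_sq_weight (ae_sphereMeasure_lastCoord_ne_zero hr)
    (integrable_weight_sphereMeasure (by linarith) hr) h1.1 h1.2

/-- The Gauss-Green formula sees a trace only multiplied by the components `x i / r` of the normal.
Testing with `φ x * x i` and summing over `i` produces `|x|² / r = r`, which recovers the trace
tested with `φ` alone. -/
theorem IsSphereTrace.ae_eq {a r : ℝ} {u T T' : Space d → ℝ} (h : IsSphereTrace a u r T)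
    (h' : IsSphereTrace a u r T') (ha : a < 1) (hr : 0 < r) :
    ∀ᵐ x ∂(sphereMeasure d r), T x = T' x := by
  have hT := h.integrable ha hr
  have hT' := h'.integrable ha hr
  have hnorm : ∀ᵐ x ∂(sphereMeasure d r), ‖x‖ = r := by
    rw [ae_sphereMeasure hr]
    filter_upwards [ae_norm_eq_one] with θ hθ
    rw [norm_smul, hθ, mul_one, Real.norm_of_nonneg hr.le]
  have key : ∀ᵐ x ∂(sphereMeasure d r), T x - T' x = 0 := by
    refine ae_eq_zero_of_integral_contDiff_smul_eq_zero (hT.sub hT').locallyIntegrable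
      fun φ hφ hφc => ?_
    obtain ⟨C, hC⟩ := exists_bound_of_hasCompactSupport hφ.continuous hφc
    have hi : ∀ i : Fin (d + 1), ∀ {S : Space d → ℝ}, Integrable S (sphereMeasure d r) →
        Integrable (fun x => S x * (φ x * x i) * (x i / r)) (sphereMeasure d r) := by
      intro i S hS
      have hc : Continuous fun x : Space d => φ x * x i * (x i / r) := by
        have := hφ.continuous
        fun_prop
      have hcs : HasCompactSupport fun x : Space d => φ x * x i * (x i / r) :=
        (hφc.mul_right).mul_right
      obtain ⟨D, hD⟩ := exists_bound_of_hasCompactSupport hc hcs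
      refine (hS.mul_bdd (c := D) hc.aestronglyMeasurable (Eventually.of_forall hD)).congr
        (Eventually.of_forall fun x => ?_)
      ring
    have hz : ∀ i : Fin (d + 1), ∫ x, (T x - T' x) * (φ x * x i) * (x i / r) ∂(sphereMeasure d r) =
        0 := by
      intro i
      have hs : ContDiff ℝ ∞ fun x : Space d => φ x * x i := hφ.mul (by fun_prop)
      have e1 := h.gauss_green i _ hs hφc.mul_right
      have e2 := h'.gauss_green i _ hs hφc.mul_right
      simp only [sub_mul]
      rw [integral_sub (hi i hT) (hi i hT'), ← e1, ← e2, sub_self]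
    have hsum : ∫ x, ∑ i, (T x - T' x) * (φ x * x i) * (x i / r) ∂(sphereMeasure d r) = 0 := by
      have hi' : ∀ i, Integrable (fun x => (T x - T' x) * (φ x * x i) * (x i / r))
        (sphereMeasure d r) := fun i => hi i (hT.sub hT')
      rw [integral_finsetSum _ fun i _ => hi' i]
      exact Finset.sum_eq_zero fun i _ => hz i
    have e : ∫ x, ∑ i, (T x - T' x) * (φ x * x i) * (x i / r) ∂(sphereMeasure d r) =
        r * ∫ x, φ x • (T x - T' x) ∂(sphereMeasure d r) := by
      rw [← integral_const_mul]
      refine integral_congr_ae ?_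
      filter_upwards [hnorm] with x hx
      have h1 : ∑ i, x i ^ 2 = r ^ 2 := by rw [← hx, EuclideanSpace.real_norm_sq_eq]
      have h2 : ∀ i, (T x - T' x) * (φ x * x i) * (x i / r) =
          (T x - T' x) * φ x / r * x i ^ 2 := fun i => by ring
      simp only [h2, ← Finset.mul_sum, h1, smul_eq_mul]
      field_simp
    rw [e] at hsum
    exact (mul_eq_zero.1 hsum).resolve_left hr.ne'
  filter_upwards [key] with x hx using sub_eq_zero.1 hx

theorem IsSphereTrace.sphereTrace_ae_eq {a r : ℝ} {u T : Space d → ℝ} (h : IsSphereTrace a u r T)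
    (ha : a < 1) (hr : 0 < r) : ∀ᵐ x ∂(sphereMeasure d r), sphereTrace a u r x = T x := by
  have hex : ∃ T, IsSphereTrace a u r T := ⟨T, h⟩
  have hT : IsSphereTrace a u r (sphereTrace a u r) := by
    rw [sphereTrace, dif_pos hex]
    exact hex.choose_spec
  exact hT.ae_eq h ha hr

/-! ### The growth of the Weiss energy -/

/-- The weighted mean square of `u` over spheres, scaled to the unit sphere. -/
noncomputable def sphereEnergy (a : ℝ) (u : Space d → ℝ) (G : Space d → Space d) (r : ℝ) : ℝ :=
  ∫ θ, (r ^ (-(1 - a)) * rayValue u G θ r) ^ 2 * weight a θ ∂(unitSphereMeasure d)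

/-- The Weiss energy in terms of a representative. -/
theorem IsSobolevPair.weiss_eq {a : ℝ} {u u₀ : Space d → ℝ} {G : Space d → Space d}
    (h : IsSobolevPair a u G) (ha : a < 1) (hu₀ : ∀ᵐ x, x ∈ ball (0 : Space d) 1 → u₀ x = u x)
    (hG₀ : ∀ᵐ x, x ∈ ball (0 : Space d) 1 → weakGradient u₀ x = G x) (lamP lamM : ℝ) {r : ℝ}
    (hr : r ∈ Ioo (0 : ℝ) 1) :
    weiss a lamP lamM u₀ r = 2 * (r ^ (-((d : ℝ) + 1 - a)) * localEnergy a lamP lamM u G r) -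
      (1 - a) * sphereEnergy a u G r := by
  have hr0 := hr.1
  have e1 : dirichletEnergy a u₀ r = ∫ x in ball 0 r, ‖G x‖ ^ 2 * weight a x := by
    refine setIntegral_congr_ae (μ := volume) measurableSet_ball ?_
    filter_upwards [hG₀] with x hx hxr
    rw [hx (ball_subset_ball hr.2.le hxr)]
  have e2 : thinEnergy lamP lamM u₀ r = ∫ y in ball (0 : EuclideanSpace ℝ (Fin d)) r,
      thinDensity lamP lamM (thinFormula u G y) := by
    rw [thinEnergy, setIntegral_thinMeasure]
    refine setIntegral_congr_ae (μ := volume) measurableSet_ball ?_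
    filter_upwards [h.thinTrace_ae_eq ha hu₀ hG₀] with x hx hxr
    rw [hx (ball_subset_ball hr.2.le hxr), thinDensity]
  have e3 : ∫ x, sphereTrace a u₀ r x ^ 2 * weight a x ∂(sphereMeasure d r) =
      r ^ d * r ^ a * ∫ θ, rayValue u G θ r ^ 2 * weight a θ ∂(unitSphereMeasure d) := by
    rw [integral_sphereMeasure hr0, mul_assoc]
    congr 1
    rw [← integral_const_mul]
    refine integral_congr_ae ?_
    filter_upwards [(ae_sphereMeasure hr0).1 ((h.isSphereTrace ha hu₀ hG₀ hr).sphereTrace_ae_eq ha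
      hr0), ae_norm_eq_one] with θ hθ hθ1
    rw [hθ, sphereValue_smul u G hθ1 hr0, weight_smul a hr0.le]
    ring
  have e4 : sphereEnergy a u G r = (r ^ (-(1 - a))) ^ 2 *
      ∫ θ, rayValue u G θ r ^ 2 * weight a θ ∂(unitSphereMeasure d) := by
    rw [sphereEnergy, ← integral_const_mul]
    refine integral_congr_ae (Eventually.of_forall fun θ => ?_)
    ring
  -- Surface measure gives `r^d` and the weight gives `r^a`; the remaining power is exactly the one
  -- that scales `u` by `r^(-(1 - a))`.
  have e5 : 1 / r ^ ((d : ℝ) + 1 + 1 - a) * (r ^ d * r ^ a) = (r ^ (-(1 - a))) ^ 2 := by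
    rw [one_div, ← Real.rpow_neg hr0.le, ← Real.rpow_natCast, ← Real.rpow_natCast,
      ← Real.rpow_add hr0, ← Real.rpow_add hr0, ← Real.rpow_mul hr0.le]
    congr 1
    push_cast
    ring
  have e6 : 1 / r ^ ((d : ℝ) + 1 - a) = r ^ (-((d : ℝ) + 1 - a)) := by
    rw [one_div, Real.rpow_neg hr0.le]
  rw [weiss, e1, e2, e3, e4, ← e5, localEnergy, integral_const_mul, ← e6]
  ring

theorem integrableOn_annulus_rpow_mul {f : Space d → ℝ} (hf : IntegrableOn f (ball 0 1)) {p q : ℝ}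
    (hp : 0 < p) (hq : q ≤ 1) {s : ℝ} (hs : 0 ≤ s) :
    IntegrableOn (fun x => ‖x‖ ^ (-s) * f x) (annulus d p q) := by
  refine (hf.mono_set ((annulus_subset_ball p q).trans (ball_subset_ball hq))).bdd_mul
    (c := p ^ (-s)) (measurable_norm.pow_const _).aestronglyMeasurable ?_
  filter_upwards [ae_restrict_mem (measurableSet_annulus p q)] with x hx
  rw [Real.norm_of_nonneg (Real.rpow_nonneg (norm_nonneg x) _)]
  exact Real.rpow_le_rpow_of_nonpos hp hx.1.le (by linarith)

/-- The growth of the scaled mean square over spheres. -/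
theorem IsSobolevPair.sphereEnergy_sub {a : ℝ} {u : Space d → ℝ} {G : Space d → Space d}
    (h : IsSobolevPair a u G) (ha : a < 1) {p q : ℝ} (hp : 0 < p) (hpq : p < q) (hq : q < 1) :
    sphereEnergy a u G q - sphereEnergy a u G p =
      2 * ((∫ y in annulus d p q, ‖y‖ ^ (-((d : ℝ) + 1 - a + 2)) *
          (u y * inner ℝ y (G y) * weight a y)) -
        (1 - a) * ∫ y in annulus d p q, ‖y‖ ^ (-((d : ℝ) + 1 - a + 2)) *
          (‖u y‖ ^ 2 * weight a y)) := by
  have hs : 0 ≤ (d : ℝ) + 1 - a + 2 := by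
    have : (0 : ℝ) ≤ d := Nat.cast_nonneg d
    linarith
  have hp1 : p ∈ Ioo (0 : ℝ) 1 := ⟨hp, hpq.trans hq⟩
  have hq1 : q ∈ Ioo (0 : ℝ) 1 := ⟨hp.trans hpq, hq⟩
  have i1 := integrableOn_annulus_rpow_mul h.integrableOn_mul_inner hp hq.le hs
  have i2 := (integrableOn_annulus_rpow_mul h.integrable_sq hp hq.le hs).const_mul (1 - a)
  have hC : ∀ r ∈ Ioo (0 : ℝ) 1, Integrable
      (fun θ => (r ^ (-(1 - a)) * rayValue u G θ r) ^ 2 * weight a θ) (unitSphereMeasure d) := by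
    intro r hr
    refine ((h.integrable_rayValue_sq ha hr).const_mul ((r ^ (-(1 - a))) ^ 2)).congr
      (Eventually.of_forall fun θ => ?_)
    ring
  have i3 : IntegrableOn (fun x => 2 * (‖x‖ ^ (-((d : ℝ) + 1 - a + 2)) *
      (u x * inner ℝ x (G x) * weight a x) - (1 - a) * (‖x‖ ^ (-((d : ℝ) + 1 - a + 2)) *
      (‖u x‖ ^ 2 * weight a x)))) (annulus d p q) := (i1.sub i2).const_mul 2
  rw [← integral_const_mul, ← integral_sub i1 i2, ← integral_const_mul,
    integral_annulus i3 hp.le, sphereEnergy, sphereEnergy, ← integral_sub (hC q hq1) (hC p hp1)]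
  refine integral_congr_ae ?_
  filter_upwards [h.ae_isRegularRay ha] with θ hθ
  rw [← sub_mul, hθ.scaled_sq_sub h.measurable h.measurable_grad (1 - a) hp hpq.le hq,
    ← integral_mul_const]
  refine setIntegral_congr_fun measurableSet_Ioo fun r hr => ?_
  have hr0 : 0 < r := hp.trans hr.1
  -- The polar Jacobian, the kernel of the ring and the weight combine to the power produced by
  -- differentiating the square on a ray.
  have e : r ^ d * r ^ (-((d : ℝ) + 1 - a + 2)) * r ^ a = r ^ (-(2 * (1 - a)) - 1) := by
    rw [← Real.rpow_natCast, ← Real.rpow_add hr0, ← Real.rpow_add hr0]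
    congr 1
    ring
  simp only [norm_smul, hθ.norm_eq_one, mul_one, Real.norm_of_nonneg hr0.le, weight_smul a hr0.le]
  rw [← e, inner_smul_left, conj_trivial, real_inner_comm θ, Real.norm_eq_abs, sq_abs]
  ring

/-- The growth of the Weiss energy of a minimizer. -/
theorem IsMinimizer.weiss_sub {a lamP lamM : ℝ} (ha : a < 1) {g u₀ : Space d → ℝ}
    (hmin : IsMinimizer a lamP lamM g u₀) {u : Space d → ℝ} {G : Space d → Space d}
    (h : IsSobolevPair a u G) (hu₀ : ∀ᵐ x, x ∈ ball (0 : Space d) 1 → u₀ x = u x)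
    (hG₀ : ∀ᵐ x, x ∈ ball (0 : Space d) 1 → weakGradient u₀ x = G x)
    {p q : ℝ} (hp : 0 < p) (hpq : p < q) (hq : q < 1) :
    weiss a lamP lamM u₀ q - weiss a lamP lamM u₀ p =
      2 * ∫ y in annulus d p q, ‖y‖ ^ (-((d : ℝ) + 1 - a + 2)) *
        ((inner ℝ y (G y) - (1 - a) * u y) ^ 2 * weight a y) := by
  have hs : 0 ≤ (d : ℝ) + 1 - a + 2 := by
    have : (0 : ℝ) ≤ d := Nat.cast_nonneg d
    linarith
  rw [h.weiss_eq ha hu₀ hG₀ lamP lamM ⟨hp.trans hpq, hq⟩,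
    h.weiss_eq ha hu₀ hG₀ lamP lamM ⟨hp, hpq.trans hq⟩]
  have e1 := hmin.localEnergy_sub ha h hu₀ hG₀ hp hpq hq
  have e2 := h.sphereEnergy_sub ha hp hpq hq
  have i0 := integrableOn_annulus_rpow_mul h.integrableOn_inner_sq hp hq.le hs
  have i1 := (integrableOn_annulus_rpow_mul h.integrableOn_mul_inner hp hq.le hs).const_mul
    (2 * (1 - a))
  have i2 := (integrableOn_annulus_rpow_mul h.integrable_sq hp hq.le hs).const_mul ((1 - a) ^ 2)
  have e3 : ∫ y in annulus d p q, ‖y‖ ^ (-((d : ℝ) + 1 - a + 2)) *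
        ((inner ℝ y (G y) - (1 - a) * u y) ^ 2 * weight a y) =
      (∫ y in annulus d p q, ‖y‖ ^ (-((d : ℝ) + 1 - a + 2)) *
          ((inner ℝ y (G y)) ^ 2 * weight a y)) -
        2 * (1 - a) * (∫ y in annulus d p q, ‖y‖ ^ (-((d : ℝ) + 1 - a + 2)) *
          (u y * inner ℝ y (G y) * weight a y)) +
        (1 - a) ^ 2 * ∫ y in annulus d p q, ‖y‖ ^ (-((d : ℝ) + 1 - a + 2)) *
          (‖u y‖ ^ 2 * weight a y) := by
    have s1 := integral_sub i0 i1
    have s2 := integral_add (i0.sub i1) i2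
    simp only [Pi.sub_apply] at s2
    rw [integral_const_mul] at s1
    rw [integral_const_mul, s1] at s2
    rw [← s2]
    refine integral_congr_ae (Eventually.of_forall fun y => ?_)
    simp only [Real.norm_eq_abs, sq_abs]
    ring
  rw [e3]
  -- The mixed term occurs once in each identity. Together they give the coefficient `-2 (1 - a)`
  -- inside twice the ring integral, which completes the square.
  linear_combination 2 * e1 - (1 - a) * e2

/-! ### Homogeneity and Euler's relation -/

theorem ae_of_ae_ray {f g : Space d → ℝ} (hf : Measurable f) (hg : Measurable g) {p q : ℝ}
    (hp : 0 ≤ p) (h : ∀ᵐ θ ∂(unitSphereMeasure d), ∀ᵐ r : ℝ, r ∈ Ioo p q →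
      f (r • θ) = g (r • θ)) : ∀ᵐ x, x ∈ annulus d p q → f x = g x := by
  have hm : Measurable fun x => ‖f x - g x‖ₑ := (hf.sub hg).enorm
  have h0 : ∫⁻ x in annulus d p q, ‖f x - g x‖ₑ = 0 := by
    rw [lintegral_annulus hm hp]
    refine (lintegral_congr_ae ?_).trans lintegral_zero
    filter_upwards [h] with θ hθ
    refine (setLIntegral_congr_fun_ae measurableSet_Ioo ?_).trans lintegral_zero
    filter_upwards [hθ] with r hr hr'
    simp [hr hr']
  rw [lintegral_eq_zero_iff hm, EventuallyEq, ae_restrict_iff' (measurableSet_annulus p q)] at h0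
  filter_upwards [h0] with x hx hx'
  have := hx hx'
  rwa [Pi.zero_apply, enorm_eq_zero, sub_eq_zero] at this

theorem IsSobolevPair.ae_eq_sphereValue {a : ℝ} {u : Space d → ℝ} {G : Space d → Space d}
    (h : IsSobolevPair a u G) (ha : a < 1) :
    ∀ᵐ x, x ∈ annulus d 0 1 → u x = sphereValue u G x := by
  refine ae_of_ae_ray h.measurable (measurable_sphereValue h.measurable h.measurable_grad) le_rfl ?_
  filter_upwards [h.ae_isRegularRay ha] with θ hθ
  filter_upwards [hθ.ae_eq] with r hr hr'
  rw [hr hr', sphereValue_smul u G hθ.norm_eq_one hr'.1]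

namespace IsRegularRay

variable {u : Space d → ℝ} {G : Space d → Space d} {θ : Space d}

theorem ae_hasDerivAt_scaled (h : IsRegularRay u G θ) (hu : Measurable u) (hG : Measurable G)
    (κ : ℝ) : ∀ᵐ r : ℝ, r ∈ Ioo (0 : ℝ) 1 → HasDerivAt (fun r => r ^ (-κ) * rayValue u G θ r)
      (r ^ (-κ - 1) * (r * inner ℝ (G (r • θ)) θ - κ * u (r • θ))) r := by
  filter_upwards [h.ae_hasDerivAt_rayValue hu hG, h.ae_eq] with r hr hr' hr01
  have h1 := (Real.hasDerivAt_rpow_const (p := -κ) (Or.inl hr01.1.ne')).mul (hr hr01)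
  refine h1.congr_deriv ?_
  have hr0 := hr01.1.ne'
  rw [hr' hr01, Real.rpow_sub_one hr0]
  field_simp
  ring

/-- Euler's relation makes the derivative of the scaled value vanish almost everywhere. Absolute
continuity is what turns this into constancy. -/
theorem scaled_eq (h : IsRegularRay u G θ) (hu : Measurable u) (hG : Measurable G) {κ p q : ℝ}
    (hp : 0 ≤ p) (hq : q ≤ 1) (hr : ∀ᵐ r : ℝ, r ∈ Ioo p q →
      r * inner ℝ (G (r • θ)) θ = κ * u (r • θ)) {x y : ℝ} (hx : x ∈ Ioo p q) (hy : y ∈ Ioo p q) :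
    x ^ (-κ) * rayValue u G θ x = y ^ (-κ) * rayValue u G θ y := by
  have hs : ∀ t ∈ uIcc x y, t ∈ Ioo p q := fun t ht =>
    ⟨(lt_min hx.1 hy.1).trans_le ht.1, ht.2.trans_lt (max_lt hx.2 hy.2)⟩
  have hm : ∀ t ∈ Ioo p q, t ∈ Ioo (0 : ℝ) 1 := fun t ht =>
    ⟨hp.trans_lt ht.1, ht.2.trans_le hq⟩
  have h1 := h.absolutelyContinuous_rayValue hu hG (hm x hx) (hm y hy)
  have h2 : AbsolutelyContinuousOnInterval (fun r : ℝ => r ^ (-κ)) x y := by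
    refine ContDiffOn.absolutelyContinuousOnInterval fun r hr => ?_
    exact (Real.contDiffAt_rpow_const_of_ne (hm r (hs r hr)).1.ne').contDiffWithinAt
  obtain ⟨C, hC⟩ := (h2.fun_mul h1).const_of_ae_hasDerivAt_zero (by
    filter_upwards [hr, h.ae_hasDerivAt_scaled hu hG κ] with t ht ht' hts
    have := ht' (hm t (hs t hts))
    rwa [ht (hs t hts), sub_self, mul_zero] at this)
  exact (hC x left_mem_uIcc).trans (hC y right_mem_uIcc).symm

theorem ae_radial_of_scaled_eq (h : IsRegularRay u G θ) (hu : Measurable u) (hG : Measurable G)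
    {κ p q : ℝ} (hp : 0 ≤ p) (hq : q ≤ 1) (hc : ∀ x ∈ Ioo p q, ∀ y ∈ Ioo p q,
      x ^ (-κ) * rayValue u G θ x = y ^ (-κ) * rayValue u G θ y) :
    ∀ᵐ r : ℝ, r ∈ Ioo p q → r * inner ℝ (G (r • θ)) θ = κ * u (r • θ) := by
  filter_upwards [h.ae_hasDerivAt_scaled hu hG κ] with r hr hrpq
  have hr01 : r ∈ Ioo (0 : ℝ) 1 := ⟨hp.trans_lt hrpq.1, hrpq.2.trans_le hq⟩
  have h0 : HasDerivAt (fun r => r ^ (-κ) * rayValue u G θ r) 0 r := by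
    refine (hasDerivAt_const r (r ^ (-κ) * rayValue u G θ r)).congr_of_eventuallyEq ?_
    filter_upwards [Ioo_mem_nhds hrpq.1 hrpq.2] with x hx using hc x hx r hrpq
  have := (hr hr01).unique h0
  exact sub_eq_zero.1 ((mul_eq_zero.1 this).resolve_left (Real.rpow_pos_of_pos hr01.1 _).ne')

/-- Homogeneity comes with an exceptional null set for each `t`, so only countably many `t` can be
used on one ray. Rational ones suffice: the scaled value is continuous, hence each relation holds at
every radius, and rationals close to `y / x` connect `x` with `y` in the limit. -/
theorem scaled_eq_of_rat (h : IsRegularRay u G θ) (hu : Measurable u) (hG : Measurable G)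
    {κ p q : ℝ} (hp : 0 ≤ p) (hq : q ≤ 1) (hr : ∀ t : ℚ, 0 < t → ∀ᵐ r : ℝ, r ∈ Ioo p q →
      (t : ℝ) * r ∈ Ioo p q → u (((t : ℝ) * r) • θ) = (t : ℝ) ^ κ * u (r • θ))
    {x y : ℝ} (hx : x ∈ Ioo p q) (hy : y ∈ Ioo p q) :
    x ^ (-κ) * rayValue u G θ x = y ^ (-κ) * rayValue u G θ y := by
  set w : ℝ → ℝ := fun r => r ^ (-κ) * rayValue u G θ r with hw
  have hm : ∀ t ∈ Ioo p q, t ∈ Ioo (0 : ℝ) 1 := fun t ht =>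
    ⟨hp.trans_lt ht.1, ht.2.trans_le hq⟩
  have hwc : ContinuousOn w (Ioo p q) := by
    refine ContinuousOn.mul (fun r hr => ?_) ((h.continuousOn_rayValue hu hG).mono hm)
    exact (Real.continuousAt_rpow_const _ _ (Or.inl (hm r hr).1.ne')).continuousWithinAt
  have hrat : ∀ t : ℚ, 0 < t → ∀ r ∈ Ioo p q, (t : ℝ) * r ∈ Ioo p q → w (t * r) = w r := by
    intro t ht
    have ht' : (0 : ℝ) < t := by exact_mod_cast ht
    have hU : IsOpen (Ioo p q ∩ (fun r : ℝ => (t : ℝ) * r) ⁻¹' Ioo p q) :=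
      isOpen_Ioo.inter (isOpen_Ioo.preimage (continuous_const_mul _))
    have he : (fun r => w (t * r)) =ᵐ[volume.restrict
        (Ioo p q ∩ (fun r : ℝ => (t : ℝ) * r) ⁻¹' Ioo p q)] w := by
      rw [EventuallyEq, ae_restrict_iff' hU.measurableSet]
      have h2 := (Measure.quasiMeasurePreserving_smul (volume : Measure ℝ) ht'.ne').ae h.ae_eq
      filter_upwards [hr t ht, h.ae_eq, h2] with r h1 h2 h3 hr
      have h4 := h1 hr.1 hr.2
      rw [h2 (hm r hr.1)] at h4
      rw [smul_eq_mul] at h3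
      rw [h3 (hm _ hr.2)] at h4
      simp only [hw]
      rw [h4, Real.mul_rpow ht'.le (hm r hr.1).1.le, Real.rpow_neg ht'.le]
      field_simp
    have := Measure.eqOn_open_of_ae_eq he hU
      (hwc.comp (continuous_const_mul _).continuousOn fun r hr => hr.2)
      (hwc.mono inter_subset_left)
    exact fun r hr hr' => this ⟨hr, hr'⟩
  have hx0 := (hm x hx).1
  have hy0 := (hm y hy).1
  have hcl : (y / x : ℝ) ∈ closure (range ((↑) : ℚ → ℝ)) := Rat.denseRange_cast _
  have ht1 : Tendsto (fun t : ℝ => t * x) (𝓝 (y / x)) (𝓝 y) := by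
    have : Tendsto (fun t : ℝ => t * x) (𝓝 (y / x)) (𝓝 (y / x * x)) :=
      (continuous_mul_const x).tendsto _
    rwa [div_mul_cancel₀ _ hx0.ne'] at this
  have ht2 : Tendsto (fun t : ℝ => w (t * x)) (𝓝 (y / x)) (𝓝 (w y)) :=
    (hwc.continuousAt (Ioo_mem_nhds hy.1 hy.2)).tendsto.comp ht1
  refine (tendsto_nhds_unique_of_frequently_eq ht2 tendsto_const_nhds ?_).symm
  refine ((mem_closure_iff_frequently.1 hcl).and_eventually ((ht1.eventually
    (Ioo_mem_nhds hy.1 hy.2)).and (lt_mem_nhds (div_pos hy0 hx0)))).mono ?_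
  rintro _ ⟨⟨t, rfl⟩, ht, ht0⟩
  exact hrat t (by exact_mod_cast ht0) x hx ht

end IsRegularRay

theorem smul_inner_ray {G : Space d → Space d} (r : ℝ) (θ : Space d) :
    (inner ℝ (r • θ) (G (r • θ)) : ℝ) = r * inner ℝ (G (r • θ)) θ := by
  rw [inner_smul_left, conj_trivial, real_inner_comm]

/-- Euler's relation in a ring characterizes homogeneity. -/
theorem IsSobolevPair.isHomogeneousInRing_iff {a : ℝ} {u u₀ : Space d → ℝ} {G : Space d → Space d}
    (h : IsSobolevPair a u G) (ha : a < 1) (hu₀ : ∀ᵐ x, x ∈ ball (0 : Space d) 1 → u₀ x = u x)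
    (κ : ℝ) {p q : ℝ} (hp : 0 ≤ p) (hq : q ≤ 1) :
    IsHomogeneousInRing κ u₀ p q ↔
      ∀ᵐ x, x ∈ annulus d p q → (inner ℝ x (G x) : ℝ) = κ * u x := by
  have hb : ∀ x : Space d, ‖x‖ ∈ Ioo p q → x ∈ ball (0 : Space d) 1 := fun x hx =>
    mem_ball_zero_iff.2 (hx.2.trans_le hq)
  constructor
  · intro hh
    have h1 : ∀ t : ℚ, 0 < t → ∀ᵐ x : Space d, ‖x‖ ∈ Ioo p q → ‖(t : ℝ) • x‖ ∈ Ioo p q →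
        u ((t : ℝ) • x) = (t : ℝ) ^ κ * u x := by
      intro t ht
      have ht' : (0 : ℝ) < t := by exact_mod_cast ht
      have h2 := (Measure.quasiMeasurePreserving_smul (volume : Measure (Space d)) ht'.ne').ae hu₀
      filter_upwards [hh t ht', hu₀, h2] with x h3 h4 h5 hx hx'
      rw [← h4 (hb _ hx), ← h5 (hb _ hx'), h3 hx hx']
    -- Countability of the rationals permits one null set of directions for all `t`.
    have h2 : ∀ᵐ θ ∂(unitSphereMeasure d), ∀ t : ℚ, 0 < t → ∀ᵐ r : ℝ, 0 < r →
        (‖r • θ‖ ∈ Ioo p q → ‖(t : ℝ) • r • θ‖ ∈ Ioo p q →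
          u ((t : ℝ) • r • θ) = (t : ℝ) ^ κ * u (r • θ)) :=
      ae_all_iff.2 fun t => by
        by_cases ht : 0 < t
        · filter_upwards [ae_polar (h1 t ht)] with θ hθ _ using hθ
        · exact Eventually.of_forall fun θ ht' => absurd ht' ht
    have hm : Measurable fun x : Space d => (inner ℝ x (G x) : ℝ) :=
      Measurable.inner (𝕜 := ℝ) measurable_id h.measurable_grad
    refine ae_of_ae_ray hm (h.measurable.const_mul κ) hp ?_
    filter_upwards [h2, h.ae_isRegularRay ha] with θ hθ hreg
    simp only [smul_inner_ray]
    refine hreg.ae_radial_of_scaled_eq h.measurable h.measurable_grad hp hq fun x hx y hy =>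
      hreg.scaled_eq_of_rat h.measurable h.measurable_grad hp hq (fun t ht => ?_) hx hy
    filter_upwards [hθ t ht] with r hr hrpq htr
    have hr0 : 0 < r := hp.trans_lt hrpq.1
    have ht' : (0 : ℝ) < t := by exact_mod_cast ht
    have h3 := hr hr0
    rw [smul_smul, norm_smul, norm_smul, hreg.norm_eq_one, mul_one, mul_one,
      Real.norm_of_nonneg hr0.le, Real.norm_of_nonneg (mul_pos ht' hr0).le] at h3
    exact h3 hrpq htr
  · intro hh t ht
    have h1 : ∀ᵐ θ ∂(unitSphereMeasure d), ∀ x ∈ Ioo p q, ∀ y ∈ Ioo p q,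
        x ^ (-κ) * rayValue u G θ x = y ^ (-κ) * rayValue u G θ y := by
      filter_upwards [ae_polar hh, h.ae_isRegularRay ha] with θ hθ hreg x hx y hy
      refine hreg.scaled_eq h.measurable h.measurable_grad hp hq ?_ hx hy
      filter_upwards [hθ] with r hr hrpq
      have hr0 : 0 < r := hp.trans_lt hrpq.1
      rw [← smul_inner_ray]
      exact hr hr0 ((smul_mem_annulus_iff hreg.norm_eq_one hr0).2 hrpq)
    have h2 : ∀ᵐ x, x ∈ ball (0 : Space d) 1 → x ∈ annulus d 0 1 → u₀ x = sphereValue u G x := by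
      filter_upwards [hu₀, h.ae_eq_sphereValue ha] with x hx hx' hxb hxa
      rw [hx hxb, hx' hxa]
    -- Dilations preserve null sets, so `u₀` may be replaced by its representative on rays at `x`
    -- and at `t • x` simultaneously.
    have h3 := (Measure.quasiMeasurePreserving_smul (volume : Measure (Space d)) ht.ne').ae h2
    have hpos : Ioo p q ⊆ Ioo 0 1 := Ioo_subset_Ioo hp hq
    filter_upwards [ae_normalize h1, h2, h3] with x hx h4 h5 hxr htxr
    rw [h4 (hb x hxr) (hpos hxr), h5 (hb _ htxr) (hpos htxr), sphereValue, sphereValue]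
    have hx0 : 0 < ‖x‖ := (hpos hxr).1
    have e : ‖t • x‖⁻¹ • t • x = ‖x‖⁻¹ • x := by
      rw [norm_smul, Real.norm_of_nonneg ht.le, smul_smul]
      congr 1
      field_simp
    have h6 := hx _ htxr _ hxr
    rw [e]
    rw [norm_smul, Real.norm_of_nonneg ht.le] at h6 ⊢
    rw [Real.mul_rpow ht.le hx0.le, mul_comm (t ^ (-κ)), mul_assoc] at h6
    have h7 := mul_left_cancel₀ (Real.rpow_pos_of_pos hx0 _).ne' h6
    rw [← h7, Real.rpow_neg ht.le]
    field_simp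

/-! ### Constancy and monotonicity of the Weiss energy -/

/-- The Weiss energy of a minimizer is constant exactly where Euler's relation holds. -/
theorem IsMinimizer.weiss_const_iff {a lamP lamM : ℝ} (ha : a < 1) {g u₀ : Space d → ℝ}
    (hmin : IsMinimizer a lamP lamM g u₀) {u : Space d → ℝ} {G : Space d → Space d}
    (h : IsSobolevPair a u G) (hu₀ : ∀ᵐ x, x ∈ ball (0 : Space d) 1 → u₀ x = u x)
    (hG₀ : ∀ᵐ x, x ∈ ball (0 : Space d) 1 → weakGradient u₀ x = G x)
    {p q : ℝ} (hp : 0 ≤ p) (hpq : p < q) (hq : q ≤ 1) :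
    (∃ c : ℝ, ∀ r ∈ Ioo p q, weiss a lamP lamM u₀ r = c) ↔
      ∀ᵐ x, x ∈ annulus d p q → (inner ℝ x (G x) : ℝ) = (1 - a) * u x := by
  have hs : 0 ≤ (d : ℝ) + 1 - a + 2 := by
    have : (0 : ℝ) ≤ d := Nat.cast_nonneg d
    linarith
  constructor
  · rintro ⟨c, hc⟩
    have key : ∀ s ∈ Ioo p q, ∀ t ∈ Ioo p q, s < t →
        ∀ᵐ x, x ∈ annulus d s t → (inner ℝ x (G x) : ℝ) = (1 - a) * u x := by
      intro s hs' t ht' hst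
      have hs0 := hp.trans_lt hs'.1
      have ht1 := ht'.2.trans_le hq
      have e := hmin.weiss_sub ha h hu₀ hG₀ hs0 hst ht1
      rw [hc s hs', hc t ht', sub_self, eq_comm, mul_eq_zero, or_iff_right two_ne_zero] at e
      have i0 : IntegrableOn (fun y => (inner ℝ y (G y) - (1 - a) * u y) ^ 2 * weight a y)
          (ball (0 : Space d) 1) := by
        refine ((h.integrableOn_inner_sq.sub (h.integrableOn_mul_inner.const_mul
          (2 * (1 - a)))).add (h.integrable_sq.const_mul ((1 - a) ^ 2))).congr
          (Eventually.of_forall fun y => ?_)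
        simp only [Pi.add_apply, Pi.sub_apply, Real.norm_eq_abs, sq_abs]
        ring
      have i1 := integrableOn_annulus_rpow_mul i0 hs0 ht1.le hs
      -- A nonnegative integrand with vanishing integral is zero almost everywhere. The kernel is
      -- positive in the ring and the weight is positive off the thin space, so the square itself
      -- vanishes.
      rw [integral_eq_zero_iff_of_nonneg (fun y => mul_nonneg (Real.rpow_nonneg (norm_nonneg y) _)
        (mul_nonneg (sq_nonneg _) (weight_nonneg a y))) i1, EventuallyEq,
        ae_restrict_iff' (measurableSet_annulus s t)] at e
      filter_upwards [e, ae_lastCoord_ne_zero] with x hx hx0 hxa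
      have h1 := hx hxa
      rw [Pi.zero_apply, mul_eq_zero, or_iff_right (Real.rpow_pos_of_pos (hs0.trans hxa.1) _).ne',
        mul_eq_zero, or_iff_left (weight_pos a hx0).ne'] at h1
      exact sub_eq_zero.1 (pow_eq_zero_iff two_ne_zero |>.1 h1)
    -- The growth formula needs radii strictly between 0 and 1, so the ring is exhausted by smaller
    -- ones. The shift by 3 keeps each margin below half of the width, also for `n = 0`.
    have hδ : ∀ n : ℕ, 0 < (q - p) / ((n : ℝ) + 3) := fun n => div_pos (by linarith) (by positivity)
    have hδ' : ∀ n : ℕ, (q - p) / ((n : ℝ) + 3) < (q - p) / 2 := fun n =>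
      div_lt_div_of_pos_left (by linarith) (by norm_num)
        (by linarith [(Nat.cast_nonneg n : (0 : ℝ) ≤ n)])
    have hall := fun n : ℕ => key (p + (q - p) / ((n : ℝ) + 3))
      ⟨by linarith [hδ n], by linarith [hδ' n]⟩ (q - (q - p) / ((n : ℝ) + 3))
      ⟨by linarith [hδ' n], by linarith [hδ n]⟩ (by linarith [hδ' n])
    filter_upwards [ae_all_iff.2 hall] with x hx hxa
    have hm : 0 < min (‖x‖ - p) (q - ‖x‖) := lt_min (sub_pos.2 hxa.1) (sub_pos.2 hxa.2)
    obtain ⟨n, hn⟩ := exists_nat_gt ((q - p) / min (‖x‖ - p) (q - ‖x‖))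
    have hlt : (q - p) / ((n : ℝ) + 3) < min (‖x‖ - p) (q - ‖x‖) := by
      rw [div_lt_iff₀ hm] at hn
      rw [div_lt_iff₀ (by positivity)]
      nlinarith
    refine hx n ⟨?_, ?_⟩
    · linarith [hlt.trans_le (min_le_left _ _)]
    · linarith [hlt.trans_le (min_le_right _ _)]
  · intro hae
    have key : ∀ s ∈ Ioo p q, ∀ t ∈ Ioo p q, s < t →
        weiss a lamP lamM u₀ t = weiss a lamP lamM u₀ s := by
      intro s hs' t ht' hst
      rw [← sub_eq_zero, hmin.weiss_sub ha h hu₀ hG₀ (hp.trans_lt hs'.1) hst (ht'.2.trans_le hq)]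
      rw [mul_eq_zero]
      right
      refine (setIntegral_congr_ae (μ := volume) (measurableSet_annulus s t) ?_).trans
        (integral_zero _ _)
      filter_upwards [hae] with x hx hxa
      rw [hx ⟨hs'.1.trans hxa.1, hxa.2.trans ht'.2⟩]
      simp
    have hmid : (p + q) / 2 ∈ Ioo p q := ⟨by linarith, by linarith⟩
    refine ⟨weiss a lamP lamM u₀ ((p + q) / 2), fun r hr => ?_⟩
    rcases lt_trichotomy r ((p + q) / 2) with hlt | heq | hgt
    · exact (key _ hr _ hmid hlt).symm
    · rw [heq]
    · exact key _ hmid _ hr hgt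

theorem IsMinimizer.monotoneOn_weiss {a lamP lamM : ℝ} (ha : a < 1) {g u₀ : Space d → ℝ}
    (hmin : IsMinimizer a lamP lamM g u₀) {u : Space d → ℝ} {G : Space d → Space d}
    (h : IsSobolevPair a u G) (hu₀ : ∀ᵐ x, x ∈ ball (0 : Space d) 1 → u₀ x = u x)
    (hG₀ : ∀ᵐ x, x ∈ ball (0 : Space d) 1 → weakGradient u₀ x = G x) :
    MonotoneOn (weiss a lamP lamM u₀) (Ioo 0 1) := by
  intro p hp q hq hpq
  rcases hpq.eq_or_lt with rfl | hlt
  · rfl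
  rw [← sub_nonneg, hmin.weiss_sub ha h hu₀ hG₀ hp.1 hlt hq.2]
  refine mul_nonneg zero_le_two (integral_nonneg fun y => ?_)
  exact mul_nonneg (Real.rpow_nonneg (norm_nonneg y) _)
    (mul_nonneg (sq_nonneg _) (weight_nonneg a y))

end TwoPhase

theorem theorem4p9 (d : ℕ) (a lamP lamM : ℝ) (ha : a ∈ Set.Ioo (-1 : ℝ) 1)
    (hP : 0 < lamP) (hM : 0 < lamM) (g u : TwoPhase.Space d → ℝ)
    (hg : ∀ᵐ x ∂(TwoPhase.sphereMeasure d 1), g (TwoPhase.reflection x) = g x)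
    (hu : TwoPhase.IsMinimizer a lamP lamM g u) :
    (∃ T, TwoPhase.IsThinTrace u T) ∧
    (∀ r ∈ Set.Ioo (0 : ℝ) 1, ∃ T, TwoPhase.IsSphereTrace a u r T) ∧
    MonotoneOn (TwoPhase.weiss a lamP lamM u) (Set.Ioo 0 1) ∧
    ∀ r₁ r₂ : ℝ, 0 ≤ r₁ → r₁ < r₂ → r₂ ≤ 1 →
      ((∃ c : ℝ, ∀ r ∈ Set.Ioo r₁ r₂, TwoPhase.weiss a lamP lamM u r = c) ↔
        TwoPhase.IsHomogeneousInRing (1 - a) u r₁ r₂) := by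
  -- `u` and its chosen gradient are determined only up to null sets; the work is done with Borel
  -- representatives, on which the formulas along curves and rays are measurable.
  obtain ⟨v, G, h, huv, hG⟩ := hu.memSobolev.exists_isSobolevPair
  refine ⟨⟨_, h.isThinTrace ha.2 huv hG⟩, fun r hr => ⟨_, h.isSphereTrace ha.2 huv hG hr⟩,
    hu.monotoneOn_weiss ha.2 h huv hG, fun r₁ r₂ h₁ h₁₂ h₂ => ?_⟩
  rw [hu.weiss_const_iff ha.2 h huv hG h₁ h₁₂ h₂, h.isHomogeneousInRing_iff ha.2 huv _ h₁ h₂]
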